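/- Let $n\ge 2$ and $0<r<R$. For open balls $B_1,B_2\subset\mathbb{R}^n$ of radii $R$ and $r$ with $\overline{B_2}\subset B_1$, consider on $\Omega=B_1\setminus\overline{B_2}$ the eigenvalue problem $$\begin{cases}\Delta u=0 & \text{in } \Omega,\\ u=0 & \text{on } \partial B_2,\\ \dfrac{\partial u}{\partial n}=\tau u & \text{on } \partial B_1,\end{cases}$$ where $\partial/\partial n$ is the outer normal derivative. It is understood weakly: $\tau\in\mathbb{R}$ is an eigenvalue if there is a nonzero $u\in H^1(\Omega)$ with zero trace on $\partial B_2$ such that $\int_\Omega\nabla u\cdot\nabla v\,dx=\tau\int_{\partial B_1}uv\,d\sigma$ for all $v\in H^1(\Omega)$ with zero trace on $\partial B_2$. Then there is a smallest nonzero eigenvalue $\tau_1(B_1\setminus\overline{B_2})$, and it is positive. Moreover, among all such pairs of balls with the fixed radii $R$ and $r$, $\tau_1(B_1\setminus\overline{B_2})$ attains its maximal value when $B_1$ and $B_2$ are concentric, and only then. -/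

import Mathlib

open MeasureTheory Filter Topology Metric Set
open scoped ContDiff Gradient

noncomputable section

namespace DirichletSteklov

variable {n : ℕ}

/-- The domain `B₁ \ closure B₂`, where `B₁ = B(c₁, R)` and `B₂ = B(c₂, r)`. -/
def perforatedBall (c₁ : EuclideanSpace ℝ (Fin n)) (R : ℝ)
    (c₂ : EuclideanSpace ℝ (Fin n)) (r : ℝ) : Set (EuclideanSpace ℝ (Fin n)) :=
  ball c₁ R \ closedBall c₂ r

/-- The surface measure of the sphere of centre `c` and radius `ρ` in `ℝⁿ`, as a measure on `ℝⁿ`: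
the image of the surface measure of the unit sphere under `y ↦ c + ρ y`, times `ρ ^ (n - 1)`. -/
def surfaceMeasure (c : EuclideanSpace ℝ (Fin n)) (ρ : ℝ) :
    Measure (EuclideanSpace ℝ (Fin n)) :=
  ENNReal.ofReal (ρ ^ (n - 1)) •
    Measure.map (fun y : sphere (0 : EuclideanSpace ℝ (Fin n)) 1 =>
        c + ρ • (y : EuclideanSpace ℝ (Fin n)))
      (volume : Measure (EuclideanSpace ℝ (Fin n))).toSphere

/-- `u ∈ H¹(Ω)` with weak gradient `G`: both are square integrable on `Ω`, and
`∫_Ω u ∂_v φ = - ∫_Ω ⟨G, v⟩ φ` for all test functions `φ ∈ C_c^∞(Ω)` and all directions `v`. -/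
structure IsH1 (Ω : Set (EuclideanSpace ℝ (Fin n))) (u : EuclideanSpace ℝ (Fin n) → ℝ)
    (G : EuclideanSpace ℝ (Fin n) → EuclideanSpace ℝ (Fin n)) : Prop where
  memLp : MemLp u 2 (volume.restrict Ω)
  memLp_grad : MemLp G 2 (volume.restrict Ω)
  weak_grad : ∀ φ : EuclideanSpace ℝ (Fin n) → ℝ, ContDiff ℝ ∞ φ → HasCompactSupport φ →
    tsupport φ ⊆ Ω → ∀ v : EuclideanSpace ℝ (Fin n),
      ∫ x in Ω, u x * fderiv ℝ φ x v = - ∫ x in Ω, inner ℝ (G x) v * φ x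

/-- `t ∈ L²(σ)` is the trace of `u ∈ H¹(Ω)` (with weak gradient `G`) on the part of the boundary
that carries the surface measure `σ`: there are functions `φ k`, smooth up to the boundary, with
`φ k → u` in `H¹(Ω)` and `φ k → t` in `L²(σ)`. (On a Lipschitz domain the restriction map is
continuous from `H¹(Ω)` to `L²(σ)` and smooth functions are dense, so this is the graph of the
trace operator.) -/
def IsTrace (Ω : Set (EuclideanSpace ℝ (Fin n))) (σ : Measure (EuclideanSpace ℝ (Fin n)))
    (u : EuclideanSpace ℝ (Fin n) → ℝ)
    (G : EuclideanSpace ℝ (Fin n) → EuclideanSpace ℝ (Fin n))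
    (t : EuclideanSpace ℝ (Fin n) → ℝ) : Prop :=
  MemLp t 2 σ ∧
    ∃ φ : ℕ → EuclideanSpace ℝ (Fin n) → ℝ, (∀ k, ContDiff ℝ ∞ (φ k)) ∧
      Tendsto (fun k => eLpNorm (fun x => φ k x - u x) 2 (volume.restrict Ω)) atTop (𝓝 0) ∧
      Tendsto (fun k => eLpNorm (fun x => ∇ (φ k) x - G x) 2 (volume.restrict Ω)) atTop (𝓝 0) ∧
      Tendsto (fun k => eLpNorm (fun x => φ k x - t x) 2 σ) atTop (𝓝 0)

/-- `u ∈ H¹(B₁ \ closure B₂)` with weak gradient `G`, trace `t` on `∂B₁` and trace `0` on `∂B₂`. -/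
structure IsAdmissible (c₁ : EuclideanSpace ℝ (Fin n)) (R : ℝ)
    (c₂ : EuclideanSpace ℝ (Fin n)) (r : ℝ) (u : EuclideanSpace ℝ (Fin n) → ℝ)
    (G : EuclideanSpace ℝ (Fin n) → EuclideanSpace ℝ (Fin n))
    (t : EuclideanSpace ℝ (Fin n) → ℝ) : Prop where
  isH1 : IsH1 (perforatedBall c₁ R c₂ r) u G
  trace_outer : IsTrace (perforatedBall c₁ R c₂ r) (surfaceMeasure c₁ R) u G t
  trace_inner : IsTrace (perforatedBall c₁ R c₂ r) (surfaceMeasure c₂ r) u G 0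

/-- `τ` is an eigenvalue of the problem `Δu = 0` in `Ω = B₁ \ closure B₂`, `u = 0` on `∂B₂`,
`∂u/∂n = τ u` on `∂B₁`: there is a nonzero weak solution, that is, a nonzero `u ∈ H¹(Ω)` that
vanishes on `∂B₂` and satisfies `∫_Ω ∇u · ∇v = τ ∫_{∂B₁} u v` for all `v ∈ H¹(Ω)` that vanish
on `∂B₂`. -/
def IsEigenvalue (c₁ : EuclideanSpace ℝ (Fin n)) (R : ℝ)
    (c₂ : EuclideanSpace ℝ (Fin n)) (r : ℝ) (τ : ℝ) : Prop :=
  ∃ u G t, IsAdmissible c₁ R c₂ r u G t ∧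
    ¬ (u =ᵐ[volume.restrict (perforatedBall c₁ R c₂ r)] 0) ∧
    ∀ v H s, IsAdmissible c₁ R c₂ r v H s →
      ∫ x in perforatedBall c₁ R c₂ r, inner ℝ (G x) (H x)
        = τ * ∫ x, t x * s x ∂(surfaceMeasure c₁ R)

/-- The set of nonzero eigenvalues. -/
def nonzeroEigenvalues (c₁ : EuclideanSpace ℝ (Fin n)) (R : ℝ)
    (c₂ : EuclideanSpace ℝ (Fin n)) (r : ℝ) : Set ℝ :=
  {τ | τ ≠ 0 ∧ IsEigenvalue c₁ R c₂ r τ}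

/-- The first nonzero eigenvalue `τ₁(B₁ \ closure B₂)`. -/
def firstEigenvalue (c₁ : EuclideanSpace ℝ (Fin n)) (R : ℝ)
    (c₂ : EuclideanSpace ℝ (Fin n)) (r : ℝ) : ℝ :=
  sInf (nonzeroEigenvalues c₁ R c₂ r)

end DirichletSteklov

end

/-! The reciprocal of the first eigenvalue is the maximum `m` of the quotient ∫_{∂B₁} u² / ∫_Ω |∇u|²
over functions vanishing on ∂B₂. The claim is therefore that `m` is smallest in the concentric case,
and only there. Put I = ∫_r^R s^(1-n) ds, which is `profile n r R`. The concentric value is m =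
R^(n-1) I, and every other position satisfies m > R^(n-1) I.

Lower bound: the test function is w(x) = ∫_r^{|x - c₂|} s^(1-n) ds, harmonic outside the hole and
zero on ∂B₂. Its mean over ∂B₁ equals I for every position of the hole (`integral_radial_sphere`),
so by Jensen its mean square there is at least I² (`le_integral_radial_sq`). Its Dirichlet integral
is largest in the concentric case, strictly (`lintegral_gradient_radial_le`): |∇w| decreases with
the distance to c₂, and B(c₁,R) arises from B(c₂,R) by exchanging two pieces of equal volume, the
new one lying farther from c₂.

Upper bound in the concentric case: on each ray, the fundamental theorem of calculus and
Cauchy–Schwarz with weight s^(n-1) give u(R)² ≤ I ∫ s^(n-1) |∇u|² ds when u(r) = 0. Integration over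
directions gives m ≤ R^(n-1) I (`norm_trace_sq_le_concentric`).

Existence: `exists_maximizer` is an abstract direct method on a Banach space, needing coercivity of
the Dirichlet norm (`exists_norm_le`) and compactness of the trace. The latter appears in
quantitative form: the trace is bounded by a small multiple of the gradient plus finitely many
averages (`exists_trace_le_averages`). All estimates are proved for smooth functions and pass to the
closure of the smooth graph. `isAdmissible_of_mem` and `mem_admissibleSpace` identify the admissible
functions with the elements of a closed space built from this closure. -/

noncomputable section

namespace DirichletSteklov

open scoped ENNReal

/-! ### Polar coordinates and estimates along rays. -/

section Polar

/-- Euclidean space of dimension `n`. -/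
abbrev Euc (n : ℕ) : Type := EuclideanSpace ℝ (Fin n)

/-- The surface measure of the unit sphere. -/
abbrev sphereMeasure (n : ℕ) : Measure (sphere (0 : Euc n) 1) :=
  (volume : Measure (Euc n)).toSphere

variable {n : ℕ}

theorem measurePreserving_polar :
    MeasurePreserving (homeomorphUnitSphereProd (Euc n))
      (Measure.comap (↑) (volume : Measure (Euc n)))
      ((sphereMeasure n).prod (Measure.volumeIoiPow (n - 1))) := by
  simpa using (volume : Measure (Euc n)).measurePreserving_homeomorphUnitSphereProd

theorem lintegral_volumeIoiPow (m : ℕ) (f : ℝ → ℝ≥0∞) (hf : Measurable f) :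
    ∫⁻ s, f s ∂(Measure.volumeIoiPow m) = ∫⁻ s in Ioi (0 : ℝ), ENNReal.ofReal (s ^ m) * f s := by
  rw [Measure.volumeIoiPow, lintegral_withDensity_eq_lintegral_mul _ (by fun_prop) (by fun_prop),
    ← lintegral_subtype_comap measurableSet_Ioi]
  rfl

/-- The polar homeomorphism lives on the complement of the origin, which has full measure; a
translation moves the pole to `c`. The freedom in `c` matters, since the proof uses rays from the
centres of both balls. -/
theorem lintegral_polar (hn : 0 < n) (c : Euc n) (f : Euc n → ℝ≥0∞) (hf : Measurable f) :
    ∫⁻ x, f x = ∫⁻ w, (∫⁻ s in Ioi (0 : ℝ),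
      ENNReal.ofReal (s ^ (n - 1)) * f (c + s • (w : Euc n))) ∂(sphereMeasure n) := by
  have : NeZero n := ⟨hn.ne'⟩
  have : Nonempty (Fin n) := ⟨⟨0, hn⟩⟩
  have h0 : ∫⁻ x, f x = ∫⁻ x, f (c + x) := (lintegral_add_left_eq_self f c).symm
  rw [h0, ← Measure.restrict_univ (μ := (volume : Measure (Euc n))),
    ← setLIntegral_congr (s := ({0} : Set (Euc n))ᶜ) (by simp [ae_eq_univ]),
    ← lintegral_subtype_comap (measurableSet_singleton _).compl,
    ← (measurePreserving_polar (n := n)).symm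
      (homeomorphUnitSphereProd (Euc n)).toMeasurableEquiv |>.lintegral_comp_emb
      (homeomorphUnitSphereProd (Euc n)).symm.measurableEmbedding, lintegral_prod _ (by
        apply Measurable.aemeasurable
        exact hf.comp (measurable_const.add (measurable_subtype_coe.comp
          (homeomorphUnitSphereProd (Euc n)).symm.measurable)))]
  refine lintegral_congr fun w => ?_
  rw [← lintegral_volumeIoiPow (n - 1) (fun s => f (c + s • (w : Euc n))) (by fun_prop)]
  rfl

theorem integral_polar (hn : 0 < n) (c : Euc n) (f : Euc n → ℝ) (hf : Integrable f) :
    ∫ x, f x = ∫ w, (∫ s in Ioi (0 : ℝ),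
      s ^ (n - 1) * f (c + s • (w : Euc n))) ∂(sphereMeasure n) := by
  have : NeZero n := ⟨hn.ne'⟩
  have : Nonempty (Fin n) := ⟨⟨0, hn⟩⟩
  have h0 : ∫ x, f x = ∫ x, f (c + x) := (integral_add_left_eq_self f c).symm
  have hf' : Integrable (fun x => f (c + x)) := hf.comp_add_left c
  have hmp := (measurePreserving_polar (n := n)).symm
      (homeomorphUnitSphereProd (Euc n)).toMeasurableEquiv
  have hemb := (homeomorphUnitSphereProd (Euc n)).symm.measurableEmbedding
  have hi : Integrable (fun x : (({0} : Set (Euc n))ᶜ : Set (Euc n)) => f (c + (x : Euc n)))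
      (Measure.comap (↑) (volume : Measure (Euc n))) :=
    (integrableOn_iff_comap_subtypeVal (measurableSet_singleton _).compl).1 hf'.integrableOn
  rw [h0, ← setIntegral_univ,
    ← setIntegral_congr_set (s := ({0} : Set (Euc n))ᶜ) (by simp [ae_eq_univ]),
    ← integral_subtype_comap (measurableSet_singleton _).compl,
    ← hmp.integral_comp hemb]
  refine (integral_prod _ ((hmp.integrable_comp_emb hemb).2 hi)).trans ?_
  refine integral_congr_ae (ae_of_all _ fun w => ?_)
  simp only [Measure.volumeIoiPow]
  rw [integral_withDensity_eq_integral_toReal_smul (by fun_prop) (by simp),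
    ← integral_subtype_comap measurableSet_Ioi]
  refine integral_congr_ae (ae_of_all _ fun s => ?_)
  simp only [smul_eq_mul]
  rw [ENNReal.toReal_ofReal (pow_nonneg s.2.le _)]
  rfl

theorem lintegral_surfaceMeasure (c : Euc n) (ρ : ℝ) (f : Euc n → ℝ≥0∞) (hf : Measurable f) :
    ∫⁻ x, f x ∂(surfaceMeasure c ρ) =
      ENNReal.ofReal (ρ ^ (n - 1)) * ∫⁻ w, f (c + ρ • (w : Euc n)) ∂(sphereMeasure n) := by
  rw [surfaceMeasure, lintegral_smul_measure, lintegral_map hf (by fun_prop), smul_eq_mul]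

instance (c : Euc n) (ρ : ℝ) : IsFiniteMeasure (surfaceMeasure c ρ) := by
  have : IsFiniteMeasure (Measure.map (fun y : sphere (0 : Euc n) 1 => c + ρ • (y : Euc n))
      (sphereMeasure n)) := inferInstance
  refine ⟨?_⟩
  rw [surfaceMeasure, Measure.smul_apply, smul_eq_mul]
  exact ENNReal.mul_lt_top ENNReal.ofReal_lt_top (measure_lt_top _ _)

theorem ae_surfaceMeasure_mem_sphere (c : Euc n) {ρ : ℝ} (hρ : 0 ≤ ρ) :
    ∀ᵐ x ∂(surfaceMeasure c ρ), x ∈ sphere c ρ := by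
  refine Measure.ae_smul_measure ?_ _
  refine (ae_map_iff (by fun_prop) (isClosed_sphere (x := c) (ε := ρ)).measurableSet).2 ?_
  refine ae_of_all _ fun y => ?_
  simp [norm_smul, abs_of_nonneg hρ]

/-- Integral of `s ^ (1 - n)` over `[a, b]`. -/
def radialResistance (n : ℕ) (a b : ℝ) : ℝ := ∫ s in a..b, (s ^ (n - 1))⁻¹

theorem hasDerivAt_comp_ray {φ : Euc n → ℝ} (hφ : ContDiff ℝ 1 φ) (c w : Euc n) (s : ℝ) :
    HasDerivAt (fun s : ℝ => φ (c + s • w)) (fderiv ℝ φ (c + s • w) w) s := by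
  have h1 : HasDerivAt (fun s : ℝ => c + s • w) w s := by
    simpa using ((hasDerivAt_id s).smul_const w).const_add c
  exact ((hφ.differentiable one_ne_zero).differentiableAt.hasFDerivAt).comp_hasDerivAt s h1

theorem norm_gradient_eq (φ : Euc n → ℝ) (x : Euc n) : ‖∇ φ x‖ = ‖fderiv ℝ φ x‖ := by
  simp [gradient]

theorem continuous_gradient {φ : Euc n → ℝ} (hφ : ContDiff ℝ 1 φ) : Continuous (∇ φ) :=
  (InnerProductSpace.toDual ℝ (Euc n)).symm.continuous.comp (hφ.continuous_fderiv one_ne_zero)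

/-- Weighted Cauchy–Schwarz on an interval. -/
theorem sq_integral_le_weighted {f g : ℝ → ℝ} {a b : ℝ} (hab : a ≤ b)
    (hf : ContinuousOn f (Icc a b)) (hg : ContinuousOn g (Icc a b)) (hg0 : ∀ s ∈ Icc a b, 0 < g s) :
    (∫ s in a..b, f s) ^ 2 ≤ (∫ s in a..b, (g s)⁻¹) * ∫ s in a..b, g s * f s ^ 2 := by
  rcases hab.eq_or_lt with rfl | hab'
  · simp
  have hgi : ContinuousOn (fun s => (g s)⁻¹) (Icc a b) := hg.inv₀ fun s hs => (hg0 s hs).ne'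
  have hpos : 0 < ∫ s in a..b, (g s)⁻¹ := by
    apply intervalIntegral.intervalIntegral_pos_of_pos_on _ _ hab'
    · exact ContinuousOn.intervalIntegrable (by rwa [uIcc_of_le hab])
    · intro s hs
      exact inv_pos.2 (hg0 s (Ioo_subset_Icc_self hs))
  set I := ∫ s in a..b, (g s)⁻¹
  set J := ∫ s in a..b, f s with hJ
  have ii : ∀ {h : ℝ → ℝ}, ContinuousOn h (Icc a b) → IntervalIntegrable h volume a b := fun h =>
    ContinuousOn.intervalIntegrable (by rwa [uIcc_of_le hab])
  -- Expand the square of the distance from f to its projection on 1/g in the space with weight g;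
  -- the projection coefficient is J / I.
  have key : 0 ≤ ∫ s in a..b, g s * (f s - J / I * (g s)⁻¹) ^ 2 := by
    apply intervalIntegral.integral_nonneg hab
    intro s hs
    exact mul_nonneg (hg0 s hs).le (sq_nonneg _)
  have e : ∫ s in a..b, g s * (f s - J / I * (g s)⁻¹) ^ 2
      = (∫ s in a..b, g s * f s ^ 2) - 2 * (J / I) * J + (J / I) ^ 2 * I := by
    have : ∫ s in a..b, g s * (f s - J / I * (g s)⁻¹) ^ 2 = ∫ s in a..b,
        (g s * f s ^ 2 - 2 * (J / I) * f s + (J / I) ^ 2 * (g s)⁻¹) := by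
      apply intervalIntegral.integral_congr
      intro s hs
      rw [uIcc_of_le hab] at hs
      have := (hg0 s hs).ne'
      simp only
      field_simp
      ring
    rw [this, intervalIntegral.integral_add, intervalIntegral.integral_sub,
      intervalIntegral.integral_const_mul, intervalIntegral.integral_const_mul]
    · exact ii (hg.mul (hf.pow 2))
    · exact (ii hf).const_mul _
    · exact (ii (hg.mul (hf.pow 2))).sub ((ii hf).const_mul _)
    · exact (ii hgi).const_mul _
  rw [e] at key
  have : (J / I) * I = J := by field_simp
  have h2 : 2 * (J / I) * J - (J / I) ^ 2 * I = J ^ 2 / I := by field_simp; ring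
  have h3 : J ^ 2 / I ≤ ∫ s in a..b, g s * f s ^ 2 := by linarith
  rw [div_le_iff₀ hpos] at h3
  linarith

/-- Fundamental theorem of calculus on the ray, then Cauchy–Schwarz with the polar density s^(n-1)
as weight. With this weight the right side integrates over directions to a Dirichlet integral, and
the constant is the sharp one for radial harmonic functions. -/
theorem sq_sub_ray_le {φ : Euc n → ℝ} (hφ : ContDiff ℝ 1 φ) (c w : Euc n) (hw : ‖w‖ = 1)
    {a b : ℝ} (ha : 0 < a) (hab : a ≤ b) :
    ‖φ (c + b • w) - φ (c + a • w)‖ₑ ^ 2 ≤ ENNReal.ofReal (radialResistance n a b) *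
      ∫⁻ s in Ioc a b, ENNReal.ofReal (s ^ (n - 1)) * ‖∇ φ (c + s • w)‖ₑ ^ 2 := by
  have hc : Continuous fun s : ℝ => fderiv ℝ φ (c + s • w) w :=
    ((hφ.continuous_fderiv one_ne_zero).comp (by fun_prop)).clm_apply continuous_const
  have hc2 : Continuous fun s : ℝ => ‖∇ φ (c + s • w)‖ :=
    ((continuous_gradient hφ).comp (by fun_prop)).norm
  have e : ∫ s in a..b, fderiv ℝ φ (c + s • w) w = φ (c + b • w) - φ (c + a • w) :=
    intervalIntegral.integral_eq_sub_of_hasDerivAt (fun s _ => hasDerivAt_comp_ray hφ c w s)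
      (hc.intervalIntegrable _ _)
  have h1 := sq_integral_le_weighted (f := fun s => fderiv ℝ φ (c + s • w) w)
    (g := fun s => s ^ (n - 1)) hab hc.continuousOn (by fun_prop)
    (fun s hs => pow_pos (ha.trans_le hs.1) _)
  rw [e] at h1
  have hI : 0 ≤ radialResistance n a b :=
    intervalIntegral.integral_nonneg hab fun s hs => inv_nonneg.2 (pow_nonneg (ha.le.trans hs.1) _)
  have h2 : ∫ s in a..b, s ^ (n - 1) * (fderiv ℝ φ (c + s • w) w) ^ 2 ≤
      ∫ s in a..b, s ^ (n - 1) * ‖∇ φ (c + s • w)‖ ^ 2 := by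
    apply intervalIntegral.integral_mono_on hab
    · exact Continuous.intervalIntegrable (by fun_prop) _ _
    · exact Continuous.intervalIntegrable (by fun_prop) _ _
    · intro s hs
      apply mul_le_mul_of_nonneg_left _ (pow_nonneg (ha.le.trans hs.1) _)
      rw [← sq_abs, norm_gradient_eq]
      gcongr
      simpa [hw] using (fderiv ℝ φ (c + s • w)).le_opNorm w
  have h3 : (φ (c + b • w) - φ (c + a • w)) ^ 2 ≤ radialResistance n a b *
      ∫ s in a..b, s ^ (n - 1) * ‖∇ φ (c + s • w)‖ ^ 2 :=
    h1.trans (mul_le_mul_of_nonneg_left h2 hI)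
  have h4 : ENNReal.ofReal (∫ s in a..b, s ^ (n - 1) * ‖∇ φ (c + s • w)‖ ^ 2) =
      ∫⁻ s in Ioc a b, ENNReal.ofReal (s ^ (n - 1)) * ‖∇ φ (c + s • w)‖ₑ ^ 2 := by
    rw [intervalIntegral.integral_of_le hab, ofReal_integral_eq_lintegral_ofReal]
    · refine setLIntegral_congr_fun measurableSet_Ioc fun s hs => ?_
      rw [ENNReal.ofReal_mul (pow_nonneg (ha.le.trans hs.1.le) _),
        ENNReal.ofReal_pow (norm_nonneg _), ofReal_norm]
    · exact (Continuous.intervalIntegrable (by fun_prop) a b).1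
    · filter_upwards [ae_restrict_mem measurableSet_Ioc] with s hs
      exact mul_nonneg (pow_nonneg (ha.le.trans hs.1.le) _) (sq_nonneg _)
  rw [← h4, ← ENNReal.ofReal_mul hI, ← ofReal_norm, ← ENNReal.ofReal_pow (norm_nonneg _),
    Real.norm_eq_abs, sq_abs]
  exact ENNReal.ofReal_le_ofReal h3

end Polar

/-! ### Poincaré and trace inequalities for C¹ functions. -/

section SmoothInequalities

variable {n : ℕ}

theorem measurableSet_perforatedBall (c₁ : Euc n) (R : ℝ) (c₂ : Euc n) (r : ℝ) :
    MeasurableSet (perforatedBall c₁ R c₂ r) :=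
  measurableSet_ball.diff measurableSet_closedBall

theorem norm_sphere (w : sphere (0 : Euc n) 1) : ‖(w : Euc n)‖ = 1 := by
  simp

theorem add_smul_mem_ball_iff (c : Euc n) {s : ℝ} (hs : 0 ≤ s) (w : sphere (0 : Euc n) 1) (b : ℝ) :
    c + s • (w : Euc n) ∈ ball c b ↔ s < b := by
  simp [norm_smul, abs_of_nonneg hs]

theorem add_smul_mem_closedBall_iff (c : Euc n) {s : ℝ} (hs : 0 ≤ s) (w : sphere (0 : Euc n) 1)
    (b : ℝ) : c + s • (w : Euc n) ∈ closedBall c b ↔ s ≤ b := by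
  simp [norm_smul, abs_of_nonneg hs]

theorem setLIntegral_polar (hn : 0 < n) (c : Euc n) {S : Set (Euc n)} (hS : MeasurableSet S)
    (f : Euc n → ℝ≥0∞) (hf : Measurable f) :
    ∫⁻ x in S, f x = ∫⁻ w, (∫⁻ s in Ioi (0 : ℝ),
      ENNReal.ofReal (s ^ (n - 1)) * S.indicator f (c + s • (w : Euc n))) ∂(sphereMeasure n) := by
  rw [← lintegral_indicator hS, lintegral_polar hn c _ (hf.indicator hS)]

theorem lintegral_annulus (hn : 0 < n) (c : Euc n) {a : ℝ} (ha : 0 ≤ a) (b : ℝ)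
    (f : Euc n → ℝ≥0∞) (hf : Measurable f) :
    ∫⁻ x in perforatedBall c b c a, f x = ∫⁻ w, (∫⁻ s in Ioo a b,
      ENNReal.ofReal (s ^ (n - 1)) * f (c + s • (w : Euc n))) ∂(sphereMeasure n) := by
  rw [setLIntegral_polar hn c (measurableSet_perforatedBall _ _ _ _) f hf]
  refine lintegral_congr fun w => ?_
  rw [← lintegral_indicator measurableSet_Ioi, ← lintegral_indicator measurableSet_Ioo]
  refine lintegral_congr fun s => ?_
  by_cases hs : 0 < s
  · rw [indicator_of_mem (show s ∈ Ioi (0 : ℝ) from hs)]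
    by_cases h : s ∈ Ioo a b
    · rw [indicator_of_mem h, indicator_of_mem]
      exact ⟨(add_smul_mem_ball_iff c hs.le w b).2 h.2,
        fun h' => h.1.not_ge ((add_smul_mem_closedBall_iff c hs.le w a).1 h')⟩
    · rw [indicator_of_notMem h, indicator_of_notMem, mul_zero]
      intro h'
      exact h ⟨not_le.1 fun h'' => h'.2 ((add_smul_mem_closedBall_iff c hs.le w a).2 h''),
        (add_smul_mem_ball_iff c hs.le w b).1 h'.1⟩
  · rw [indicator_of_notMem (show s ∉ Ioi (0 : ℝ) from hs), indicator_of_notMem]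
    exact fun h => hs (ha.trans_lt h.1)

theorem enorm_sq_le_two_mul {F : Type*} [NormedAddCommGroup F] (x y : F) :
    ‖x‖ₑ ^ 2 ≤ 2 * ‖x - y‖ₑ ^ 2 + 2 * ‖y‖ₑ ^ 2 := by
  have h : ‖x‖ ^ 2 ≤ 2 * ‖x - y‖ ^ 2 + 2 * ‖y‖ ^ 2 := by
    have : ‖x‖ ≤ ‖x - y‖ + ‖y‖ := by simpa using norm_add_le (x - y) y
    nlinarith [sq_nonneg (‖x - y‖ - ‖y‖), norm_nonneg x]
  have h2 := ENNReal.ofReal_le_ofReal h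
  rw [ENNReal.ofReal_add (by positivity) (by positivity), ENNReal.ofReal_mul (by norm_num),
    ENNReal.ofReal_mul (by norm_num), ENNReal.ofReal_pow (norm_nonneg _),
    ENNReal.ofReal_pow (norm_nonneg _), ENNReal.ofReal_pow (norm_nonneg _), ofReal_norm,
    ofReal_norm, ofReal_norm] at h2
  simpa using h2

theorem intervalIntegrable_inv_pow {a b : ℝ} (ha : 0 < a) (hb : 0 < b) (m : ℕ) :
    IntervalIntegrable (fun s : ℝ => (s ^ m)⁻¹) volume a b := by
  apply ContinuousOn.intervalIntegrable
  refine ContinuousOn.inv₀ (by fun_prop) fun s hs => ?_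
  exact (pow_pos (lt_of_lt_of_le (lt_min ha hb) hs.1) _).ne'

theorem radialResistance_nonneg {a b : ℝ} (ha : 0 < a) (hab : a ≤ b) :
    0 ≤ radialResistance n a b :=
  intervalIntegral.integral_nonneg hab fun _ hs => inv_nonneg.2 (pow_nonneg (ha.le.trans hs.1) _)

theorem radialResistance_mono {a s t b : ℝ} (ha : 0 < a) (has : a ≤ s) (hst : s ≤ t) (htb : t ≤ b) :
    radialResistance n s t ≤ radialResistance n a b := by
  apply intervalIntegral.integral_mono_interval has hst htb
  · filter_upwards [ae_restrict_mem measurableSet_Ioc] with x hx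
    exact inv_nonneg.2 (pow_nonneg (ha.le.trans hx.1.le) _)
  · exact intervalIntegrable_inv_pow ha (by linarith) _

theorem radialResistance_pos {a b : ℝ} (ha : 0 < a) (hab : a < b) :
    0 < radialResistance n a b := by
  apply intervalIntegral.intervalIntegral_pos_of_pos_on
    (intervalIntegrable_inv_pow ha (ha.trans hab) _) _ hab
  intro s hs
  exact inv_pos.2 (pow_pos (ha.trans hs.1) _)

/-- For `φ` of class `C¹`, the `L²` distance of its restrictions to two concentric spheres is
controlled by the Dirichlet integral over the annulus in between. -/
theorem lintegral_sphere_sub_le (hn : 0 < n) {φ : Euc n → ℝ} (hφ : ContDiff ℝ 1 φ) (c : Euc n)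
    {a b : ℝ} (ha : 0 < a) (hab : a ≤ b) :
    ∫⁻ w : sphere (0 : Euc n) 1, ‖φ (c + b • (w : Euc n)) - φ (c + a • (w : Euc n))‖ₑ ^ 2
        ∂(sphereMeasure n) ≤
      ENNReal.ofReal (radialResistance n a b) *
        ∫⁻ x in perforatedBall c b c a, ‖∇ φ x‖ₑ ^ 2 := by
  have hm : Measurable fun x => ‖∇ φ x‖ₑ ^ 2 :=
    ((continuous_gradient hφ).measurable.enorm).pow_const 2
  rw [lintegral_annulus hn c ha.le b _ hm, ← lintegral_const_mul' _ _ ENNReal.ofReal_ne_top]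
  refine lintegral_mono fun w => ?_
  refine (sq_sub_ray_le hφ c w (norm_sphere w) ha hab).trans ?_
  rw [setLIntegral_congr Ioo_ae_eq_Ioc]

/-- B₁ is convex and contains c₂, so the part of a ray from c₂ between the hole and a point of the
domain stays in the domain. Its length is below the diameter of B₁. This allows integration from the
inner sphere outwards. -/
theorem ray_subset_perforatedBall {c₁ c₂ : Euc n} {R r : ℝ} (hr : 0 < r)
    (h : closedBall c₂ r ⊆ ball c₁ R) (w : sphere (0 : Euc n) 1) {ρ : ℝ} (hρ : 0 < ρ)
    (hmem : c₂ + ρ • (w : Euc n) ∈ perforatedBall c₁ R c₂ r) :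
    r < ρ ∧ ρ < 2 * R ∧ ∀ s ∈ Ioc r ρ, c₂ + s • (w : Euc n) ∈ perforatedBall c₁ R c₂ r := by
  have h1 : r < ρ := not_le.1 fun h' => hmem.2 ((add_smul_mem_closedBall_iff c₂ hρ.le w r).2 h')
  have hc₂ : c₂ ∈ ball c₁ R := h (mem_closedBall_self hr.le)
  refine ⟨h1, ?_, fun s hs => ⟨?_, fun h' => ?_⟩⟩
  · have h2 : dist (c₂ + ρ • (w : Euc n)) c₂ = ρ := by
      simp [norm_smul, abs_of_nonneg hρ.le]
    have := dist_triangle_right (c₂ + ρ • (w : Euc n)) c₂ c₁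
    have h3 := hmem.1
    rw [mem_ball] at h3 hc₂
    linarith
  · have hs0 : 0 < s := hr.trans hs.1
    have e : c₂ + s • (w : Euc n) = (1 - s / ρ) • c₂ + (s / ρ) • (c₂ + ρ • (w : Euc n)) := by
      rw [smul_add, smul_smul, div_mul_cancel₀ _ hρ.ne', sub_smul, one_smul]
      abel
    rw [e]
    refine convex_ball c₁ R hc₂ hmem.1 ?_ (by positivity) (by ring)
    have : s / ρ ≤ 1 := (div_le_one hρ).2 hs.2
    linarith
  · exact hs.1.not_ge ((add_smul_mem_closedBall_iff c₂ (hr.trans hs.1).le w r).1 h')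

theorem lintegral_sphere_le_surfaceMeasure {ρ : ℝ} (hρ : 0 < ρ) (c : Euc n) (f : Euc n → ℝ≥0∞)
    (hf : Measurable f) :
    ∫⁻ w, f (c + ρ • (w : Euc n)) ∂(sphereMeasure n) =
      (ENNReal.ofReal (ρ ^ (n - 1)))⁻¹ * ∫⁻ x, f x ∂(surfaceMeasure c ρ) := by
  rw [lintegral_surfaceMeasure c ρ f hf, ← mul_assoc, ENNReal.inv_mul_cancel, one_mul]
  · simpa using pow_pos hρ _
  · exact ENNReal.ofReal_ne_top

/-- Poincaré inequality: the values on the inner sphere and the gradient control the function. -/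
theorem exists_poincare (hn : 0 < n) {c₁ c₂ : Euc n} {R r : ℝ} (hr : 0 < r)
    (h : closedBall c₂ r ⊆ ball c₁ R) :
    ∃ C : ℝ≥0∞, C ≠ ⊤ ∧ ∀ φ : Euc n → ℝ, ContDiff ℝ 1 φ →
      ∫⁻ x in perforatedBall c₁ R c₂ r, ‖φ x‖ₑ ^ 2 ≤
        C * ((∫⁻ x in perforatedBall c₁ R c₂ r, ‖∇ φ x‖ₑ ^ 2) +
          ∫⁻ x, ‖φ x‖ₑ ^ 2 ∂(surfaceMeasure c₂ r)) := by
  -- Rays from c₂ leave the domain before 2R. So `M` bounds the integral of s^(n-1) along a ray, `K`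
  -- is the Cauchy–Schwarz constant on it, and `N` passes from the unit sphere to the surface
  -- measure of ∂B₂.
  set M : ℝ≥0∞ := ENNReal.ofReal ((2 * R) ^ (n - 1)) * ENNReal.ofReal (2 * R)
  set K : ℝ≥0∞ := ENNReal.ofReal (radialResistance n r (2 * R))
  set N : ℝ≥0∞ := (ENNReal.ofReal (r ^ (n - 1)))⁻¹
  have hM : M ≠ ⊤ := ENNReal.mul_ne_top ENNReal.ofReal_ne_top ENNReal.ofReal_ne_top
  have hN : N ≠ ⊤ := by simpa [N] using pow_pos hr _
  refine ⟨M * (2 * K + 2 * N), by finiteness, fun φ hφ => ?_⟩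
  have hm : Measurable fun x => ‖∇ φ x‖ₑ ^ 2 :=
    ((continuous_gradient hφ).measurable.enorm).pow_const 2
  have hm' : Measurable fun x => ‖φ x‖ₑ ^ 2 := (hφ.continuous.measurable.enorm).pow_const 2
  have hΩ := measurableSet_perforatedBall c₁ R c₂ r
  set Ω := perforatedBall c₁ R c₂ r
  set D : sphere (0 : Euc n) 1 → ℝ≥0∞ := fun w => ∫⁻ s in Ioi (0 : ℝ),
      ENNReal.ofReal (s ^ (n - 1)) * Ω.indicator (fun x => ‖∇ φ x‖ₑ ^ 2) (c₂ + s • (w : Euc n))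
  have hD : ∫⁻ x in Ω, ‖∇ φ x‖ₑ ^ 2 = ∫⁻ w, D w ∂(sphereMeasure n) :=
    setLIntegral_polar hn c₂ hΩ _ hm
  have key : ∀ w : sphere (0 : Euc n) 1, ∫⁻ s in Ioi (0 : ℝ),
      ENNReal.ofReal (s ^ (n - 1)) * Ω.indicator (fun x => ‖φ x‖ₑ ^ 2) (c₂ + s • (w : Euc n)) ≤
      M * (2 * K * D w + 2 * ‖φ (c₂ + r • (w : Euc n))‖ₑ ^ 2) := by
    intro w
    have hp : ∀ s ∈ Ioi (0 : ℝ), ENNReal.ofReal (s ^ (n - 1)) *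
        Ω.indicator (fun x => ‖φ x‖ₑ ^ 2) (c₂ + s • (w : Euc n)) ≤
        (Ioo (0 : ℝ) (2 * R)).indicator (fun _ => ENNReal.ofReal ((2 * R) ^ (n - 1)) *
          (2 * K * D w + 2 * ‖φ (c₂ + r • (w : Euc n))‖ₑ ^ 2)) s := by
      intro s hs
      by_cases hmem : c₂ + s • (w : Euc n) ∈ Ω
      · obtain ⟨h1, h2, h3⟩ := ray_subset_perforatedBall hr h w hs hmem
        rw [indicator_of_mem hmem, indicator_of_mem (show s ∈ Ioo 0 (2 * R) from ⟨hs, h2⟩)]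
        have hs' : (0 : ℝ) < s := hs
        gcongr
        refine (enorm_sq_le_two_mul _ (φ (c₂ + r • (w : Euc n)))).trans ?_
        refine add_le_add ?_ le_rfl
        rw [mul_assoc]
        refine mul_le_mul' le_rfl ?_
        refine (sq_sub_ray_le hφ c₂ w (norm_sphere w) hr h1.le).trans ?_
        refine mul_le_mul' (ENNReal.ofReal_le_ofReal
          (radialResistance_mono hr le_rfl h1.le h2.le)) ?_
        refine (setLIntegral_mono' measurableSet_Ioc fun t ht => ?_).trans
          (lintegral_mono_set fun t (ht : t ∈ Ioc r s) => show (0:ℝ) < t from hr.trans ht.1)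
        rw [indicator_of_mem (h3 t ht)]
      · rw [indicator_of_notMem hmem, mul_zero]
        exact zero_le
    refine (setLIntegral_mono' measurableSet_Ioi hp).trans ?_
    refine (setLIntegral_le_lintegral _ _).trans ?_
    rw [lintegral_indicator measurableSet_Ioo, setLIntegral_const, Real.volume_Ioo, sub_zero]
    rw [mul_right_comm]
  rw [setLIntegral_polar hn c₂ hΩ _ hm']
  refine (lintegral_mono key).trans ?_
  rw [lintegral_const_mul' _ _ hM, lintegral_add_right, lintegral_const_mul' _ _ (by finiteness),
    lintegral_const_mul' _ _ (by finiteness), lintegral_sphere_le_surfaceMeasure hr c₂ _ hm', ← hD,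
    mul_assoc M]
  · gcongr M * ?_
    rw [mul_add, add_mul, add_mul, ← mul_assoc 2 N]
    exact add_le_add (le_add_right le_rfl) (le_add_left le_rfl)
  · exact (hm'.comp (by fun_prop)).const_mul _

/-- The values on a sphere are controlled by the function on an annulus and by the gradient. -/
theorem lintegral_sphere_le_annulus (hn : 0 < n) {φ : Euc n → ℝ} (hφ : ContDiff ℝ 1 φ) (c : Euc n)
    {a b R : ℝ} (ha : 0 < a) (hab : a < b) (hbR : b ≤ R) :
    ∫⁻ w : sphere (0 : Euc n) 1, ‖φ (c + R • (w : Euc n))‖ₑ ^ 2 ∂(sphereMeasure n) ≤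
      2 * ENNReal.ofReal (radialResistance n a R) *
          (∫⁻ x in perforatedBall c R c a, ‖∇ φ x‖ₑ ^ 2) +
        2 * (ENNReal.ofReal (a ^ (n - 1)) * ENNReal.ofReal (b - a))⁻¹ *
          ∫⁻ x in perforatedBall c b c a, ‖φ x‖ₑ ^ 2 := by
  have hm : Measurable fun x => ‖∇ φ x‖ₑ ^ 2 :=
    ((continuous_gradient hφ).measurable.enorm).pow_const 2
  have hm' : Measurable fun x => ‖φ x‖ₑ ^ 2 := (hφ.continuous.measurable.enorm).pow_const 2
  set K : ℝ≥0∞ := ENNReal.ofReal (radialResistance n a R)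
  set V : ℝ≥0∞ := ∫⁻ s in Ioo a b, ENNReal.ofReal (s ^ (n - 1))
  set V₀ : ℝ≥0∞ := ENNReal.ofReal (a ^ (n - 1)) * ENNReal.ofReal (b - a)
  have hV₀ : V₀ ≤ V := by
    have : V₀ = ∫⁻ s in Ioo a b, ENNReal.ofReal (a ^ (n - 1)) := by
      rw [setLIntegral_const, Real.volume_Ioo]
    rw [this]
    refine setLIntegral_mono' measurableSet_Ioo fun s hs => ENNReal.ofReal_le_ofReal ?_
    exact pow_le_pow_left₀ ha.le hs.1.le _
  have hV₀0 : V₀ ≠ 0 := by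
    have h1 : (0:ℝ) < a ^ (n - 1) := pow_pos ha _
    have h2 : 0 < b - a := sub_pos.2 hab
    simp only [V₀, ne_eq, mul_eq_zero, ENNReal.ofReal_eq_zero, not_or, not_le]
    exact ⟨h1, h2⟩
  have hV : V ≠ ⊤ := by
    have : V ≤ ∫⁻ s in Ioo a b, ENNReal.ofReal (b ^ (n - 1)) := by
      refine setLIntegral_mono' measurableSet_Ioo fun s hs => ENNReal.ofReal_le_ofReal ?_
      exact pow_le_pow_left₀ (ha.le.trans hs.1.le) hs.2.le _
    rw [setLIntegral_const, Real.volume_Ioo] at this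
    exact ne_top_of_le_ne_top (by finiteness) this
  set D : sphere (0 : Euc n) 1 → ℝ≥0∞ := fun w => ∫⁻ s in Ioo a R,
      ENNReal.ofReal (s ^ (n - 1)) * ‖∇ φ (c + s • (w : Euc n))‖ₑ ^ 2
  set P : sphere (0 : Euc n) 1 → ℝ≥0∞ := fun w => ∫⁻ s in Ioo a b,
      ENNReal.ofReal (s ^ (n - 1)) * ‖φ (c + s • (w : Euc n))‖ₑ ^ 2
  have hPm : Measurable P := by
    apply Measurable.lintegral_prod_right
      (f := fun (w : sphere (0 : Euc n) 1) (s : ℝ) => ENNReal.ofReal (s ^ (n - 1)) *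
        ‖φ (c + s • (w : Euc n))‖ₑ ^ 2)
    refine Measurable.mul (by fun_prop) (hm'.comp (by fun_prop))
  have key : ∀ w : sphere (0 : Euc n) 1, ‖φ (c + R • (w : Euc n))‖ₑ ^ 2 ≤
      2 * K * D w + 2 * V₀⁻¹ * P w := by
    intro w
    -- Compare the boundary value with the value at radius s and average over s in (a, b) with
    -- weight s^(n-1), of total mass `V`. In the end `V` gives way to its explicit lower bound `V₀`.
    have h1 : V * ‖φ (c + R • (w : Euc n))‖ₑ ^ 2 ≤ V * (2 * K * D w) + 2 * P w := by
      have hmp : Measurable fun s : ℝ => ENNReal.ofReal (s ^ (n - 1)) := by fun_prop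
      have hm2 : Measurable fun s : ℝ =>
          2 * (ENNReal.ofReal (s ^ (n - 1)) * ‖φ (c + s • (w : Euc n))‖ₑ ^ 2) :=
        (hmp.mul (hm'.comp (by fun_prop : Measurable fun s : ℝ => c + s • (w : Euc n)))).const_mul _
      calc V * ‖φ (c + R • (w : Euc n))‖ₑ ^ 2
          = ∫⁻ s in Ioo a b, ENNReal.ofReal (s ^ (n - 1)) * ‖φ (c + R • (w : Euc n))‖ₑ ^ 2 :=
            (lintegral_mul_const _ hmp).symm
        _ ≤ ∫⁻ s in Ioo a b, (ENNReal.ofReal (s ^ (n - 1)) * (2 * K * D w) +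
            2 * (ENNReal.ofReal (s ^ (n - 1)) * ‖φ (c + s • (w : Euc n))‖ₑ ^ 2)) := by
            refine setLIntegral_mono' measurableSet_Ioo fun s hs => ?_
            rw [mul_left_comm 2, ← mul_add]
            gcongr
            refine (enorm_sq_le_two_mul _ (φ (c + s • (w : Euc n)))).trans ?_
            refine add_le_add ?_ le_rfl
            rw [mul_assoc]
            refine mul_le_mul' le_rfl ?_
            have hs0 := ha.trans hs.1
            refine (sq_sub_ray_le hφ c w (norm_sphere w) hs0 (hs.2.le.trans hbR)).trans ?_
            refine mul_le_mul' (ENNReal.ofReal_le_ofReal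
              (radialResistance_mono ha hs.1.le (hs.2.le.trans hbR) le_rfl)) ?_
            rw [← setLIntegral_congr Ioo_ae_eq_Ioc]
            exact lintegral_mono_set (Ioo_subset_Ioo_left hs.1.le)
        _ = _ := by
            rw [lintegral_add_right _ hm2, lintegral_mul_const _ hmp,
              lintegral_const_mul' _ _ (by finiteness)]
    have hV0 : V ≠ 0 := fun h0 => hV₀0 (le_antisymm (h0 ▸ hV₀) zero_le)
    calc ‖φ (c + R • (w : Euc n))‖ₑ ^ 2 = V⁻¹ * (V * ‖φ (c + R • (w : Euc n))‖ₑ ^ 2) := by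
          rw [← mul_assoc, ENNReal.inv_mul_cancel hV0 hV, one_mul]
      _ ≤ V⁻¹ * (V * (2 * K * D w) + 2 * P w) := by gcongr
      _ = 2 * K * D w + 2 * V⁻¹ * P w := by
          rw [mul_add, ← mul_assoc V⁻¹, ENNReal.inv_mul_cancel hV0 hV, one_mul]
          ring
      _ ≤ _ := by gcongr
  refine (lintegral_mono key).trans ?_
  rw [lintegral_add_right _ (hPm.const_mul _), lintegral_const_mul' _ _ (by finiteness),
    lintegral_const_mul' _ _ (ENNReal.mul_ne_top (by simp) (ENNReal.inv_ne_top.2 hV₀0)),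
    lintegral_annulus hn c ha.le R _ hm, lintegral_annulus hn c ha.le b _ hm']

end SmoothInequalities

/-! ### Poincaré inequality on cells and compactness of the trace. -/

section TraceCompactness

variable {n : ℕ}

theorem lintegral_comp_smul_add (a : Euc n) {s : ℝ} (hs : s ≠ 0) (f : Euc n → ℝ≥0∞)
    (hf : Measurable f) :
    ∫⁻ y, f (a + s • y) = ENNReal.ofReal |(s ^ n)⁻¹| * ∫⁻ y, f y := by
  have h1 : ∫⁻ y, f (a + s • y) = ∫⁻ z, f (a + z) ∂(Measure.map (s • ·) (volume : Measure (Euc n))) :=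
    (lintegral_map (hf.comp (measurable_const_add a)) (measurable_const_smul s)).symm
  rw [h1, Measure.map_addHaar_smul _ hs, lintegral_smul_measure, lintegral_add_left_eq_self f a,
    finrank_euclideanSpace_fin, smul_eq_mul]

/-- The map y ↦ (1-s)x + sy sends the convex set Q into itself and has Jacobian s^n ≥ 2^(-n). -/
theorem setLIntegral_comp_segment_le {Q : Set (Euc n)} (hQ : MeasurableSet Q) (hc : Convex ℝ Q)
    {x : Euc n} (hx : x ∈ Q) {s : ℝ} (hs : 1 / 2 ≤ s) (hs1 : s ≤ 1) (f : Euc n → ℝ≥0∞)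
    (hf : Measurable f) :
    ∫⁻ y in Q, f ((1 - s) • x + s • y) ≤ 2 ^ n * ∫⁻ y in Q, f y := by
  have hs0 : 0 < s := by linarith
  rw [← lintegral_indicator hQ, ← lintegral_indicator hQ]
  calc ∫⁻ y, Q.indicator (fun y => f ((1 - s) • x + s • y)) y
      ≤ ∫⁻ y, Q.indicator f ((1 - s) • x + s • y) := by
        refine lintegral_mono fun y => ?_
        by_cases hy : y ∈ Q
        · rw [indicator_of_mem hy, indicator_of_mem]
          exact hc hx hy (by linarith) hs0.le (by ring)
        · rw [indicator_of_notMem hy]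
          exact zero_le
    _ = ENNReal.ofReal |(s ^ n)⁻¹| * ∫⁻ y, Q.indicator f y :=
        lintegral_comp_smul_add _ hs0.ne' _ (hf.indicator hQ)
    _ ≤ 2 ^ n * ∫⁻ y, Q.indicator f y := by
        gcongr
        rw [abs_of_pos (by positivity), ← inv_pow]
        calc ENNReal.ofReal (s⁻¹ ^ n) ≤ ENNReal.ofReal (2 ^ n) := by
              apply ENNReal.ofReal_le_ofReal
              gcongr
              rw [inv_le_comm₀ hs0 (by norm_num)]
              linarith
          _ = 2 ^ n := by rw [ENNReal.ofReal_pow (by norm_num)]; norm_num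

theorem enorm_sub_sq_le_segment {φ : Euc n → ℝ} (hφ : ContDiff ℝ 1 φ) (x y : Euc n) {D : ℝ}
    (hD : dist x y ≤ D) :
    ‖φ x - φ y‖ₑ ^ 2 ≤ ENNReal.ofReal (D ^ 2) *
      ∫⁻ s in Ioc (0 : ℝ) 1, ‖∇ φ ((1 - s) • x + s • y)‖ₑ ^ 2 := by
  have hseg : ∀ s : ℝ, (1 - s) • x + s • y = x + s • (y - x) := fun s => by module
  simp only [hseg]
  have hc : Continuous fun s : ℝ => fderiv ℝ φ (x + s • (y - x)) (y - x) :=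
    ((hφ.continuous_fderiv one_ne_zero).comp (by fun_prop)).clm_apply continuous_const
  have hc2 : Continuous fun s : ℝ => ‖∇ φ (x + s • (y - x))‖ :=
    ((continuous_gradient hφ).comp (by fun_prop)).norm
  have e : ∫ s in (0 : ℝ)..1, fderiv ℝ φ (x + s • (y - x)) (y - x) = φ y - φ x := by
    rw [intervalIntegral.integral_eq_sub_of_hasDerivAt
      (fun s _ => hasDerivAt_comp_ray hφ x (y - x) s) (hc.intervalIntegrable _ _)]
    simp
  have h1 := sq_integral_le_weighted (f := fun s => fderiv ℝ φ (x + s • (y - x)) (y - x))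
    (g := fun _ => 1) zero_le_one hc.continuousOn (by fun_prop) (fun s hs => one_pos)
  rw [e] at h1
  simp only [inv_one, intervalIntegral.integral_const, sub_zero, smul_eq_mul, mul_one, one_mul]
    at h1
  have h2 : ∫ s in (0 : ℝ)..1, (fderiv ℝ φ (x + s • (y - x)) (y - x)) ^ 2 ≤
      ∫ s in (0 : ℝ)..1, D ^ 2 * ‖∇ φ (x + s • (y - x))‖ ^ 2 := by
    apply intervalIntegral.integral_mono_on zero_le_one
    · exact Continuous.intervalIntegrable (by fun_prop) _ _
    · exact Continuous.intervalIntegrable (by fun_prop) _ _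
    · intro s hs
      rw [← sq_abs, ← mul_pow, norm_gradient_eq, mul_comm]
      gcongr
      refine ((fderiv ℝ φ (x + s • (y - x))).le_opNorm (y - x)).trans ?_
      gcongr
      rwa [← dist_eq_norm, dist_comm]
  rw [intervalIntegral.integral_const_mul] at h2
  have h4 : ENNReal.ofReal (∫ s in (0 : ℝ)..1, ‖∇ φ (x + s • (y - x))‖ ^ 2) =
      ∫⁻ s in Ioc (0 : ℝ) 1, ‖∇ φ (x + s • (y - x))‖ₑ ^ 2 := by
    rw [intervalIntegral.integral_of_le zero_le_one, ofReal_integral_eq_lintegral_ofReal]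
    · refine setLIntegral_congr_fun measurableSet_Ioc fun s hs => ?_
      rw [ENNReal.ofReal_pow (norm_nonneg _), ofReal_norm]
    · exact (Continuous.intervalIntegrable (by fun_prop) (0 : ℝ) 1).1
    · exact ae_of_all _ fun s => sq_nonneg _
  rw [← h4, ← ENNReal.ofReal_mul (sq_nonneg _), ← ofReal_norm, ← ENNReal.ofReal_pow (norm_nonneg _),
    Real.norm_eq_abs, sq_abs]
  refine ENNReal.ofReal_le_ofReal ?_
  linarith [sq_nonneg (φ x - φ y), show (φ x - φ y) ^ 2 = (φ y - φ x) ^ 2 by ring]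

/-- Bound the difference by the gradient along the segment from x to y and integrate over the
segment parameter last. At each parameter, one of the two endpoints carries weight at least 1/2 and
serves as the variable of substitution. -/
theorem lintegral_lintegral_enorm_sub_sq_le {φ : Euc n → ℝ} (hφ : ContDiff ℝ 1 φ)
    {Q : Set (Euc n)} (hQ : MeasurableSet Q) (hc : Convex ℝ Q) {D : ℝ}
    (hD : ∀ x ∈ Q, ∀ y ∈ Q, dist x y ≤ D) :
    ∫⁻ x in Q, ∫⁻ y in Q, ‖φ x - φ y‖ₑ ^ 2 ≤
      ENNReal.ofReal (D ^ 2) * (2 ^ n * (∫⁻ x in Q, ‖∇ φ x‖ₑ ^ 2) * volume Q) := by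
  set e : Euc n → ℝ≥0∞ := fun x => ‖∇ φ x‖ₑ ^ 2 with he
  have hm : Measurable e := ((continuous_gradient hφ).measurable.enorm).pow_const 2
  have hm3 : Measurable fun p : (Euc n × ℝ) × Euc n => e ((1 - p.1.2) • p.1.1 + p.1.2 • p.2) :=
    hm.comp (by fun_prop)
  calc ∫⁻ x in Q, ∫⁻ y in Q, ‖φ x - φ y‖ₑ ^ 2
      ≤ ∫⁻ x in Q, ∫⁻ y in Q, ENNReal.ofReal (D ^ 2) *
          ∫⁻ s in Ioc (0 : ℝ) 1, e ((1 - s) • x + s • y) :=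
        setLIntegral_mono' hQ fun x hx => setLIntegral_mono' hQ fun y hy =>
          enorm_sub_sq_le_segment hφ x y (hD x hx y hy)
    _ = ENNReal.ofReal (D ^ 2) * ∫⁻ x in Q, ∫⁻ y in Q,
          ∫⁻ s in Ioc (0 : ℝ) 1, e ((1 - s) • x + s • y) := by
        simp_rw [lintegral_const_mul' _ _ ENNReal.ofReal_ne_top]
    _ = ENNReal.ofReal (D ^ 2) * ∫⁻ s in Ioc (0 : ℝ) 1, ∫⁻ x in Q, ∫⁻ y in Q,
          e ((1 - s) • x + s • y) := by
        congr 1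
        refine Eq.trans (lintegral_congr fun x => lintegral_lintegral_swap
          (f := fun y s => e ((1 - s) • x + s • y)) ?_)
          (lintegral_lintegral_swap (f := fun x s => ∫⁻ y in Q, e ((1 - s) • x + s • y)) ?_)
        · exact (hm.comp (by fun_prop : Measurable fun p : Euc n × ℝ =>
            (1 - p.2) • x + p.2 • p.1)).aemeasurable
        · exact (Measurable.lintegral_prod_right
            (f := fun (p : Euc n × ℝ) (y : Euc n) => e ((1 - p.2) • p.1 + p.2 • y))
            hm3).aemeasurable
    _ ≤ ENNReal.ofReal (D ^ 2) * ∫⁻ s in Ioc (0 : ℝ) 1, 2 ^ n * (∫⁻ x in Q, e x) * volume Q := by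
        gcongr ENNReal.ofReal (D ^ 2) * ?_
        refine setLIntegral_mono' measurableSet_Ioc fun s hs => ?_
        rw [← setLIntegral_const]
        -- For s ≥ 1/2 substitute in y. For s ≤ 1/2 exchange the integrals and substitute in x,
        -- whose weight is 1 - s.
        rcases le_total (1 / 2) s with h | h
        · exact setLIntegral_mono' hQ fun x hx =>
            setLIntegral_comp_segment_le hQ hc hx h hs.2 e hm
        · rw [lintegral_lintegral_swap (f := fun x y => e ((1 - s) • x + s • y))
            ((hm.comp (by fun_prop : Measurable
              fun p : Euc n × Euc n => (1 - s) • p.1 + s • p.2)).aemeasurable)]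
          refine setLIntegral_mono' hQ fun y hy => ?_
          have := setLIntegral_comp_segment_le hQ hc hy (s := 1 - s) (by linarith)
            (by linarith [hs.1]) e hm
          simpa [add_comm] using this
    _ = _ := by
        rw [setLIntegral_const, Real.volume_Ioc]
        simp

theorem integrableOn_of_continuous_isBounded {F : Type*} [NormedAddCommGroup F] {f : Euc n → F}
    (hf : Continuous f) {Q : Set (Euc n)} (hb : Bornology.IsBounded Q) : IntegrableOn f Q := by
  obtain ⟨ρ, hρ⟩ := hb.subset_closedBall 0
  exact ((hf.continuousOn).integrableOn_compact (isCompact_closedBall 0 ρ)).mono_set hρ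

theorem lintegral_enorm_sq_eq_ofReal {f : Euc n → ℝ} (hf : Continuous f) {Q : Set (Euc n)}
    (hb : Bornology.IsBounded Q) :
    ∫⁻ x in Q, ‖f x‖ₑ ^ 2 = ENNReal.ofReal (∫ x in Q, f x ^ 2) := by
  have hi : IntegrableOn (fun x => f x ^ 2) Q :=
    integrableOn_of_continuous_isBounded (hf.pow 2) hb
  rw [ofReal_integral_eq_lintegral_ofReal hi
    (ae_of_all _ fun x => sq_nonneg _)]
  refine lintegral_congr fun x => ?_
  rw [← sq_abs, ENNReal.ofReal_pow (abs_nonneg _), ← Real.norm_eq_abs, ofReal_norm]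

/-- With V the volume, S = ∫φ² and J = ∫φ, the double integral equals 2(VS - J²). Being nonnegative,
it gives VS - J² ≤ 2(VS - J²), which is the claim. -/
theorem volume_mul_lintegral_sq_le {φ : Euc n → ℝ} (hφ : Continuous φ) {Q : Set (Euc n)}
    (hb : Bornology.IsBounded Q) :
    volume Q * ∫⁻ x in Q, ‖φ x‖ₑ ^ 2 ≤ ‖∫ x in Q, φ x‖ₑ ^ 2 +
      ∫⁻ x in Q, ∫⁻ y in Q, ‖φ x - φ y‖ₑ ^ 2 := by
  have hV : volume Q ≠ ⊤ := hb.measure_lt_top.ne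
  set V := (volume : Measure (Euc n)).real Q
  set J := ∫ x in Q, φ x
  set S := ∫ x in Q, φ x ^ 2
  have i1 : IntegrableOn φ Q := integrableOn_of_continuous_isBounded hφ hb
  have i2 : IntegrableOn (fun x => φ x ^ 2) Q :=
    integrableOn_of_continuous_isBounded (hφ.pow 2) hb
  have ic : ∀ a : ℝ, IntegrableOn (fun _ : Euc n => a) Q := fun a => integrableOn_const hV
  have inner : ∀ x, ∫ y in Q, (φ x - φ y) ^ 2 = V * φ x ^ 2 - 2 * J * φ x + S := by
    intro x
    have : ∀ y, (φ x - φ y) ^ 2 = φ x ^ 2 - 2 * φ x * φ y + φ y ^ 2 := fun y => by ring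
    simp_rw [this]
    have i3 : IntegrableOn (fun y => φ x ^ 2 - 2 * φ x * φ y) Q := (ic _).sub (i1.const_mul _)
    rw [integral_add i3 i2, integral_sub (ic _) (i1.const_mul _),
      integral_const_mul, setIntegral_const, smul_eq_mul]
    ring
  have outer : ∫ x in Q, (V * φ x ^ 2 - 2 * J * φ x + S) = 2 * (V * S) - 2 * J ^ 2 := by
    have i3 : IntegrableOn (fun x => V * φ x ^ 2 - 2 * J * φ x) Q :=
      (i2.const_mul _).sub (i1.const_mul _)
    rw [integral_add i3 (ic _),
      integral_sub (i2.const_mul _) (i1.const_mul _), integral_const_mul, integral_const_mul,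
      setIntegral_const, smul_eq_mul]
    ring
  have hnn : ∀ x, 0 ≤ V * φ x ^ 2 - 2 * J * φ x + S := fun x => by
    rw [← inner]
    exact integral_nonneg fun y => sq_nonneg _
  have hint : IntegrableOn (fun x => V * φ x ^ 2 - 2 * J * φ x + S) Q :=
    ((i2.const_mul _).sub (i1.const_mul _)).add (ic _)
  have e1 : ∫⁻ x in Q, ∫⁻ y in Q, ‖φ x - φ y‖ₑ ^ 2 = ENNReal.ofReal (2 * (V * S) - 2 * J ^ 2) := by
    rw [← outer, ofReal_integral_eq_lintegral_ofReal hint (ae_of_all _ hnn)]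
    refine lintegral_congr fun x => ?_
    rw [← inner]
    exact lintegral_enorm_sq_eq_ofReal (continuous_const.sub hφ) hb
  have e2 : 0 ≤ 2 * (V * S) - 2 * J ^ 2 := by
    rw [← outer]
    exact integral_nonneg hnn
  have hS : 0 ≤ S := integral_nonneg fun x => sq_nonneg _
  rw [e1, lintegral_enorm_sq_eq_ofReal hφ hb, ← ENNReal.ofReal_toReal hV,
    ← ENNReal.ofReal_mul ENNReal.toReal_nonneg, ← ofReal_norm, ← ENNReal.ofReal_pow (norm_nonneg _),
    Real.norm_eq_abs, sq_abs, ← ENNReal.ofReal_add (sq_nonneg _) e2]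
  refine ENNReal.ofReal_le_ofReal ?_
  change V * S ≤ _
  linarith

/-- Poincaré inequality on a bounded convex set. -/
theorem setLIntegral_sq_le_mean_add_gradient {φ : Euc n → ℝ} (hφ : ContDiff ℝ 1 φ)
    {Q : Set (Euc n)} (hQ : MeasurableSet Q) (hb : Bornology.IsBounded Q) (hc : Convex ℝ Q)
    (hQ0 : volume Q ≠ 0) {D : ℝ} (hD : ∀ x ∈ Q, ∀ y ∈ Q, dist x y ≤ D) :
    ∫⁻ x in Q, ‖φ x‖ₑ ^ 2 ≤ (volume Q)⁻¹ * ‖∫ x in Q, φ x‖ₑ ^ 2 +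
      ENNReal.ofReal (D ^ 2) * 2 ^ n * ∫⁻ x in Q, ‖∇ φ x‖ₑ ^ 2 := by
  have hV : volume Q ≠ ⊤ := hb.measure_lt_top.ne
  have h1 := (volume_mul_lintegral_sq_le hφ.continuous hb).trans
    (add_le_add_right (lintegral_lintegral_enorm_sub_sq_le hφ hQ hc hD) _)
  calc ∫⁻ x in Q, ‖φ x‖ₑ ^ 2 = (volume Q)⁻¹ * (volume Q * ∫⁻ x in Q, ‖φ x‖ₑ ^ 2) := by
        rw [← mul_assoc, ENNReal.inv_mul_cancel hQ0 hV, one_mul]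
    _ ≤ (volume Q)⁻¹ * (‖∫ x in Q, φ x‖ₑ ^ 2 + ENNReal.ofReal (D ^ 2) *
          (2 ^ n * (∫⁻ x in Q, ‖∇ φ x‖ₑ ^ 2) * volume Q)) := by gcongr
    _ = (volume Q)⁻¹ * ‖∫ x in Q, φ x‖ₑ ^ 2 + ((volume Q)⁻¹ * volume Q) *
          (ENNReal.ofReal (D ^ 2) * 2 ^ n * ∫⁻ x in Q, ‖∇ φ x‖ₑ ^ 2) := by ring
    _ = _ := by rw [ENNReal.inv_mul_cancel hQ0 hV, one_mul]

/-- The cell with index `k` of the cubic grid of mesh `h`. -/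
def gridCell (h : ℝ) (k : Fin n → ℤ) : Set (Euc n) := {x | ∀ i, ⌊x i / h⌋ = k i}

theorem measurableSet_gridCell (h : ℝ) (k : Fin n → ℤ) : MeasurableSet (gridCell h k) := by
  have : gridCell h k = ⋂ i, {x : Euc n | ⌊x i / h⌋ = k i} := by ext; simp [gridCell]
  rw [this]
  refine MeasurableSet.iInter fun i => ?_
  have hm : Measurable fun x : Euc n => ⌊x i / h⌋ :=
    Int.measurable_floor.comp (by fun_prop)
  exact hm (measurableSet_singleton (k i))

theorem mem_gridCell_iff {h : ℝ} (hh : 0 < h) (k : Fin n → ℤ) (x : Euc n) :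
    x ∈ gridCell h k ↔ ∀ i, (k i : ℝ) * h ≤ x i ∧ x i < (k i + 1) * h := by
  simp only [gridCell, mem_ofPred_eq, Int.floor_eq_iff, le_div_iff₀ hh, div_lt_iff₀ hh]

theorem convex_gridCell {h : ℝ} (hh : 0 < h) (k : Fin n → ℤ) :
    Convex ℝ (gridCell (n := n) h k) := by
  intro x hx y hy a b ha hb hab
  rw [mem_gridCell_iff hh] at hx hy ⊢
  intro i
  have := convex_Ico ((k i : ℝ) * h) ((k i + 1) * h) (hx i) (hy i) ha hb hab
  simpa using this

theorem dist_le_of_mem_gridCell {h : ℝ} (hh : 0 < h) (k : Fin n → ℤ) {x y : Euc n}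
    (hx : x ∈ gridCell h k) (hy : y ∈ gridCell h k) : dist x y ≤ n * h := by
  rw [mem_gridCell_iff hh] at hx hy
  rw [EuclideanSpace.dist_eq]
  apply Real.sqrt_le_iff.2 ⟨by positivity, ?_⟩
  calc ∑ i, dist (x i) (y i) ^ 2 ≤ ∑ _i : Fin n, h ^ 2 := by
        refine Finset.sum_le_sum fun i _ => ?_
        rw [Real.dist_eq]
        gcongr
        rw [abs_le]
        constructor <;> nlinarith [hx i, hy i]
    _ = n * h ^ 2 := by simp
    _ ≤ (n * h) ^ 2 := by
        rw [mul_pow]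
        gcongr
        exact_mod_cast Nat.le_self_pow two_ne_zero n

theorem finite_gridCell_inter {h : ℝ} (hh : 0 < h) {A : Set (Euc n)} (hA : Bornology.IsBounded A) :
    {k : Fin n → ℤ | (gridCell h k ∩ A).Nonempty}.Finite := by
  obtain ⟨M, hM⟩ := hA.subset_closedBall 0
  refine (Set.finite_Icc (fun _ : Fin n => ⌊-M / h⌋) (fun _ => ⌊M / h⌋)).subset ?_
  rintro k ⟨x, hx, hxA⟩
  have h1 : ‖x‖ ≤ M := by simpa using hM hxA
  have h2 : ∀ i, |x i| ≤ M := fun i => (PiLp.norm_apply_le x i).trans h1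
  refine ⟨fun i => ?_, fun i => ?_⟩
  · rw [← hx i]
    apply Int.floor_mono
    gcongr
    exact (abs_le.1 (h2 i)).1
  · rw [← hx i]
    apply Int.floor_mono
    gcongr
    exact (abs_le.1 (h2 i)).2

/-- On a set that stays away from the complement of `Ω`, the `L²` norm is controlled by finitely
many averages, up to a small multiple of the Dirichlet integral. -/
theorem exists_finite_averages (hn : 0 < n) {Ω A : Set (Euc n)} (hA : Bornology.IsBounded A)
    {η : ℝ} (hη : 0 < η) (hAΩ : ∀ x ∈ A, closedBall x η ⊆ Ω) :
    ∃ (t : Finset (Fin n → ℤ)) (Q : (Fin n → ℤ) → Set (Euc n)) (C : ℝ≥0∞), C ≠ ⊤ ∧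
      (∀ k ∈ t, MeasurableSet (Q k) ∧ Q k ⊆ Ω) ∧ ∀ φ : Euc n → ℝ, ContDiff ℝ 1 φ →
      ∫⁻ x in A, ‖φ x‖ₑ ^ 2 ≤ ENNReal.ofReal (η ^ 2) * 2 ^ n * (∫⁻ x in Ω, ‖∇ φ x‖ₑ ^ 2) +
        C * ∑ k ∈ t, ‖∫ x in Q k, φ x‖ₑ ^ 2 := by
  have hn' : (0 : ℝ) < n := by exact_mod_cast hn
  -- This mesh makes the diameter of a cell at most η, so every cell that meets `A` lies in `Ω`.
  set h := η / n
  have hh : 0 < h := by positivity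
  have hnh : n * h = η := by simp only [h]; field_simp
  set t := (finite_gridCell_inter hh hA).toFinset
  have hsub : ∀ k ∈ t, gridCell h k ⊆ Ω := by
    intro k hk y hy
    obtain ⟨x, hx, hxA⟩ := (Set.Finite.mem_toFinset _).1 hk
    refine hAΩ x hxA ?_
    rw [mem_closedBall, ← hnh]
    exact dist_le_of_mem_gridCell hh k hy hx
  have hbdd : ∀ k : Fin n → ℤ, Bornology.IsBounded (gridCell (n := n) h k) := fun k =>
    isBounded_iff.2 ⟨n * h, fun x hx y hy => dist_le_of_mem_gridCell hh k hx hy⟩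
  -- The weight 0 for a null cell keeps `C` finite without a computation of cell volumes; the
  -- estimate on such a cell is trivial.
  set C : ℝ≥0∞ := ∑ k ∈ t, if volume (gridCell (n := n) h k) = 0 then 0
    else (volume (gridCell (n := n) h k))⁻¹
  refine ⟨t, gridCell h, C, ?_, fun k hk => ⟨measurableSet_gridCell h k, hsub k hk⟩,
    fun φ hφ => ?_⟩
  · refine ENNReal.sum_ne_top.2 fun k _ => ?_
    split_ifs with h0
    · simp
    · exact ENNReal.inv_ne_top.2 h0
  have hdisj : Set.PairwiseDisjoint (t : Set (Fin n → ℤ)) (gridCell (n := n) h) := by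
    intro k _ k' _ hkk'
    refine Set.disjoint_left.2 fun x hx hx' => hkk' (funext fun i => ?_)
    rw [← hx i, hx' i]
  have hcell : ∀ k ∈ t, ∫⁻ x in gridCell h k, ‖φ x‖ₑ ^ 2 ≤
      ENNReal.ofReal (η ^ 2) * 2 ^ n * (∫⁻ x in gridCell h k, ‖∇ φ x‖ₑ ^ 2) +
        C * ‖∫ x in gridCell h k, φ x‖ₑ ^ 2 := by
    intro k hk
    by_cases h0 : volume (gridCell (n := n) h k) = 0
    · rw [setLIntegral_measure_zero _ _ h0]
      exact zero_le
    · rw [add_comm]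
      refine (setLIntegral_sq_le_mean_add_gradient hφ (measurableSet_gridCell h k) (hbdd k)
        (convex_gridCell hh k) h0 (D := η)
        fun x hx y hy => hnh ▸ dist_le_of_mem_gridCell hh k hx hy).trans ?_
      gcongr
      have := Finset.single_le_sum (f := fun k => if volume (gridCell (n := n) h k) = 0 then 0
        else (volume (gridCell (n := n) h k))⁻¹) (fun _ _ => zero_le) hk
      simpa [h0] using this
  calc ∫⁻ x in A, ‖φ x‖ₑ ^ 2 ≤ ∫⁻ x in ⋃ k ∈ t, gridCell h k, ‖φ x‖ₑ ^ 2 := by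
        refine lintegral_mono_set fun x hx => ?_
        simp only [mem_iUnion]
        refine ⟨fun i => ⌊x i / h⌋, ?_, fun i => rfl⟩
        exact (Set.Finite.mem_toFinset _).2 ⟨x, fun i => rfl, hx⟩
    _ = ∑ k ∈ t, ∫⁻ x in gridCell h k, ‖φ x‖ₑ ^ 2 :=
        lintegral_biUnion_finset hdisj (fun k _ => measurableSet_gridCell h k) _
    _ ≤ ∑ k ∈ t, (ENNReal.ofReal (η ^ 2) * 2 ^ n * (∫⁻ x in gridCell h k, ‖∇ φ x‖ₑ ^ 2) +
        C * ‖∫ x in gridCell h k, φ x‖ₑ ^ 2) := Finset.sum_le_sum hcell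
    _ = ENNReal.ofReal (η ^ 2) * 2 ^ n * (∑ k ∈ t, ∫⁻ x in gridCell h k, ‖∇ φ x‖ₑ ^ 2) +
        C * ∑ k ∈ t, ‖∫ x in gridCell h k, φ x‖ₑ ^ 2 := by
        rw [Finset.sum_add_distrib, Finset.mul_sum, Finset.mul_sum]
    _ ≤ _ := by
        gcongr
        rw [← lintegral_biUnion_finset hdisj (fun k _ => measurableSet_gridCell h k)]
        exact lintegral_mono_set (iUnion₂_subset hsub)

/-- Test the inclusion at the point of the small ball farthest from c₁: go from c₂ by r in the
direction c₂ - c₁, or in any direction if the centres agree. -/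
theorem dist_add_lt_of_closedBall_subset (hn : 0 < n) {c₁ c₂ : Euc n} {R r : ℝ} (hr : 0 < r)
    (h : closedBall c₂ r ⊆ ball c₁ R) : dist c₂ c₁ + r < R := by
  have : Nonempty (Fin n) := ⟨⟨0, hn⟩⟩
  obtain ⟨w, hw, e⟩ : ∃ w : Euc n, ‖w‖ = 1 ∧ c₂ - c₁ = dist c₂ c₁ • w := by
    by_cases h0 : c₂ = c₁
    · obtain ⟨w, hw⟩ := exists_norm_eq (Euc n) zero_le_one
      exact ⟨w, hw, by simp [h0]⟩
    · have h1 : 0 < dist c₂ c₁ := dist_pos.2 h0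
      refine ⟨(dist c₂ c₁)⁻¹ • (c₂ - c₁), ?_, ?_⟩
      · rw [norm_smul, norm_inv, Real.norm_of_nonneg h1.le, ← dist_eq_norm, inv_mul_cancel₀ h1.ne']
      · rw [smul_smul, mul_inv_cancel₀ h1.ne', one_smul]
  have h2 : c₂ + r • w ∈ ball c₁ R := h (by simp [norm_smul, hw, abs_of_pos hr])
  rw [mem_ball, dist_eq_norm, add_sub_right_comm, e, ← add_smul, norm_smul, hw, mul_one,
    Real.norm_of_nonneg (by positivity)] at h2
  exact h2

/-- The integrand s^(1-n) is bounded by `C` on [R/2, R], so its integral over [a, R] vanishes as a →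
R. -/
theorem exists_radialResistance_lt {R ρ : ℝ} (hR : 0 < R) (hρ : ρ < R) {ε : ℝ} (hε : 0 < ε) :
    ∃ a, ρ < a ∧ 0 < a ∧ a < R ∧ radialResistance n a R < ε := by
  set C := ((R / 2) ^ (n - 1))⁻¹
  have ht : Tendsto (fun a => C * (R - a)) (𝓝[<] R) (𝓝 0) := by
    have : Tendsto (fun a => C * (R - a)) (𝓝 R) (𝓝 (C * (R - R))) :=
      Continuous.tendsto (by fun_prop) R
    rw [sub_self, mul_zero] at this
    exact this.mono_left nhdsWithin_le_nhds
  have h1 : ∀ᶠ a in 𝓝[<] R, max ρ (R / 2) < a :=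
    (lt_mem_nhds (max_lt hρ (by linarith))).filter_mono nhdsWithin_le_nhds
  obtain ⟨a, ha, ha2, ha3⟩ :=
    (h1.and ((ht.eventually (gt_mem_nhds hε)).and self_mem_nhdsWithin)).exists
  have ha4 : R / 2 < a := (le_max_right _ _).trans_lt ha
  have haR : a < R := ha3
  refine ⟨a, (le_max_left _ _).trans_lt ha, by linarith, haR, lt_of_le_of_lt ?_ ha2⟩
  have := intervalIntegral.norm_integral_le_of_norm_le_const (a := a) (b := R) (C := C)
    (f := fun s : ℝ => (s ^ (n - 1))⁻¹) (by
      intro s hs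
      rw [uIoc_of_le haR.le] at hs
      have hs' : R / 2 < s := ha4.trans hs.1
      rw [Real.norm_of_nonneg (inv_nonneg.2 (pow_nonneg (by linarith) _))]
      exact inv_anti₀ (by positivity) (pow_le_pow_left₀ (by linarith) hs'.le _))
  rw [abs_of_pos (sub_pos.2 haR)] at this
  exact (le_abs_self _).trans this

/-- Compactness of the trace on the outer sphere, in quantitative form: the trace is controlled by
finitely many averages, up to a small multiple of the Dirichlet integral. -/
theorem exists_trace_le_averages (hn : 0 < n) {c₁ c₂ : Euc n} {R r : ℝ} (hr : 0 < r)
    (h : closedBall c₂ r ⊆ ball c₁ R) {ε : ℝ} (hε : 0 < ε) :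
    ∃ (t : Finset (Fin n → ℤ)) (Q : (Fin n → ℤ) → Set (Euc n)) (C : ℝ≥0∞), C ≠ ⊤ ∧
      (∀ k ∈ t, MeasurableSet (Q k) ∧ Q k ⊆ perforatedBall c₁ R c₂ r) ∧
      ∀ φ : Euc n → ℝ, ContDiff ℝ 1 φ →
      ∫⁻ x, ‖φ x‖ₑ ^ 2 ∂(surfaceMeasure c₁ R) ≤
        ENNReal.ofReal ε * (∫⁻ x in perforatedBall c₁ R c₂ r, ‖∇ φ x‖ₑ ^ 2) +
        C * ∑ k ∈ t, ‖∫ x in Q k, φ x‖ₑ ^ 2 := by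
  have hd := dist_add_lt_of_closedBall_subset hn hr h
  set d := dist c₂ c₁
  have hd0 : 0 ≤ d := dist_nonneg
  have hR : 0 < R := by linarith
  set P := R ^ (n - 1)
  have hP : 0 < P := pow_pos hR _
  -- A thin collar a < |x - c₁| < R that misses the hole. Its gradient term carries the factor 2P
  -- times the resistance, so the bound ε / (4P) costs at most ε / 2.
  obtain ⟨a, hda, ha, haR, hI⟩ := exists_radialResistance_lt (n := n) hR hd
    (ε := ε / (4 * P)) (by positivity)
  set b := (a + R) / 2
  have hab : a < b := by simp only [b]; linarith
  have hbR : b < R := by simp only [b]; linarith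
  set W : ℝ := P * (2 * (a ^ (n - 1) * (b - a))⁻¹)
  have hW : 0 < W := by
    have : 0 < a ^ (n - 1) := pow_pos ha _
    have : 0 < b - a := sub_pos.2 hab
    positivity
  -- The first two bounds keep the η-neighbourhood of the annulus a < |x - c₁| < b inside the
  -- domain; the last makes the Poincaré error on the cells cost the other ε / 2.
  obtain ⟨η, hη, hη1, hη2, hη3⟩ : ∃ η : ℝ, 0 < η ∧ η < a - (d + r) ∧ η < R - b ∧
      W * (η ^ 2 * 2 ^ n) < ε / 2 := by
    have ht : Tendsto (fun η : ℝ => W * (η ^ 2 * 2 ^ n)) (𝓝[>] 0) (𝓝 0) := by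
      have : Tendsto (fun η : ℝ => W * (η ^ 2 * 2 ^ n)) (𝓝 0) (𝓝 (W * (0 ^ 2 * 2 ^ n))) :=
        Continuous.tendsto (by fun_prop) 0
      rw [zero_pow two_ne_zero, zero_mul, mul_zero] at this
      exact this.mono_left nhdsWithin_le_nhds
    have h1 : ∀ᶠ η : ℝ in 𝓝[>] 0, η < min (a - (d + r)) (R - b) :=
      (gt_mem_nhds (lt_min (sub_pos.2 hda) (sub_pos.2 hbR))).filter_mono nhdsWithin_le_nhds
    obtain ⟨η, h1, h2, h3⟩ := (h1.and ((ht.eventually (gt_mem_nhds (half_pos hε))).and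
      self_mem_nhdsWithin)).exists
    exact ⟨η, h3, h1.trans_le (min_le_left _ _), h1.trans_le (min_le_right _ _), h2⟩
  have hsub : perforatedBall c₁ R c₁ a ⊆ perforatedBall c₁ R c₂ r := by
    rintro x ⟨hx1, hx2⟩
    refine ⟨hx1, fun hx3 => hx2 ?_⟩
    rw [mem_closedBall] at hx3 ⊢
    linarith [dist_triangle x c₂ c₁]
  obtain ⟨t, Q, C, hC, hQ, hest⟩ := exists_finite_averages hn
    (Ω := perforatedBall c₁ R c₂ r) (A := perforatedBall c₁ b c₁ a)
    (isBounded_ball.subset sdiff_subset) hη (by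
      rintro x ⟨hx1, hx2⟩ y hy
      rw [mem_ball] at hx1
      rw [mem_closedBall, not_le] at hx2
      rw [mem_closedBall] at hy
      refine ⟨?_, fun hy2 => ?_⟩
      · rw [mem_ball]
        linarith [dist_triangle y x c₁]
      · rw [mem_closedBall] at hy2
        linarith [dist_triangle x y c₁, dist_triangle y c₂ c₁, dist_comm x y])
  refine ⟨t, Q, ENNReal.ofReal W * C, by finiteness, hQ, fun φ hφ => ?_⟩
  have hm' : Measurable fun x => ‖φ x‖ₑ ^ 2 := (hφ.continuous.measurable.enorm).pow_const 2
  have h2W : ENNReal.ofReal P * (2 * (ENNReal.ofReal (a ^ (n - 1)) * ENNReal.ofReal (b - a))⁻¹)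
      = ENNReal.ofReal W := by
    rw [← ENNReal.ofReal_mul (pow_nonneg ha.le _), ← ENNReal.ofReal_inv_of_pos
      (mul_pos (pow_pos ha _) (sub_pos.2 hab)), ENNReal.ofReal_mul hP.le,
      ENNReal.ofReal_mul zero_le_two, ENNReal.ofReal_ofNat]
  have hK : ENNReal.ofReal P * (2 * ENNReal.ofReal (radialResistance n a R)) ≤
      ENNReal.ofReal (ε / 2) := by
    rw [show (2 : ℝ≥0∞) = ENNReal.ofReal 2 by simp, ← ENNReal.ofReal_mul zero_le_two,
      ← ENNReal.ofReal_mul hP.le]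
    refine ENNReal.ofReal_le_ofReal ?_
    rw [lt_div_iff₀ (by positivity)] at hI
    linarith
  have hW2 : ENNReal.ofReal W * (ENNReal.ofReal (η ^ 2) * 2 ^ n) ≤ ENNReal.ofReal (ε / 2) := by
    rw [show (2 : ℝ≥0∞) ^ n = ENNReal.ofReal (2 ^ n) by
      rw [ENNReal.ofReal_pow zero_le_two, ENNReal.ofReal_ofNat],
      ← ENNReal.ofReal_mul (sq_nonneg _), ← ENNReal.ofReal_mul hW.le]
    exact ENNReal.ofReal_le_ofReal hη3.le
  rw [lintegral_surfaceMeasure c₁ R _ hm']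
  set G := ∫⁻ x in perforatedBall c₁ R c₂ r, ‖∇ φ x‖ₑ ^ 2
  set S := ∑ k ∈ t, ‖∫ x in Q k, φ x‖ₑ ^ 2
  calc _ ≤ ENNReal.ofReal P * (2 * ENNReal.ofReal (radialResistance n a R) * G +
        2 * (ENNReal.ofReal (a ^ (n - 1)) * ENNReal.ofReal (b - a))⁻¹ *
          (ENNReal.ofReal (η ^ 2) * 2 ^ n * G + C * S)) := by
        gcongr
        refine (lintegral_sphere_le_annulus hn hφ c₁ ha hab hbR.le).trans ?_
        gcongr
        · exact lintegral_mono_set hsub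
        · exact hest φ hφ
    _ = ENNReal.ofReal P * (2 * ENNReal.ofReal (radialResistance n a R)) * G +
        (ENNReal.ofReal P * (2 * (ENNReal.ofReal (a ^ (n - 1)) * ENNReal.ofReal (b - a))⁻¹)) *
          (ENNReal.ofReal (η ^ 2) * 2 ^ n) * G +
        (ENNReal.ofReal P * (2 * (ENNReal.ofReal (a ^ (n - 1)) * ENNReal.ofReal (b - a))⁻¹)) *
          C * S := by ring
    _ ≤ ENNReal.ofReal (ε / 2) * G + ENNReal.ofReal (ε / 2) * G + ENNReal.ofReal W * C * S := by
        rw [h2W]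
        gcongr
    _ = ENNReal.ofReal ε * G + ENNReal.ofReal W * C * S := by
        rw [← add_mul, ← ENNReal.ofReal_add (by positivity) (by positivity), add_halves]

end TraceCompactness

/-! ### Abstract direct method for a quotient of quadratic forms. -/

section Maximizer

variable {K Y Z : Type*} [NormedAddCommGroup K] [NormedSpace ℝ K]
  [NormedAddCommGroup Y] [InnerProductSpace ℝ Y] [NormedAddCommGroup Z] [InnerProductSpace ℝ Z]

/-- A continuous linear map that is controlled by finitely many functionals up to a small error
sends bounded sequences to sequences that are Cauchy along an ultrafilter. -/
theorem tendsto_norm_sub_of_finite_functionals {U : Ultrafilter ℕ} (g : K →L[ℝ] Y) (T : K →L[ℝ] Z)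
    (hcomp : ∀ ε > 0, ∃ (ι : Type) (t : Finset ι) (l : ι → K →L[ℝ] ℝ) (C : ℝ),
      ∀ x, ‖T x‖ ^ 2 ≤ ε * ‖g x‖ ^ 2 + C * ∑ i ∈ t, (l i x) ^ 2)
    {x : ℕ → K} {B : ℝ} (hB : ∀ k, ‖x k‖ ≤ B) (hgx : ∀ k, ‖g (x k)‖ ≤ 1) :
    Tendsto (fun p : ℕ × ℕ => ‖T (x p.1 - x p.2)‖ ^ 2) ((U : Filter ℕ) ×ˢ (U : Filter ℕ)) (𝓝 0) := by
  refine tendsto_order.2 ⟨fun a ha => Eventually.of_forall fun p => ha.trans_le (sq_nonneg _),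
    fun ε hε => ?_⟩
  -- Since ‖g (x - x')‖² ≤ 4, the gradient term contributes at most ε / 2. The finitely many
  -- functionals take bounded values, so they converge along the ultrafilter and contribute less
  -- than ε / 2 eventually.
  obtain ⟨ι, t, l, C, hl⟩ := hcomp (ε / 8) (by positivity)
  have hlim : ∀ i, ∃ L : ℝ, Tendsto (fun k => l i (x k)) U (𝓝 L) := by
    intro i
    have hc := isCompact_closedBall (0 : ℝ) (‖l i‖ * B)
    obtain ⟨L, -, hL⟩ := hc.ultrafilter_le_nhds (U.map fun k => l i (x k)) (by
      rw [le_principal_iff]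
      refine Filter.mem_map.2 (univ_mem' fun k => ?_)
      simp only [mem_preimage, mem_closedBall, dist_zero_right]
      exact ((l i).le_opNorm _).trans (by gcongr; exact hB k))
    exact ⟨L, hL⟩
  choose L hL using hlim
  have hsum : Tendsto (fun p : ℕ × ℕ => C * ∑ i ∈ t, (l i (x p.1 - x p.2)) ^ 2)
      ((U : Filter ℕ) ×ˢ (U : Filter ℕ)) (𝓝 (C * ∑ i ∈ t, (L i - L i) ^ 2)) := by
    refine Tendsto.const_mul _ (tendsto_finsetSum _ fun i _ => Tendsto.pow ?_ 2)
    simp only [map_sub]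
    exact ((hL i).comp tendsto_fst).sub ((hL i).comp tendsto_snd)
  simp only [sub_self, ne_eq, OfNat.ofNat_ne_zero, not_false_eq_true, zero_pow,
    Finset.sum_const_zero, mul_zero] at hsum
  filter_upwards [hsum.eventually (gt_mem_nhds (half_pos hε))] with p hp
  have h2 : ‖g (x p.1 - x p.2)‖ ≤ 2 := by
    rw [map_sub]
    exact (norm_sub_le _ _).trans (by linarith [hgx p.1, hgx p.2])
  have h3 : ‖g (x p.1 - x p.2)‖ ^ 2 ≤ 4 := by nlinarith [norm_nonneg (g (x p.1 - x p.2))]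
  have := hl (x p.1 - x p.2)
  nlinarith

/-- The discriminant (2B)² of a nonnegative quadratic without constant term cannot be positive. -/
theorem eq_zero_of_forall_quadratic_nonneg {A B : ℝ} (h : ∀ s : ℝ, 0 ≤ A * (s * s) + 2 * B * s) :
    B = 0 := by
  have := discrim_le_zero (a := A) (b := 2 * B) (c := 0) fun s => by simpa using h s
  rw [discrim] at this
  nlinarith [sq_nonneg B]

/-- The quotient `‖T x‖² / ‖g x‖²` attains its maximum, and the maximizer satisfies the
Euler–Lagrange equation. -/
theorem exists_maximizer [CompleteSpace K] (g : K →L[ℝ] Y) (T : K →L[ℝ] Z)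
    {C₀ : ℝ} (hg : ∀ x, ‖x‖ ≤ C₀ * ‖g x‖) (hT : ∃ x, T x ≠ 0)
    (hcomp : ∀ ε > 0, ∃ (ι : Type) (t : Finset ι) (l : ι → K →L[ℝ] ℝ) (C : ℝ),
      ∀ x, ‖T x‖ ^ 2 ≤ ε * ‖g x‖ ^ 2 + C * ∑ i ∈ t, (l i x) ^ 2) :
    ∃ m : ℝ, 0 < m ∧ (∀ y, ‖T y‖ ^ 2 ≤ m * ‖g y‖ ^ 2) ∧
      ∃ x, x ≠ 0 ∧ ∀ y, m * inner ℝ (g x) (g y) = inner ℝ (T x) (T y) := by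
  have hg0 : ∀ x, g x = 0 → x = 0 := fun x hx => by
    have := hg x
    rw [hx, norm_zero, mul_zero] at this
    simpa using this
  set S : Set ℝ := {q | ∃ x, ‖g x‖ ≤ 1 ∧ q = ‖T x‖ ^ 2} with hS
  have hbound : ∀ x, ‖g x‖ ≤ 1 → ‖x‖ ≤ |C₀| := fun x hx =>
    calc ‖x‖ ≤ C₀ * ‖g x‖ := hg x
      _ ≤ |C₀| * ‖g x‖ := by gcongr; exact le_abs_self _
      _ ≤ |C₀| * 1 := by gcongr
      _ = |C₀| := mul_one _
  have hbdd : BddAbove S := by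
    refine ⟨(‖T‖ * |C₀|) ^ 2, ?_⟩
    rintro q ⟨x, hx, rfl⟩
    gcongr
    exact (T.le_opNorm x).trans (by gcongr; exact hbound x hx)
  have hne : S.Nonempty := ⟨‖T 0‖ ^ 2, 0, by simp, rfl⟩
  set m := sSup S with hm
  have hnorm : ∀ y, ‖T y‖ ^ 2 ≤ m * ‖g y‖ ^ 2 := by
    intro y
    by_cases hy : g y = 0
    · simp [hg0 y hy]
    · have hy' : 0 < ‖g y‖ := norm_pos_iff.2 hy
      have h1 : ‖T (‖g y‖⁻¹ • y)‖ ^ 2 ≤ m := le_csSup hbdd ⟨‖g y‖⁻¹ • y, by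
        rw [map_smul, norm_smul, norm_inv, norm_norm, inv_mul_cancel₀ hy'.ne'], rfl⟩
      rw [map_smul, norm_smul, norm_inv, norm_norm, mul_pow, inv_pow,
        inv_mul_le_iff₀ (by positivity)] at h1
      linarith
  have hm0 : 0 < m := by
    obtain ⟨x, hx⟩ := hT
    by_contra! hle
    have h1 := hnorm x
    have h2 : 0 < ‖T x‖ ^ 2 := by positivity
    nlinarith [sq_nonneg ‖g x‖]
  refine ⟨m, hm0, hnorm, ?_⟩
  obtain ⟨q, -, hq, hqS⟩ := exists_seq_tendsto_sSup hne hbdd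
  choose x hx hqx using hqS
  set U : Ultrafilter ℕ := hyperfilter ℕ
  have hU : (U : Filter ℕ) ≤ atTop := by
    rw [← Nat.cofinite_eq_atTop]
    exact hyperfilter_le_cofinite
  have hTx : Tendsto (fun k => ‖T (x k)‖ ^ 2) U (𝓝 m) := by
    have := hq.mono_left hU
    exact this.congr fun k => hqx k
  have hTsub := tendsto_norm_sub_of_finite_functionals (U := U) g T hcomp
    (fun k => hbound _ (hx k)) hx
  -- A maximizing sequence converges strongly, with no appeal to weak limits. As T(x - x') → 0, the
  -- parallelogram law gives ‖T(x + x')‖² → 4m, hence ‖g(x + x')‖² is asymptotically at least 4. The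
  -- parallelogram law for g, with ‖g x‖, ‖g x'‖ ≤ 1, then forces g(x - x') → 0.
  have hgsub : Tendsto (fun p : ℕ × ℕ => ‖g (x p.1 - x p.2)‖ ^ 2)
      ((U : Filter ℕ) ×ˢ (U : Filter ℕ)) (𝓝 0) := by
    have hlim : Tendsto (fun p : ℕ × ℕ => 4 - m⁻¹ * (2 * ‖T (x p.1)‖ ^ 2 + 2 * ‖T (x p.2)‖ ^ 2 -
        ‖T (x p.1 - x p.2)‖ ^ 2)) ((U : Filter ℕ) ×ˢ (U : Filter ℕ))
        (𝓝 (4 - m⁻¹ * (2 * m + 2 * m - 0))) :=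
      ((((hTx.comp tendsto_fst).const_mul 2).add ((hTx.comp tendsto_snd).const_mul 2)).sub
        hTsub).const_mul m⁻¹ |>.const_sub 4
    have e : 4 - m⁻¹ * (2 * m + 2 * m - 0) = 0 := by field_simp; ring
    rw [e] at hlim
    refine squeeze_zero (fun p => sq_nonneg _) (fun p => ?_) hlim
    have h1 := parallelogram_law_with_norm_mul ℝ (g (x p.1)) (g (x p.2))
    have h2 := parallelogram_law_with_norm_mul ℝ (T (x p.1)) (T (x p.2))
    have h3 := hnorm (x p.1 + x p.2)
    simp only [map_add, map_sub] at h3 ⊢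
    have h4 : m⁻¹ * ‖T (x p.1) + T (x p.2)‖ ^ 2 ≤ ‖g (x p.1) + g (x p.2)‖ ^ 2 := by
      rw [inv_mul_le_iff₀ hm0]
      exact h3
    have h5 : ‖g (x p.1)‖ ^ 2 ≤ 1 := pow_le_one₀ (norm_nonneg _) (hx p.1)
    have h6 : ‖g (x p.2)‖ ^ 2 ≤ 1 := pow_le_one₀ (norm_nonneg _) (hx p.2)
    have h7 : 2 * ‖T (x p.1)‖ ^ 2 + 2 * ‖T (x p.2)‖ ^ 2 - ‖T (x p.1) - T (x p.2)‖ ^ 2 =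
        ‖T (x p.1) + T (x p.2)‖ ^ 2 := by nlinarith
    rw [h7]
    nlinarith
  have hcauchy : Cauchy ((U : Filter ℕ).map x) := by
    refine Metric.cauchy_iff.2 ⟨inferInstance, fun ε hε => ?_⟩
    have hδ : 0 < (ε / (|C₀| + 1)) ^ 2 := by positivity
    obtain ⟨s, hs, hs'⟩ := Filter.mem_prod_self_iff.1 (hgsub.eventually (gt_mem_nhds hδ))
    refine ⟨x '' s, image_mem_map hs, ?_⟩
    rintro _ ⟨k, hk, rfl⟩ _ ⟨j, hj, rfl⟩
    have h1 : ‖g (x k - x j)‖ < ε / (|C₀| + 1) :=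
      lt_of_pow_lt_pow_left₀ 2 (by positivity) (hs' (mk_mem_prod hk hj))
    rw [lt_div_iff₀ (by positivity)] at h1
    rw [dist_eq_norm]
    refine (hg _).trans_lt ?_
    nlinarith [le_abs_self C₀, norm_nonneg (g (x k - x j))]
  obtain ⟨z, hz⟩ := CompleteSpace.complete hcauchy
  have hz' : Tendsto x U (𝓝 z) := hz
  have hTz : ‖T z‖ ^ 2 = m :=
    tendsto_nhds_unique (((T.continuous.tendsto z).comp hz').norm.pow 2) hTx
  have hgz : ‖g z‖ ≤ 1 :=
    le_of_tendsto ((g.continuous.tendsto z).comp hz').norm (Eventually.of_forall hx)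
  have hgz' : m * ‖g z‖ ^ 2 ≤ m := by
    nlinarith [pow_le_one₀ (n := 2) (norm_nonneg _) hgz]
  refine ⟨z, fun h0 => ?_, fun y => ?_⟩
  · rw [h0, map_zero, norm_zero] at hTz
    simp at hTz
    exact hm0.ne hTz
  · rw [← sub_eq_zero]
    -- First variation: m‖g‖² - ‖T‖² is nonnegative on the line z + s y and its value at z is not
    -- positive, so the coefficient of s vanishes.
    refine eq_zero_of_forall_quadratic_nonneg (A := m * ‖g y‖ ^ 2 - ‖T y‖ ^ 2) fun s => ?_
    have h1 := hnorm (z + s • y)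
    rw [map_add, map_add, map_smul, map_smul, norm_add_sq_real, norm_add_sq_real, inner_smul_right,
      inner_smul_right, norm_smul, norm_smul, mul_pow, mul_pow, Real.norm_eq_abs, sq_abs] at h1
    nlinarith

end Maximizer

/-! ### The radial harmonic test function. -/

section RadialTest

variable {n : ℕ}

/-- A smooth function on `ℝ` that equals `s ^ (1 - n)` for `s ≥ r / 2` and vanishes for
`s ≤ r / 4`. -/
def slope (n : ℕ) (r s : ℝ) : ℝ := Real.smoothTransition (4 / r * s - 1) * (s ^ (n - 1))⁻¹

theorem slope_eq {r s : ℝ} (hr : 0 < r) (hs : r / 2 ≤ s) : slope n r s = (s ^ (n - 1))⁻¹ := by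
  rw [slope, Real.smoothTransition.one_of_one_le, one_mul]
  rw [le_sub_iff_add_le, div_mul_eq_mul_div, le_div_iff₀ hr]
  linarith

theorem slope_eq_zero {r s : ℝ} (hr : 0 < r) (hs : s ≤ r / 4) : slope n r s = 0 := by
  rw [slope, Real.smoothTransition.zero_of_nonpos, zero_mul]
  rw [sub_nonpos, div_mul_eq_mul_div, div_le_iff₀ hr]
  linarith

theorem contDiff_slope {r : ℝ} (hr : 0 < r) : ContDiff ℝ ∞ (slope n r) := by
  refine contDiff_iff_contDiffAt.2 fun s => ?_
  rcases eq_or_ne s 0 with rfl | hs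
  · have : slope n r =ᶠ[𝓝 0] fun _ => 0 := by
      filter_upwards [gt_mem_nhds (show (0 : ℝ) < r / 4 by positivity)] with s hs
      exact slope_eq_zero hr hs.le
    exact contDiffAt_const.congr_of_eventuallyEq this
  · unfold slope
    refine ContDiffAt.mul ?_ (ContDiffAt.inv (by fun_prop) (pow_ne_zero _ hs))
    exact Real.smoothTransition.contDiff.contDiffAt.comp s (by fun_prop)

/-- A smooth function on `ℝ` that equals `∫ t in r..s, t ^ (1 - n)` for `s ≥ r / 2`. -/
def profile (n : ℕ) (r s : ℝ) : ℝ := ∫ t in r..s, slope n r t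

theorem hasDerivAt_profile {r : ℝ} (hr : 0 < r) (s : ℝ) :
    HasDerivAt (profile n r) (slope n r s) s :=
  (contDiff_slope hr).continuous.integral_hasStrictDerivAt r s |>.hasDerivAt

theorem contDiff_profile {r : ℝ} (hr : 0 < r) : ContDiff ℝ ∞ (profile n r) := by
  have hd : deriv (profile n r) = slope n r := funext fun s => (hasDerivAt_profile hr s).deriv
  rw [contDiff_infty_iff_deriv, hd]
  exact ⟨fun s => (hasDerivAt_profile hr s).differentiableAt, contDiff_slope hr⟩

theorem profile_eq_radialResistance {r s : ℝ} (hr : 0 < r) (hs : r / 2 ≤ s) :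
    profile n r s = radialResistance n r s := by
  refine intervalIntegral.integral_congr fun t ht => slope_eq hr ?_
  exact (le_min (by linarith) hs).trans ht.1

theorem profile_self (r : ℝ) : profile n r r = 0 := intervalIntegral.integral_same

/-- Constancy near 0 makes the radial function smooth at its centre, where the norm is not
differentiable. The modification stays inside the hole. -/
theorem profile_of_le {r s : ℝ} (hr : 0 < r) (hs0 : 0 ≤ s) (hs : s ≤ r / 4) :
    profile n r s = profile n r 0 := by
  have hi : ∀ a b, IntervalIntegrable (slope n r) volume a b :=
    (contDiff_slope hr).continuous.intervalIntegrable
  rw [profile, profile, ← sub_eq_zero, intervalIntegral.integral_interval_sub_left (hi _ _) (hi _ _)]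
  refine (intervalIntegral.integral_congr (g := fun _ => 0) fun t ht => ?_).trans (by simp)
  rw [uIcc_of_le hs0] at ht
  exact slope_eq_zero hr (ht.2.trans hs)

/-- The radial function with profile `profile n r` about `c`: harmonic outside `B(c, r / 2)`. -/
def radial (n : ℕ) (r : ℝ) (c x : Euc n) : ℝ := profile n r ‖x - c‖

theorem contDiff_radial {r : ℝ} (hr : 0 < r) (c : Euc n) : ContDiff ℝ ∞ (radial n r c) := by
  refine contDiff_iff_contDiffAt.2 fun x => ?_
  rcases eq_or_ne x c with rfl | hx
  · have : radial n r x =ᶠ[𝓝 x] fun _ => profile n r 0 := by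
      filter_upwards [ball_mem_nhds x (show (0 : ℝ) < r / 4 by positivity)] with y hy
      exact profile_of_le hr (norm_nonneg _) (mem_ball_iff_norm.1 hy).le
    exact contDiffAt_const.congr_of_eventuallyEq this
  · exact (contDiff_profile hr).contDiffAt.comp x
      ((contDiffAt_id.sub contDiffAt_const).norm ℝ (sub_ne_zero.2 hx))

theorem hasFDerivAt_norm {x : Euc n} (hx : x ≠ 0) :
    HasFDerivAt (fun y : Euc n => ‖y‖) (‖x‖⁻¹ • innerSL ℝ x) x := by
  have h1 := (hasStrictFDerivAt_norm_sq x).hasFDerivAt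
  have h2 := (Real.hasDerivAt_sqrt (pow_ne_zero 2 (norm_ne_zero_iff.2 hx))).comp_hasFDerivAt x h1
  simp only [Function.comp_def, Real.sqrt_sq (norm_nonneg _)] at h2
  refine h2.congr_fderiv ?_
  rw [← Nat.cast_smul_eq_nsmul ℝ 2 (innerSL ℝ x), smul_smul]
  congr 1
  push_cast
  field_simp

theorem fderiv_radial {r : ℝ} (hr : 0 < r) (c : Euc n) {x : Euc n} (hx : x ≠ c) (v : Euc n) :
    fderiv ℝ (radial n r c) x v = slope n r ‖x - c‖ * (‖x - c‖⁻¹ * inner ℝ (x - c) v) := by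
  have h1 : HasFDerivAt (fun y : Euc n => ‖y - c‖) (‖x - c‖⁻¹ • innerSL ℝ (x - c)) x := by
    have := HasFDerivAt.comp (g := fun y : Euc n => ‖y‖) (f := fun y : Euc n => y - c) x
      (hasFDerivAt_norm (sub_ne_zero.2 hx)) ((hasFDerivAt_id x).sub_const c)
    simpa [Function.comp_def] using this
  have h2 := (hasDerivAt_profile (n := n) hr ‖x - c‖).comp_hasFDerivAt x h1
  have h3 : fderiv ℝ (radial n r c) x = _ := h2.fderiv
  rw [h3]
  rfl

theorem gradient_radial {r : ℝ} (hr : 0 < r) (c : Euc n) {x : Euc n} (hx : x ≠ c) :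
    ∇ (radial n r c) x = (slope n r ‖x - c‖ * ‖x - c‖⁻¹) • (x - c) := by
  refine ext_inner_right ℝ fun v => ?_
  rw [inner_gradient_left, fderiv_radial hr c hx, inner_smul_left]
  simp [mul_assoc]

theorem norm_gradient_radial {r : ℝ} (hr : 0 < r) (c : Euc n) {x : Euc n} (hx : r ≤ ‖x - c‖) :
    ‖∇ (radial n r c) x‖ = (‖x - c‖ ^ (n - 1))⁻¹ := by
  have h0 : 0 < ‖x - c‖ := hr.trans_le hx
  rw [gradient_radial hr c (sub_ne_zero.1 (norm_pos_iff.1 h0)), norm_smul, norm_mul, norm_inv,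
    norm_norm, inv_mul_cancel_right₀ h0.ne', slope_eq hr (by linarith),
    Real.norm_of_nonneg (by positivity)]

/-- On a ray from `c` the gradient of the radial function is s^(1-n) w, which cancels the polar
density and leaves the derivative of ψ along the ray. This takes the place of Green's formula for
the harmonic function. -/
theorem setIntegral_ray_eq_sub {r : ℝ} (hr : 0 < r) (c : Euc n) {ψ : Euc n → ℝ}
    (hψ : ContDiff ℝ 1 ψ) {A : Set (Euc n)} (w : sphere (0 : Euc n) 1) {α β : ℝ} (hα : r ≤ α)
    (hαβ : α ≤ β) (hA : ∀ s : ℝ, 0 < s → (c + s • (w : Euc n) ∈ A ↔ s ∈ Ioo α β)) :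
    ∫ s in Ioi (0 : ℝ), s ^ (n - 1) *
        A.indicator (fun x => inner ℝ (∇ (radial n r c) x) (∇ ψ x)) (c + s • (w : Euc n)) =
      ψ (c + β • (w : Euc n)) - ψ (c + α • (w : Euc n)) := by
  have hα0 : 0 < α := hr.trans_le hα
  have hc : Continuous fun s : ℝ => fderiv ℝ ψ (c + s • (w : Euc n)) w :=
    ((hψ.continuous_fderiv one_ne_zero).comp (by fun_prop)).clm_apply continuous_const
  rw [← intervalIntegral.integral_eq_sub_of_hasDerivAt
    (fun s _ => hasDerivAt_comp_ray hψ c w s) (hc.intervalIntegrable _ _),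
    intervalIntegral.integral_of_le hαβ, integral_Ioc_eq_integral_Ioo,
    ← integral_indicator measurableSet_Ioi, ← integral_indicator measurableSet_Ioo]
  congr 1
  ext s
  by_cases hs : 0 < s
  · rw [indicator_of_mem (show s ∈ Ioi (0 : ℝ) from hs)]
    by_cases h : s ∈ Ioo α β
    · rw [indicator_of_mem h, indicator_of_mem ((hA s hs).2 h)]
      have e : c + s • (w : Euc n) - c = s • (w : Euc n) := by abel
      have hne : c + s • (w : Euc n) ≠ c := by
        rw [← sub_ne_zero, e]
        refine smul_ne_zero hs.ne' ?_
        rw [← norm_ne_zero_iff, norm_sphere]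
        exact one_ne_zero
      rw [gradient_radial hr c hne, e, norm_smul, norm_sphere, mul_one, Real.norm_of_nonneg hs.le,
        inner_smul_left, inner_smul_left, real_inner_comm, inner_gradient_left,
        slope_eq hr (by linarith [h.1])]
      have : s ^ (n - 1) ≠ 0 := (pow_pos hs _).ne'
      simp only [conj_trivial]
      field_simp
    · rw [indicator_of_notMem h, indicator_of_notMem fun h' => h ((hA s hs).1 h'), mul_zero]
  · rw [indicator_of_notMem (show s ∉ Ioi (0 : ℝ) from hs), indicator_of_notMem]
    exact fun h => hs (hα0.trans h.1)

/-- ‖p + s w‖² - a² is a quadratic in s with roots -β ± √q, where β = ⟨p, w⟩; since ‖p‖ < a, exactly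
one root is positive. -/
theorem exists_ray_exit {p w : Euc n} (hw : ‖w‖ = 1) {a : ℝ} (ha : ‖p‖ < a) :
    ∃ ρ : ℝ, 0 < ρ ∧ ‖p + ρ • w‖ = a ∧
      ∀ s : ℝ, 0 ≤ s → ((‖p + s • w‖ < a ↔ s < ρ) ∧ (‖p + s • w‖ ≤ a ↔ s ≤ ρ)) := by
  have ha0 : 0 < a := (norm_nonneg p).trans_lt ha
  set β := inner ℝ p w
  set q := β ^ 2 + (a ^ 2 - ‖p‖ ^ 2)
  have hpos : 0 < a ^ 2 - ‖p‖ ^ 2 := by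
    have : ‖p‖ ^ 2 < a ^ 2 := by gcongr
    linarith
  have hq : 0 ≤ q := by positivity
  have hs2 : √q ^ 2 = q := Real.sq_sqrt hq
  have habs : |β| < √q := Real.lt_sqrt_of_sq_lt (by rw [sq_abs]; simp only [q]; linarith)
  obtain ⟨h1, h2⟩ := abs_lt.1 habs
  set ρ := -β + √q
  have hρ : 0 < ρ := by simp only [ρ]; linarith
  have key : ∀ s : ℝ, ‖p + s • w‖ ^ 2 - a ^ 2 = (s - ρ) * (s + β + √q) := by
    intro s
    rw [norm_add_sq_real, inner_smul_right, norm_smul, hw, mul_one, Real.norm_eq_abs, sq_abs]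
    simp only [ρ]
    have : √q ^ 2 = β ^ 2 + (a ^ 2 - ‖p‖ ^ 2) := hs2
    linear_combination this
  have hlt : ∀ s : ℝ, 0 ≤ s → (‖p + s • w‖ < a ↔ s < ρ) := by
    intro s hs
    have hp : 0 < s + β + √q := by linarith
    rw [← sq_lt_sq₀ (norm_nonneg _) ha0.le, ← sub_neg, key, ← not_le, mul_nonneg_iff_of_pos_right hp, not_le,
      sub_neg]
  have hle : ∀ s : ℝ, 0 ≤ s → (‖p + s • w‖ ≤ a ↔ s ≤ ρ) := by
    intro s hs
    have hp : 0 < s + β + √q := by linarith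
    rw [← sq_le_sq₀ (norm_nonneg _) ha0.le, ← sub_nonpos, key, ← not_lt, mul_pos_iff_of_pos_right hp, not_lt,
      sub_nonpos]
  refine ⟨ρ, hρ, ?_, fun s hs => ⟨hlt s hs, hle s hs⟩⟩
  exact le_antisymm ((hle ρ hρ.le).2 le_rfl) (not_lt.1 fun h => lt_irrefl _ ((hlt ρ hρ.le).1 h))

theorem integrable_sphere_of_continuous {f : Euc n → ℝ} (hf : Continuous f) (c : Euc n) (ρ : ℝ) :
    Integrable (fun w : sphere (0 : Euc n) 1 => f (c + ρ • (w : Euc n))) (sphereMeasure n) := by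
  have hc : Continuous fun w : sphere (0 : Euc n) 1 => f (c + ρ • (w : Euc n)) := by fun_prop
  obtain ⟨C, hC⟩ := isCompact_univ.exists_bound_of_continuousOn hc.continuousOn
  exact Integrable.of_bound hc.aestronglyMeasurable C (ae_of_all _ fun w => hC w (mem_univ _))

/-- Compute ∫ ⟨∇w₁, ∇w₂⟩ over the annulus a < |x - c₁| < R twice, where wᵢ is the radial function
about cᵢ. Rays from c₁ give the difference of the spherical integrals of w₂. Rays from c₂ give the
difference of w₁ at the points of entry and exit, where w₁ is constant. This is Green's symmetric
identity; it shows that the deviation of w₂ from the concentric profile has an integral independent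
of the radius. -/
theorem integral_radial_sub (hn : 0 < n) {r : ℝ} (hr : 0 < r) (c₁ c₂ : Euc n) {a R : ℝ}
    (ha : dist c₂ c₁ + r < a) (haR : a ≤ R) :
    ∫ w : sphere (0 : Euc n) 1, (radial n r c₂ (c₁ + R • (w : Euc n)) - profile n r R)
        ∂(sphereMeasure n) =
      ∫ w : sphere (0 : Euc n) 1, (radial n r c₂ (c₁ + a • (w : Euc n)) - profile n r a)
        ∂(sphereMeasure n) := by
  have hd0 : 0 ≤ dist c₂ c₁ := dist_nonneg
  set A := perforatedBall c₁ R c₁ a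
  have hA : MeasurableSet A := measurableSet_perforatedBall _ _ _ _
  have s1 : ContDiff ℝ 1 (radial n r c₁) := (contDiff_radial hr c₁).of_le (by simp)
  have s2 : ContDiff ℝ 1 (radial n r c₂) := (contDiff_radial hr c₂).of_le (by simp)
  have hcont : Continuous fun x => inner ℝ (∇ (radial n r c₁) x) (∇ (radial n r c₂) x) :=
    (continuous_gradient s1).inner (continuous_gradient s2)
  have hcomm : (fun x => inner ℝ (∇ (radial n r c₁) x) (∇ (radial n r c₂) x)) =
      fun x => inner ℝ (∇ (radial n r c₂) x) (∇ (radial n r c₁) x) :=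
    funext fun x => real_inner_comm _ _
  have hint : Integrable (A.indicator fun x =>
      inner ℝ (∇ (radial n r c₁) x) (∇ (radial n r c₂) x)) :=
    (integrable_indicator_iff hA).2 (integrableOn_of_continuous_isBounded hcont
      (isBounded_ball.subset sdiff_subset))
  have e1 := integral_polar hn c₁ _ hint
  have e2 := integral_polar hn c₂ _ hint
  have f1 : ∀ w : sphere (0 : Euc n) 1, _ := fun w =>
    setIntegral_ray_eq_sub hr c₁ s2 (A := A) w (α := a) (β := R) (by linarith) haR (fun s hs => by
      rw [show A = ball c₁ R \ closedBall c₁ a from rfl, Set.mem_sdiff,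
        add_smul_mem_ball_iff c₁ hs.le, add_smul_mem_closedBall_iff c₁ hs.le, not_le, and_comm]
      rfl)
  have f2 : ∀ w : sphere (0 : Euc n) 1, ∫ s in Ioi (0 : ℝ), s ^ (n - 1) * A.indicator (fun x =>
      inner ℝ (∇ (radial n r c₂) x) (∇ (radial n r c₁) x)) (c₂ + s • (w : Euc n)) =
      profile n r R - profile n r a := by
    intro w
    have hdn : ‖c₂ - c₁‖ = dist c₂ c₁ := (dist_eq_norm _ _).symm
    obtain ⟨α, hα0, hα1, hα2⟩ := exists_ray_exit (p := c₂ - c₁) (norm_sphere w) (a := a)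
      (by rw [hdn]; linarith)
    obtain ⟨β, hβ0, hβ1, hβ2⟩ := exists_ray_exit (p := c₂ - c₁) (norm_sphere w) (a := R)
      (by rw [hdn]; linarith)
    have e : ∀ s : ℝ, c₂ + s • (w : Euc n) - c₁ = c₂ - c₁ + s • (w : Euc n) := fun s => by abel
    have hrα : r ≤ α := by
      have := norm_add_le (c₂ - c₁) (α • (w : Euc n))
      rw [hα1, hdn, norm_smul, norm_sphere, mul_one, Real.norm_of_nonneg hα0.le] at this
      linarith
    have hαβ : α ≤ β := (hβ2 α hα0.le).2.1 (by rw [hα1]; exact haR)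
    rw [setIntegral_ray_eq_sub hr c₂ s1 w hrα hαβ (fun s hs => by
      rw [show A = ball c₁ R \ closedBall c₁ a from rfl, Set.mem_sdiff, mem_ball, mem_closedBall,
        dist_eq_norm, e, (hβ2 s hs.le).1, (hα2 s hs.le).2, not_le, and_comm]
      rfl)]
    simp only [radial, e, hα1, hβ1]
  rw [integral_congr_ae (ae_of_all _ f1)] at e1
  simp only [hcomm] at e1 e2
  rw [integral_congr_ae (ae_of_all _ f2)] at e2
  have i1 := integrable_sphere_of_continuous s2.continuous c₁ R
  have i2 := integrable_sphere_of_continuous s2.continuous c₁ a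
  rw [integral_sub i1 (integrable_const _), integral_sub i2 (integrable_const _)]
  have e3 := e1.symm.trans e2
  rw [integral_sub i1 i2, integral_sub (integrable_const _) (integrable_const _)] at e3
  linarith

/-- Beyond ρ ≥ 1 the slope s^(1-n) is at most 1/ρ, because n ≥ 2. This decay is used at large radii,
where in the plane the profile itself grows without bound. -/
theorem abs_profile_sub_le (hn : 2 ≤ n) {r : ℝ} (hr : 0 < r) {ρ s t : ℝ} (hρ : r ≤ ρ) (hρ1 : 1 ≤ ρ)
    (hs : ρ ≤ s) (ht : ρ ≤ t) : |profile n r s - profile n r t| ≤ ρ⁻¹ * |s - t| := by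
  have h := (convex_Ici ρ).norm_image_sub_le_of_norm_hasDerivWithin_le
    (f := profile n r) (f' := slope n r) (C := ρ⁻¹)
    (fun x _ => (hasDerivAt_profile hr x).hasDerivWithinAt) (fun x hx => by
      have hx' : ρ ≤ x := hx
      have hx0 : 0 < x := by linarith
      rw [slope_eq hr (by linarith), Real.norm_of_nonneg (by positivity)]
      refine inv_anti₀ (by linarith) (hx'.trans ?_)
      exact le_self_pow₀ (by linarith) (by omega)) (show t ∈ Ici ρ from ht) (show s ∈ Ici ρ from hs)
  simpa using h

/-- The mean of the radial harmonic function about `c₂` over a sphere about `c₁` that encloses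
`c₂` is the same as in the concentric case. -/
theorem integral_radial_sphere (hn : 2 ≤ n) {r : ℝ} (hr : 0 < r) (c₁ c₂ : Euc n) {R : ℝ}
    (hR : dist c₂ c₁ + r < R) :
    ∫ w : sphere (0 : Euc n) 1, (radial n r c₂ (c₁ + R • (w : Euc n)) - profile n r R)
        ∂(sphereMeasure n) = 0 := by
  set d := dist c₂ c₁
  have hd0 : 0 ≤ d := dist_nonneg
  set S := (sphereMeasure n).real univ
  set I := ∫ w : sphere (0 : Euc n) 1, (radial n r c₂ (c₁ + R • (w : Euc n)) - profile n r R)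
        ∂(sphereMeasure n)
  -- Evaluate the radius-independent integral on a large sphere of radius t. There the distances to
  -- the two centres differ by at most d, and the slope is at most 1/(t - d).
  have hb : ∀ᶠ t : ℝ in atTop, |I| ≤ (t - d)⁻¹ * d * S := by
    filter_upwards [eventually_ge_atTop (max R (d + r + 1))] with t ht
    have ht1 : R ≤ t := (le_max_left _ _).trans ht
    have ht2 : d + r + 1 ≤ t := (le_max_right _ _).trans ht
    have e : I = _ := (integral_radial_sub (by omega) hr c₁ c₂ hR ht1).symm
    rw [e, ← Real.norm_eq_abs]
    refine norm_integral_le_of_norm_le_const (ae_of_all _ fun w => ?_)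
    have h1 : ‖t • (w : Euc n)‖ = t := by
      rw [norm_smul, norm_sphere, mul_one, Real.norm_of_nonneg (by linarith)]
    have h2 : |‖c₁ + t • (w : Euc n) - c₂‖ - t| ≤ d := by
      have := abs_norm_sub_norm_le (c₁ + t • (w : Euc n) - c₂) (t • (w : Euc n))
      rw [h1] at this
      refine this.trans_eq ?_
      rw [show c₁ + t • (w : Euc n) - c₂ - t • (w : Euc n) = c₁ - c₂ by abel, ← dist_eq_norm,
        dist_comm]
    have h3 := abs_le.1 h2
    rw [Real.norm_eq_abs, radial]
    refine (abs_profile_sub_le hn hr (ρ := t - d) (by linarith) (by linarith) (by linarith)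
      (by linarith)).trans ?_
    have : 0 ≤ (t - d)⁻¹ := inv_nonneg.2 (by linarith)
    gcongr
  have hl : Tendsto (fun t : ℝ => (t - d)⁻¹ * d * S) atTop (𝓝 (0 * d * S)) :=
    ((tendsto_inv_atTop_zero.comp (tendsto_atTop_add_const_right _ (-d) tendsto_id)).mul_const
      d).mul_const S
  rw [zero_mul, zero_mul] at hl
  exact abs_eq_zero.1 (le_antisymm (ge_of_tendsto hl hb) (abs_nonneg _))

/-- Jensen: the mean of w over the sphere is the concentric value, so integrating (w - mean)² ≥ 0
leaves the claim. -/
theorem le_integral_radial_sq (hn : 2 ≤ n) {r : ℝ} (hr : 0 < r) (c₁ c₂ : Euc n) {R : ℝ}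
    (hR : dist c₂ c₁ + r < R) :
    (sphereMeasure n).real univ * profile n r R ^ 2 ≤
      ∫ w : sphere (0 : Euc n) 1, radial n r c₂ (c₁ + R • (w : Euc n)) ^ 2 ∂(sphereMeasure n) := by
  have hc : Continuous (radial n r c₂) := (contDiff_radial hr c₂).continuous
  have i1 := integrable_sphere_of_continuous hc c₁ R
  have i2 : Integrable (fun w : sphere (0 : Euc n) 1 => radial n r c₂ (c₁ + R • (w : Euc n)) ^ 2)
      (sphereMeasure n) := integrable_sphere_of_continuous (hc.pow 2) c₁ R
  have h0 := integral_radial_sphere hn hr c₁ c₂ hR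
  have h1 : 0 ≤ ∫ w : sphere (0 : Euc n) 1, (radial n r c₂ (c₁ + R • (w : Euc n)) ^ 2 -
      profile n r R ^ 2 - 2 * profile n r R *
        (radial n r c₂ (c₁ + R • (w : Euc n)) - profile n r R)) ∂(sphereMeasure n) := by
    refine integral_nonneg fun w => ?_
    simp only [Pi.zero_apply]
    nlinarith [sq_nonneg (radial n r c₂ (c₁ + R • (w : Euc n)) - profile n r R)]
  have i3 : Integrable (fun w : sphere (0 : Euc n) 1 => radial n r c₂ (c₁ + R • (w : Euc n)) ^ 2 -
      profile n r R ^ 2) (sphereMeasure n) := i2.sub (integrable_const _)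
  have i4 : Integrable (fun w : sphere (0 : Euc n) 1 => radial n r c₂ (c₁ + R • (w : Euc n)) -
      profile n r R) (sphereMeasure n) := i1.sub (integrable_const _)
  rw [integral_sub i3 (i4.const_mul _), integral_const_mul, h0,
    integral_sub i2 (integrable_const _), integral_const, smul_eq_mul] at h1
  linarith

theorem lintegral_gradient_radial_annulus (hn : 0 < n) {r R : ℝ} (hr : 0 < r) (hrR : r ≤ R)
    (c : Euc n) :
    ∫⁻ x in perforatedBall c R c r, ‖∇ (radial n r c) x‖ₑ ^ 2 =
      ENNReal.ofReal (profile n r R) * sphereMeasure n univ := by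
  have s1 : ContDiff ℝ 1 (radial n r c) := (contDiff_radial hr c).of_le (by simp)
  have hm : Measurable fun x => ‖∇ (radial n r c) x‖ₑ ^ 2 :=
    ((continuous_gradient s1).measurable.enorm).pow_const 2
  rw [lintegral_annulus hn c hr.le R _ hm, ← lintegral_const]
  refine lintegral_congr fun w => ?_
  rw [profile_eq_radialResistance hr (by linarith), radialResistance,
    intervalIntegral.integral_of_le hrR, integral_Ioc_eq_integral_Ioo,
    ofReal_integral_eq_lintegral_ofReal]
  · refine setLIntegral_congr_fun measurableSet_Ioo fun s hs => ?_
    have hs0 : 0 < s := hr.trans hs.1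
    have e : ‖c + s • (w : Euc n) - c‖ = s := by
      rw [add_sub_cancel_left, norm_smul, norm_sphere, mul_one, Real.norm_of_nonneg hs0.le]
    rw [← ofReal_norm, norm_gradient_radial hr c (by rw [e]; exact hs.1.le), e,
      ← ENNReal.ofReal_pow (by positivity), ← ENNReal.ofReal_mul (by positivity)]
    congr 1
    have : s ^ (n - 1) ≠ 0 := (pow_pos hs0 _).ne'
    field_simp
  · exact ((intervalIntegrable_inv_pow hr (hr.trans_le hrR) _).1).mono_set Ioo_subset_Ioc_self
  · filter_upwards [ae_restrict_mem measurableSet_Ioo] with s hs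
    exact inv_nonneg.2 (pow_nonneg (hr.trans hs.1).le _)

theorem volume_ball_diff_ball_comm (c₁ c₂ : Euc n) (R : ℝ) :
    volume (ball c₁ R \ ball c₂ R) = volume (ball c₂ R \ ball c₁ R) := by
  have h1 := measure_sdiff_add_inter (μ := (volume : Measure (Euc n))) (ball c₁ R)
    (measurableSet_ball (x := c₂) (ε := R))
  have h2 := measure_sdiff_add_inter (μ := (volume : Measure (Euc n))) (ball c₂ R)
    (measurableSet_ball (x := c₁) (ε := R))
  have h3 : volume (ball c₁ R) = volume (ball c₂ R) := by
    rw [Measure.addHaar_ball_center, ← Measure.addHaar_ball_center volume c₂]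
  rw [h3, ← h2, inter_comm (ball c₂ R)] at h1
  exact (ENNReal.add_left_inj (ne_top_of_le_ne_top measure_ball_lt_top.ne
    (measure_mono inter_subset_left))).1 h1

theorem enorm_gradient_radial_sq_le {r R : ℝ} (hr : 0 < r) (hR : r ≤ R) (c : Euc n) {x : Euc n}
    (hx : R ≤ ‖x - c‖) :
    ‖∇ (radial n r c) x‖ₑ ^ 2 ≤ ENNReal.ofReal ((R ^ (n - 1))⁻¹) ^ 2 := by
  rw [← ofReal_norm, norm_gradient_radial hr c (hR.trans hx)]
  have := hr.trans_le hR
  gcongr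

theorem enorm_gradient_radial_sq_lt (hn : 2 ≤ n) {r R : ℝ} (hr : 0 < r) (hR : r ≤ R) (c : Euc n)
    {x : Euc n} (hx : R < ‖x - c‖) :
    ‖∇ (radial n r c) x‖ₑ ^ 2 < ENNReal.ofReal ((R ^ (n - 1))⁻¹) ^ 2 := by
  rw [← ofReal_norm, norm_gradient_radial hr c (hR.trans hx.le)]
  have h0 := hr.trans_le hR
  refine ENNReal.pow_lt_pow_left two_ne_zero ((ENNReal.ofReal_lt_ofReal_iff (by positivity)).2 ?_)
  refine inv_strictAnti₀ (by positivity) ?_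
  exact pow_lt_pow_left₀ hx h0.le (by omega)

theorem le_enorm_gradient_radial_sq {r R : ℝ} (hr : 0 < r) (c : Euc n) {x : Euc n}
    (hxr : r ≤ ‖x - c‖) (hx : ‖x - c‖ ≤ R) :
    ENNReal.ofReal ((R ^ (n - 1))⁻¹) ^ 2 ≤ ‖∇ (radial n r c) x‖ₑ ^ 2 := by
  rw [← ofReal_norm, norm_gradient_radial hr c hxr]
  have := hr.trans_le hxr
  gcongr

theorem volume_ball_diff_closedBall_ne_zero {c₁ c₂ : Euc n} (hc : c₁ ≠ c₂) {R : ℝ}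
    (hd : dist c₁ c₂ < R) : volume (ball c₁ R \ closedBall c₂ R) ≠ 0 := by
  have hd0 : 0 < dist c₁ c₂ := dist_pos.2 hc
  set d := dist c₁ c₂
  have ho : IsOpen (ball c₁ R \ closedBall c₂ R) := isOpen_ball.sdiff isClosed_closedBall
  -- A point on the line of centres, beyond c₁ as seen from c₂: its distance is R - d/2 to c₁ and R
  -- + d/2 to c₂.
  refine (ho.measure_pos volume ⟨c₁ + ((R - d / 2) / d) • (c₁ - c₂), ?_, ?_⟩).ne'
  · rw [mem_ball, dist_eq_norm, add_sub_cancel_left, norm_smul, ← dist_eq_norm,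
      Real.norm_of_nonneg (div_nonneg (by linarith) hd0.le), div_mul_cancel₀ _ hd0.ne']
    linarith
  · have e : c₁ + ((R - d / 2) / d) • (c₁ - c₂) - c₂ = ((R + d / 2) / d) • (c₁ - c₂) := by
      have : (R + d / 2) / d = 1 + (R - d / 2) / d := by field_simp; ring
      rw [this, add_smul, one_smul]
      abel
    rw [mem_closedBall, dist_eq_norm, e, norm_smul, ← dist_eq_norm,
      Real.norm_of_nonneg (div_nonneg (by linarith) hd0.le), div_mul_cancel₀ _ hd0.ne']
    linarith

theorem setLIntegral_diff_split {A B D : Set (Euc n)} (hB : MeasurableSet B) (h : D ⊆ B)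
    (f : Euc n → ℝ≥0∞) :
    ∫⁻ x in A \ D, f x = (∫⁻ x in (A ∩ B) \ D, f x) + ∫⁻ x in A \ B, f x := by
  have e1 : A \ D ∩ B = (A ∩ B) \ D := by
    ext x
    simp only [mem_inter_iff, Set.mem_sdiff]
    tauto
  have e2 : (A \ D) \ B = A \ B := by
    ext x
    simp only [Set.mem_sdiff]
    exact ⟨fun h' => ⟨h'.1.1, h'.2⟩, fun h' => ⟨⟨h'.1, fun h'' => h'.2 (h h'')⟩, h'.2⟩⟩
  rw [← lintegral_inter_add_sdiff f (A \ D) hB, e1, e2]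

/-- Among all positions of the outer ball, the Dirichlet integral of the radial harmonic function
about the centre of the hole is largest in the concentric case. -/
theorem lintegral_gradient_radial_le (hn : 2 ≤ n) {c₁ c₂ : Euc n} {R r : ℝ} (hr : 0 < r)
    (h : closedBall c₂ r ⊆ ball c₁ R) :
    ∫⁻ x in perforatedBall c₁ R c₂ r, ‖∇ (radial n r c₂) x‖ₑ ^ 2 ≤
        ENNReal.ofReal (profile n r R) * sphereMeasure n univ ∧
      (c₁ ≠ c₂ → ∫⁻ x in perforatedBall c₁ R c₂ r, ‖∇ (radial n r c₂) x‖ₑ ^ 2 <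
        ENNReal.ofReal (profile n r R) * sphereMeasure n univ) := by
  have hd := dist_add_lt_of_closedBall_subset (by omega) hr h
  have hd0 : 0 ≤ dist c₂ c₁ := dist_nonneg
  have hrR : r < R := by linarith
  have h' : closedBall c₂ r ⊆ ball c₂ R := closedBall_subset_ball hrR
  rw [← lintegral_gradient_radial_annulus (by omega) hr hrR.le c₂]
  set f : Euc n → ℝ≥0∞ := fun x => ‖∇ (radial n r c₂) x‖ₑ ^ 2
  -- The value of |∇w|² at distance R from c₂ separates the two pieces: it is a lower bound on
  -- B(c₂,R) \ B(c₁,R) and an upper bound on B(c₁,R) \ B(c₂,R), which has the same volume.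
  set m : ℝ≥0∞ := ENNReal.ofReal ((R ^ (n - 1))⁻¹) ^ 2
  have hswap : ∫⁻ x in perforatedBall c₂ R c₂ r, f x =
      (∫⁻ x in (ball c₁ R ∩ ball c₂ R) \ closedBall c₂ r, f x) +
        ∫⁻ x in ball c₂ R \ ball c₁ R, f x := by
    rw [inter_comm]
    exact setLIntegral_diff_split measurableSet_ball h f
  have hmeas : ∀ a b : Euc n, MeasurableSet (ball a R \ ball b R) := fun a b =>
    measurableSet_ball.diff measurableSet_ball
  have hlow : m * volume (ball c₁ R \ ball c₂ R) ≤ ∫⁻ x in ball c₂ R \ ball c₁ R, f x := by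
    rw [volume_ball_diff_ball_comm, ← setLIntegral_const]
    refine setLIntegral_mono' (hmeas _ _) fun x hx => ?_
    have hx1 : ‖x - c₂‖ < R := mem_ball_iff_norm.1 hx.1
    refine le_enorm_gradient_radial_sq hr c₂ ?_ hx1.le
    by_contra! hlt
    exact hx.2 (h (mem_closedBall_iff_norm.2 hlt.le))
  have hup : ∀ x ∈ ball c₁ R \ ball c₂ R, f x ≤ m := fun x hx =>
    enorm_gradient_radial_sq_le hr hrR.le c₂ (not_lt.1 fun hlt => hx.2 (mem_ball_iff_norm.2 hlt))
  have hfin : volume (ball c₁ R \ ball c₂ R) ≠ ⊤ :=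
    ne_top_of_le_ne_top measure_ball_lt_top.ne (measure_mono sdiff_subset)
  have hle : ∫⁻ x in ball c₁ R \ ball c₂ R, f x ≤ m * volume (ball c₁ R \ ball c₂ R) := by
    rw [← setLIntegral_const]
    exact setLIntegral_mono' (hmeas _ _) hup
  have hsplit : ∫⁻ x in perforatedBall c₁ R c₂ r, f x =
      (∫⁻ x in (ball c₁ R ∩ ball c₂ R) \ closedBall c₂ r, f x) +
        ∫⁻ x in ball c₁ R \ ball c₂ R, f x :=
    setLIntegral_diff_split measurableSet_ball h' f
  rw [hsplit, hswap]
  refine ⟨add_le_add le_rfl (hle.trans hlow), fun hne => ?_⟩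
  have s1 : ContDiff ℝ 1 (radial n r c₂) := (contDiff_radial hr c₂).of_le (by simp)
  have hcommon : ∫⁻ x in (ball c₁ R ∩ ball c₂ R) \ closedBall c₂ r, f x ≠ ⊤ := by
    refine ne_top_of_le_ne_top ?_ (le_self_add.trans_eq hswap.symm)
    rw [lintegral_gradient_radial_annulus (by omega) hr hrR.le c₂]
    finiteness
  refine ENNReal.add_lt_add_left hcommon (lt_of_lt_of_le ?_ hlow)
  rw [← setLIntegral_const]
  have hsub : ball c₁ R \ closedBall c₂ R ⊆ ball c₁ R \ ball c₂ R :=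
    sdiff_subset_sdiff_right ball_subset_closedBall
  -- The upper bound is strict at distance more than R from c₂, and for distinct centres this part
  -- has positive volume.
  refine lintegral_strict_mono_of_ae_le_of_ae_lt_on (s := ball c₁ R \ closedBall c₂ R)
    aemeasurable_const ?_ ?_ ?_ ?_
  · exact ne_top_of_le_ne_top (by finiteness) hle
  · filter_upwards [ae_restrict_mem (hmeas c₁ c₂)] with x hx using hup x hx
  · rw [Measure.restrict_apply (measurableSet_ball.diff measurableSet_closedBall),
      inter_eq_left.2 hsub]
    exact volume_ball_diff_closedBall_ne_zero hne (by rw [dist_comm]; linarith)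
  · refine ae_of_all _ fun x hx => ?_
    exact enorm_gradient_radial_sq_lt hn hr hrR.le c₂
      (not_le.1 fun hle => hx.2 (mem_closedBall_iff_norm.2 hle))

end RadialTest

/-! ### Admissible functions as a closed space of triples. -/

section FunctionSpace

variable {n : ℕ}

section Smooth

variable {φ ψ : Euc n → ℝ}

theorem contDiff_one_of_smooth (hφ : ContDiff ℝ ∞ φ) : ContDiff ℝ 1 φ := hφ.of_le (by simp)

theorem differentiable_of_smooth (hφ : ContDiff ℝ ∞ φ) : Differentiable ℝ φ :=
  hφ.differentiable (by simp)

theorem gradient_add_of_smooth (hφ : ContDiff ℝ ∞ φ) (hψ : ContDiff ℝ ∞ ψ) (x : Euc n) :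
    ∇ (fun y => φ y + ψ y) x = ∇ φ x + ∇ ψ x := by
  rw [gradient, fderiv_fun_add (differentiable_of_smooth hφ x) (differentiable_of_smooth hψ x),
    map_add]
  rfl

theorem gradient_const_mul_of_smooth (hφ : ContDiff ℝ ∞ φ) (a : ℝ) (x : Euc n) :
    ∇ (fun y => a * φ y) x = a • ∇ φ x := by
  rw [gradient, fderiv_const_mul (differentiable_of_smooth hφ x), map_smul]
  rfl

theorem gradient_mul_of_smooth (hφ : ContDiff ℝ ∞ φ) (hψ : ContDiff ℝ ∞ ψ) (x : Euc n) :
    ∇ (fun y => φ y * ψ y) x = φ x • ∇ ψ x + ψ x • ∇ φ x := by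
  rw [gradient, fderiv_fun_mul (differentiable_of_smooth hφ x) (differentiable_of_smooth hψ x),
    map_add, map_smul, map_smul]
  rfl

theorem memLp_restrict_of_continuous {F : Type*} [NormedAddCommGroup F] {f : Euc n → F}
    [MeasurableSpace F] [BorelSpace F] [SecondCountableTopology F]
    (hf : Continuous f) {Q : Set (Euc n)} (hQ : MeasurableSet Q) (hb : Bornology.IsBounded Q) :
    MemLp f 2 (volume.restrict Q) := by
  obtain ⟨ρ, hρ⟩ := hb.subset_closedBall 0
  obtain ⟨C, hC⟩ := (isCompact_closedBall (0 : Euc n) ρ).exists_bound_of_continuousOn hf.continuousOn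
  have : IsFiniteMeasure (volume.restrict Q) := ⟨by simpa using hb.measure_lt_top⟩
  refine MemLp.of_bound hf.aestronglyMeasurable C ?_
  filter_upwards [ae_restrict_mem hQ] with x hx using hC x (hρ hx)

theorem memLp_surfaceMeasure_of_continuous {f : Euc n → ℝ} (hf : Continuous f) (c : Euc n) {ρ : ℝ}
    (hρ : 0 ≤ ρ) : MemLp f 2 (surfaceMeasure c ρ) := by
  obtain ⟨C, hC⟩ := (isCompact_sphere c ρ).exists_bound_of_continuousOn hf.continuousOn
  refine MemLp.of_bound hf.aestronglyMeasurable C ?_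
  filter_upwards [ae_surfaceMeasure_mem_sphere c hρ] with x hx using hC x hx

theorem isBounded_perforatedBall (c₁ : Euc n) (R : ℝ) (c₂ : Euc n) (r : ℝ) :
    Bornology.IsBounded (perforatedBall c₁ R c₂ r) :=
  isBounded_ball.subset sdiff_subset

theorem setIntegral_smooth_mul_fderiv {Ω : Set (Euc n)} (hφ : ContDiff ℝ ∞ φ) (hψ : ContDiff ℝ ∞ ψ)
    (hc : HasCompactSupport ψ) (hs : tsupport ψ ⊆ Ω) (v : Euc n) :
    ∫ x in Ω, φ x * fderiv ℝ ψ x v = - ∫ x in Ω, inner ℝ (∇ φ x) v * ψ x := by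
  have h0 : ∀ x, x ∉ Ω → ψ x = 0 := fun x hx => image_eq_zero_of_notMem_tsupport fun h => hx (hs h)
  have h1 : ∀ x, x ∉ Ω → fderiv ℝ ψ x = 0 := fun x hx =>
    image_eq_zero_of_notMem_tsupport fun h => hx (hs (tsupport_fderiv_subset ℝ h))
  have hcψ : Continuous (fderiv ℝ ψ) := hψ.continuous_fderiv (by simp)
  have hcφ : Continuous (fderiv ℝ φ) := hφ.continuous_fderiv (by simp)
  rw [setIntegral_eq_integral_of_forall_compl_eq_zero fun x hx => by simp [h1 x hx],
    setIntegral_eq_integral_of_forall_compl_eq_zero fun x hx => by simp [h0 x hx]]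
  simp only [inner_gradient_left]
  have hc' : HasCompactSupport fun x => fderiv ℝ ψ x v := by
    refine (hc.fderiv ℝ).mono' ?_
    intro x hx
    refine subset_tsupport _ ?_
    rw [Function.mem_support] at hx ⊢
    exact fun h => hx (by rw [h]; rfl)
  apply integral_mul_fderiv_eq_neg_fderiv_mul_of_integrable
  · exact ((hcφ.clm_apply continuous_const).mul hψ.continuous).integrable_of_hasCompactSupport
      hc.mul_left
  · exact (hφ.continuous.mul (hcψ.clm_apply continuous_const)).integrable_of_hasCompactSupport
      hc'.mul_left
  · exact (hφ.continuous.mul hψ.continuous).integrable_of_hasCompactSupport hc.mul_left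
  · exact fun x _ => differentiable_of_smooth hφ x
  · exact fun x _ => differentiable_of_smooth hψ x

end Smooth

theorem ofReal_norm_sq_eq_lintegral {α F : Type*} [MeasurableSpace α] {μ : Measure α}
    [NormedAddCommGroup F] (f : Lp F 2 μ) {g : α → F} (h : f =ᵐ[μ] g) :
    ENNReal.ofReal (‖f‖ ^ 2) = ∫⁻ x, ‖g x‖ₑ ^ 2 ∂μ := by
  rw [ENNReal.ofReal_pow (norm_nonneg _), ofReal_norm, Lp.enorm_def]
  have := eLpNorm_nnreal_pow_eq_lintegral (μ := μ) (f := f) (p := 2) two_ne_zero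
  simp only [NNReal.coe_ofNat, ENNReal.coe_ofNat, ENNReal.rpow_ofNat] at this
  rw [this]
  refine lintegral_congr_ae ?_
  filter_upwards [h] with x hx
  rw [hx]

variable (c₁ : Euc n) (R : ℝ) (c₂ : Euc n) (r : ℝ)

/-- The space of quadruples: function, gradient, outer trace, inner trace. -/
abbrev TraceQuad : Type :=
  Lp ℝ 2 (volume.restrict (perforatedBall c₁ R c₂ r)) ×
    Lp (Euc n) 2 (volume.restrict (perforatedBall c₁ R c₂ r)) ×
      Lp ℝ 2 (surfaceMeasure c₁ R) × Lp ℝ 2 (surfaceMeasure c₂ r)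

/-- The quadruple `x` comes from the function `φ`. -/
structure Represents (x : TraceQuad c₁ R c₂ r) (φ : Euc n → ℝ) : Prop where
  smooth : ContDiff ℝ ∞ φ
  fn : x.1 =ᵐ[volume.restrict (perforatedBall c₁ R c₂ r)] φ
  grad : x.2.1 =ᵐ[volume.restrict (perforatedBall c₁ R c₂ r)] ∇ φ
  outer : x.2.2.1 =ᵐ[surfaceMeasure c₁ R] φ
  inner : x.2.2.2 =ᵐ[surfaceMeasure c₂ r] φ

/-- The quadruples that come from smooth functions. -/
def smoothGraph : Submodule ℝ (TraceQuad c₁ R c₂ r) where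
  carrier := {x | ∃ φ, Represents c₁ R c₂ r x φ}
  add_mem' := by
    rintro x y ⟨φ, hφ⟩ ⟨ψ, hψ⟩
    refine ⟨fun z => φ z + ψ z, hφ.smooth.add hψ.smooth, ?_, ?_, ?_, ?_⟩
    · filter_upwards [Lp.coeFn_add x.1 y.1, hφ.fn, hψ.fn] with z h1 h2 h3
      rw [← h2, ← h3]
      exact h1
    · filter_upwards [Lp.coeFn_add x.2.1 y.2.1, hφ.grad, hψ.grad] with z h1 h2 h3
      rw [gradient_add_of_smooth hφ.smooth hψ.smooth, ← h2, ← h3]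
      exact h1
    · filter_upwards [Lp.coeFn_add x.2.2.1 y.2.2.1, hφ.outer, hψ.outer] with z h1 h2 h3
      rw [← h2, ← h3]
      exact h1
    · filter_upwards [Lp.coeFn_add x.2.2.2 y.2.2.2, hφ.inner, hψ.inner] with z h1 h2 h3
      rw [← h2, ← h3]
      exact h1
  zero_mem' := by
    refine ⟨fun _ => 0, contDiff_const, ?_, ?_, ?_, ?_⟩
    · exact Lp.coeFn_zero _ _ _
    · filter_upwards [Lp.coeFn_zero (Euc n) 2 (volume.restrict (perforatedBall c₁ R c₂ r))]
        with z hz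
      rw [gradient_fun_const]
      exact hz
    · exact Lp.coeFn_zero _ _ _
    · exact Lp.coeFn_zero _ _ _
  smul_mem' := by
    rintro a x ⟨φ, hφ⟩
    refine ⟨fun z => a * φ z, contDiff_const.mul hφ.smooth, ?_, ?_, ?_, ?_⟩
    · filter_upwards [Lp.coeFn_smul a x.1, hφ.fn] with z h1 h2
      rw [← h2]
      exact h1
    · filter_upwards [Lp.coeFn_smul a x.2.1, hφ.grad] with z h1 h2
      rw [gradient_const_mul_of_smooth hφ.smooth, ← h2]
      exact h1
    · filter_upwards [Lp.coeFn_smul a x.2.2.1, hφ.outer] with z h1 h2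
      rw [← h2]
      exact h1
    · filter_upwards [Lp.coeFn_smul a x.2.2.2, hφ.inner] with z h1 h2
      rw [← h2]
      exact h1

/-- The space of triples: function, gradient, outer trace. -/
abbrev TraceTriple : Type :=
  Lp ℝ 2 (volume.restrict (perforatedBall c₁ R c₂ r)) ×
    Lp (Euc n) 2 (volume.restrict (perforatedBall c₁ R c₂ r)) × Lp ℝ 2 (surfaceMeasure c₁ R)

/-- A triple, completed by the inner trace `0`. -/
def extendByZero : TraceTriple c₁ R c₂ r →L[ℝ] TraceQuad c₁ R c₂ r :=
  (ContinuousLinearMap.fst ℝ _ _).prod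
    (((ContinuousLinearMap.fst ℝ _ _).comp (ContinuousLinearMap.snd ℝ _ _)).prod
      (((ContinuousLinearMap.snd ℝ _ _).comp (ContinuousLinearMap.snd ℝ _ _)).prod 0))

/-- The triples (function, gradient, outer trace) of functions that vanish on the inner sphere. -/
def admissibleSpace : Submodule ℝ (TraceTriple c₁ R c₂ r) :=
  -- The closure is taken before the inner trace is set to zero: the approximating smooth functions
  -- need not vanish on the inner sphere, only the limit does.
  (smoothGraph c₁ R c₂ r).topologicalClosure.comap (extendByZero c₁ R c₂ r).toLinearMap

variable {c₁ R c₂ r}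

theorem mem_admissibleSpace_iff (x : TraceTriple c₁ R c₂ r) :
    x ∈ admissibleSpace c₁ R c₂ r ↔
      (x.1, x.2.1, x.2.2, 0) ∈ closure (smoothGraph c₁ R c₂ r : Set (TraceQuad c₁ R c₂ r)) :=
  Iff.rfl

theorem isClosed_admissibleSpace :
    IsClosed (admissibleSpace c₁ R c₂ r : Set (TraceTriple c₁ R c₂ r)) :=
  (smoothGraph c₁ R c₂ r).isClosed_topologicalClosure.preimage (extendByZero c₁ R c₂ r).continuous

instance : CompleteSpace (admissibleSpace c₁ R c₂ r) :=
  isClosed_admissibleSpace.completeSpace_coe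

/-- Closed conditions pass from smooth functions to the closure. -/
theorem closure_induction {P : Set (TraceQuad c₁ R c₂ r)} (hP : IsClosed P)
    (h : ∀ x φ, Represents c₁ R c₂ r x φ → x ∈ P) {x : TraceQuad c₁ R c₂ r}
    (hx : x ∈ closure (smoothGraph c₁ R c₂ r : Set (TraceQuad c₁ R c₂ r))) : x ∈ P :=
  by
  refine closure_minimal ?_ hP hx
  rintro y ⟨φ, hφ⟩
  exact h y φ hφ

/-- For a fixed test function both sides are L² inner products with fixed elements, so the identity
is a closed condition and reduces to integration by parts for smooth functions. -/
theorem weak_grad_of_mem_closure {x : TraceQuad c₁ R c₂ r}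
    (hx : x ∈ closure (smoothGraph c₁ R c₂ r : Set (TraceQuad c₁ R c₂ r)))
    {ψ : Euc n → ℝ} (hψ : ContDiff ℝ ∞ ψ) (hc : HasCompactSupport ψ)
    (hs : tsupport ψ ⊆ perforatedBall c₁ R c₂ r) (v : Euc n) :
    ∫ z in perforatedBall c₁ R c₂ r, x.1 z * fderiv ℝ ψ z v =
      - ∫ z in perforatedBall c₁ R c₂ r, inner ℝ (x.2.1 z) v * ψ z := by
  have hΩ := measurableSet_perforatedBall c₁ R c₂ r
  have hb := isBounded_perforatedBall c₁ R c₂ r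
  have m1 : MemLp (fun z => fderiv ℝ ψ z v) 2 (volume.restrict (perforatedBall c₁ R c₂ r)) :=
    memLp_restrict_of_continuous ((hψ.continuous_fderiv (by simp)).clm_apply continuous_const) hΩ hb
  have m2 : MemLp (fun z => ψ z • v) 2 (volume.restrict (perforatedBall c₁ R c₂ r)) :=
    memLp_restrict_of_continuous (hψ.continuous.smul continuous_const) hΩ hb
  have e1 : ∀ y : TraceQuad c₁ R c₂ r,
      ∫ z in perforatedBall c₁ R c₂ r, y.1 z * fderiv ℝ ψ z v = inner ℝ (m1.toLp _) y.1 := by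
    intro y
    rw [L2.inner_def]
    refine integral_congr_ae ?_
    filter_upwards [m1.coeFn_toLp] with z hz
    rw [hz]
    rfl
  have e2 : ∀ y : TraceQuad c₁ R c₂ r,
      ∫ z in perforatedBall c₁ R c₂ r, inner ℝ (y.2.1 z) v * ψ z =
        inner ℝ (m2.toLp _) y.2.1 := by
    intro y
    rw [L2.inner_def]
    refine integral_congr_ae ?_
    filter_upwards [m2.coeFn_toLp] with z hz
    rw [hz, inner_smul_left, real_inner_comm]
    simp [mul_comm]
  rw [e1, e2]
  refine closure_induction (P := {y | inner ℝ (m1.toLp _) y.1 = - inner ℝ (m2.toLp _) y.2.1})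
    (isClosed_eq (by fun_prop) (by fun_prop)) (fun y φ hφ => ?_) hx
  change inner ℝ (m1.toLp _) y.1 = - inner ℝ (m2.toLp _) y.2.1
  rw [← e1, ← e2]
  have h := setIntegral_smooth_mul_fderiv hφ.smooth hψ hc hs v
  rw [integral_congr_ae (g := fun z => φ z * fderiv ℝ ψ z v) (by
      filter_upwards [hφ.fn] with z hz
      rw [hz]), h,
    integral_congr_ae (f := fun z => inner ℝ (y.2.1 z) v * ψ z)
      (g := fun z => inner ℝ (∇ φ z) v * ψ z) (by
      filter_upwards [hφ.grad] with z hz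
      rw [hz])]

theorem tendsto_eLpNorm_of_tendsto_Lp {α F : Type*} [MeasurableSpace α] {μ : Measure α}
    [NormedAddCommGroup F] {f : ℕ → Lp F 2 μ} {g : Lp F 2 μ} (h : Tendsto f atTop (𝓝 g))
    {φ : ℕ → α → F} (hφ : ∀ k, f k =ᵐ[μ] φ k) {u : α → F} (hu : g =ᵐ[μ] u) :
    Tendsto (fun k => eLpNorm (fun x => φ k x - u x) 2 μ) atTop (𝓝 0) := by
  refine ((Lp.tendsto_Lp_iff_tendsto_eLpNorm' f g).1 h).congr fun k => eLpNorm_congr_ae ?_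
  filter_upwards [hφ k, hu] with x h1 h2
  simp [h1, h2]

theorem isAdmissible_of_mem {x : TraceTriple c₁ R c₂ r} (hx : x ∈ admissibleSpace c₁ R c₂ r) :
    IsAdmissible c₁ R c₂ r x.1 x.2.1 x.2.2 := by
  rw [mem_admissibleSpace_iff] at hx
  obtain ⟨y, hy, hlim⟩ := mem_closure_iff_seq_limit.1 hx
  choose φ hφ using hy
  have l1 := (continuous_fst.tendsto _).comp hlim
  have l2 := (continuous_snd.fst.tendsto _).comp hlim
  have l3 := (continuous_snd.snd.fst.tendsto _).comp hlim
  have l4 := (continuous_snd.snd.snd.tendsto _).comp hlim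
  have t1 := tendsto_eLpNorm_of_tendsto_Lp l1 (fun k => (hφ k).fn) (ae_eq_refl _)
  have t2 := tendsto_eLpNorm_of_tendsto_Lp l2 (fun k => (hφ k).grad) (ae_eq_refl _)
  have t3 := tendsto_eLpNorm_of_tendsto_Lp l3 (fun k => (hφ k).outer) (ae_eq_refl _)
  have t4 := tendsto_eLpNorm_of_tendsto_Lp l4 (fun k => (hφ k).inner) (Lp.coeFn_zero _ _ _)
  refine ⟨⟨Lp.memLp _, Lp.memLp _, fun ψ hψ hc hs v => weak_grad_of_mem_closure hx hψ hc hs v⟩,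
    ⟨Lp.memLp _, φ, fun k => (hφ k).smooth, t1, t2, t3⟩,
    ⟨MemLp.zero, φ, fun k => (hφ k).smooth, t1, t2, t4⟩⟩

theorem tendsto_eLpNorm_zero_of_le_add {α F F₁ F₂ : Type*} [MeasurableSpace α] {μ : Measure α}
    [NormedAddCommGroup F] [NormedAddCommGroup F₁] [NormedAddCommGroup F₂]
    {f : ℕ → α → F} {a : ℕ → α → F₁} {b : ℕ → α → F₂}
    (ha : ∀ k, AEStronglyMeasurable (a k) μ) (hb : ∀ k, AEStronglyMeasurable (b k) μ)
    (h : ∀ k, ∀ᵐ x ∂μ, ‖f k x‖ ≤ ‖a k x‖ + ‖b k x‖)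
    (ta : Tendsto (fun k => eLpNorm (a k) 2 μ) atTop (𝓝 0))
    (tb : Tendsto (fun k => eLpNorm (b k) 2 μ) atTop (𝓝 0)) :
    Tendsto (fun k => eLpNorm (f k) 2 μ) atTop (𝓝 0) := by
  have t := ta.add tb
  rw [add_zero] at t
  refine tendsto_of_tendsto_of_tendsto_of_le_of_le tendsto_const_nhds t (fun k => zero_le)
    fun k => ?_
  calc eLpNorm (f k) 2 μ ≤ eLpNorm (fun x => ‖a k x‖ + ‖b k x‖) 2 μ :=
        eLpNorm_mono_ae_real (h k)
    _ ≤ eLpNorm (fun x => ‖a k x‖) 2 μ + eLpNorm (fun x => ‖b k x‖) 2 μ :=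
        eLpNorm_add_le (ha k).norm (hb k).norm (by norm_num)
    _ = _ := by rw [eLpNorm_norm, eLpNorm_norm]

/-- The hole lies in the ball of radius α = |c₂ - c₁| + r < R about c₁, so a smooth step in |x -
c₁|² between α² and R² works. It is used to glue two approximating sequences. -/
theorem exists_cutoff (hn : 0 < n) (hr : 0 < r) (h : closedBall c₂ r ⊆ ball c₁ R) :
    ∃ χ : Euc n → ℝ, ContDiff ℝ ∞ χ ∧ (∀ x, 0 ≤ χ x ∧ χ x ≤ 1) ∧
      (∀ x ∈ sphere c₁ R, χ x = 1) ∧ ∀ x ∈ sphere c₂ r, χ x = 0 := by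
  have hd := dist_add_lt_of_closedBall_subset hn hr h
  have hd0 : 0 ≤ dist c₂ c₁ := dist_nonneg
  set α := dist c₂ c₁ + r
  have hα : 0 < R ^ 2 - α ^ 2 := by nlinarith
  refine ⟨fun x => Real.smoothTransition ((‖x - c₁‖ ^ 2 - α ^ 2) / (R ^ 2 - α ^ 2)), ?_, ?_, ?_, ?_⟩
  · refine Real.smoothTransition.contDiff.comp ?_
    exact (((contDiff_id.sub contDiff_const).norm_sq ℝ).sub contDiff_const).div_const _
  · exact fun x => ⟨Real.smoothTransition.nonneg _, Real.smoothTransition.le_one _⟩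
  · intro x hx
    simp only [mem_sphere_iff_norm.1 hx, div_self hα.ne']
    exact Real.smoothTransition.one
  · intro x hx
    refine Real.smoothTransition.zero_of_nonpos (div_nonpos_of_nonpos_of_nonneg ?_ hα.le)
    have h1 : ‖x - c₁‖ ≤ α := by
      rw [← dist_eq_norm]
      linarith [dist_triangle x c₂ c₁, mem_sphere.1 hx]
    have := pow_le_pow_left₀ (norm_nonneg _) h1 2
    linarith

theorem mem_smoothGraph_toLp (hr : 0 ≤ r) (hR : 0 ≤ R) {φ : Euc n → ℝ} (hφ : ContDiff ℝ ∞ φ) :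
    ∃ (m1 : MemLp φ 2 (volume.restrict (perforatedBall c₁ R c₂ r)))
      (m2 : MemLp (∇ φ) 2 (volume.restrict (perforatedBall c₁ R c₂ r)))
      (m3 : MemLp φ 2 (surfaceMeasure c₁ R)) (m4 : MemLp φ 2 (surfaceMeasure c₂ r)),
      Represents c₁ R c₂ r (m1.toLp φ, m2.toLp (∇ φ), m3.toLp φ, m4.toLp φ) φ := by
  have hΩ := measurableSet_perforatedBall c₁ R c₂ r
  have hb := isBounded_perforatedBall c₁ R c₂ r
  have m1 := memLp_restrict_of_continuous hφ.continuous hΩ hb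
  have m2 := memLp_restrict_of_continuous (continuous_gradient (contDiff_one_of_smooth hφ)) hΩ hb
  have m3 := memLp_surfaceMeasure_of_continuous hφ.continuous c₁ hR
  have m4 := memLp_surfaceMeasure_of_continuous hφ.continuous c₂ hr
  exact ⟨m1, m2, m3, m4, hφ, m1.coeFn_toLp, m2.coeFn_toLp, m3.coeFn_toLp, m4.coeFn_toLp⟩

theorem norm_convex_comb_le {F : Type*} [NormedAddCommGroup F] [NormedSpace ℝ F] {t : ℝ}
    (h0 : 0 ≤ t) (h1 : t ≤ 1) (a b : F) : ‖b + t • (a - b)‖ ≤ ‖a‖ + ‖b‖ := by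
  have e : b + t • (a - b) = t • a + (1 - t) • b := by module
  rw [e]
  refine (norm_add_le _ _).trans ?_
  rw [norm_smul, norm_smul, Real.norm_of_nonneg h0, Real.norm_of_nonneg (by linarith)]
  nlinarith [norm_nonneg a, norm_nonneg b]

/-- An admissible function is approximated by one sequence of smooth functions whose traces on both
spheres converge. -/
theorem mem_admissibleSpace (hn : 0 < n) (hr : 0 < r) (hR : 0 < R)
    (h : closedBall c₂ r ⊆ ball c₁ R)
    {u : Euc n → ℝ} {G : Euc n → Euc n} {t : Euc n → ℝ} (ha : IsAdmissible c₁ R c₂ r u G t) :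
    (ha.isH1.memLp.toLp u, ha.isH1.memLp_grad.toLp G, ha.trace_outer.1.toLp t) ∈
      admissibleSpace c₁ R c₂ r := by
  rw [mem_admissibleSpace_iff]
  obtain ⟨-, φ, hφ, φ1, φ2, φ3⟩ := ha.trace_outer
  obtain ⟨-, ψ, hψ, ψ1, ψ2, ψ3⟩ := ha.trace_inner
  obtain ⟨χ, hχ, hχ01, hχ1, hχ0⟩ := exists_cutoff hn hr h
  set μ := volume.restrict (perforatedBall c₁ R c₂ r)
  have hu := ha.isH1.memLp.aestronglyMeasurable
  have hG := ha.isH1.memLp_grad.aestronglyMeasurable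
  -- The two trace conditions provide unrelated sequences, φ for the outer and ψ for the inner
  -- sphere. The glued function equals φ on the outer sphere and ψ on the inner one. Its gradient
  -- has the extra term (φ - ψ)∇χ, which tends to 0 in L² because φ and ψ have the same limit u.
  have hs : ∀ k, ContDiff ℝ ∞ fun x => ψ k x + χ x * (φ k x + (-1) * ψ k x) := fun k =>
    (hψ k).add (hχ.mul ((hφ k).add (contDiff_const.mul (hψ k))))
  have hgrad : ∀ k x, ∇ (fun x => ψ k x + χ x * (φ k x + (-1) * ψ k x)) x =
      ∇ (ψ k) x + χ x • (∇ (φ k) x - ∇ (ψ k) x) + (φ k x - ψ k x) • ∇ χ x := by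
    intro k x
    have s1 : ContDiff ℝ ∞ fun x => (-1) * ψ k x := contDiff_const.mul (hψ k)
    have s2 : ContDiff ℝ ∞ fun x => φ k x + (-1) * ψ k x := (hφ k).add s1
    rw [gradient_add_of_smooth (hψ k) (hχ.mul s2), gradient_mul_of_smooth hχ s2,
      gradient_add_of_smooth (hφ k) s1, gradient_const_mul_of_smooth (hψ k)]
    module
  have mφ : ∀ k, AEStronglyMeasurable (fun x => φ k x - u x) μ := fun k =>
    (hφ k).continuous.aestronglyMeasurable.sub hu
  have mψ : ∀ k, AEStronglyMeasurable (fun x => ψ k x - u x) μ := fun k =>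
    (hψ k).continuous.aestronglyMeasurable.sub hu
  have mφ' : ∀ k, AEStronglyMeasurable (fun x => ∇ (φ k) x - G x) μ := fun k =>
    (continuous_gradient (contDiff_one_of_smooth (hφ k))).aestronglyMeasurable.sub hG
  have mψ' : ∀ k, AEStronglyMeasurable (fun x => ∇ (ψ k) x - G x) μ := fun k =>
    (continuous_gradient (contDiff_one_of_smooth (hψ k))).aestronglyMeasurable.sub hG
  obtain ⟨M, hM⟩ := (isCompact_closedBall c₁ R).exists_bound_of_continuousOn
    (continuous_gradient (contDiff_one_of_smooth hχ)).continuousOn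
  have t0 : Tendsto (fun k => eLpNorm (fun x => φ k x - ψ k x) 2 μ) atTop (𝓝 0) := by
    refine tendsto_eLpNorm_zero_of_le_add mφ mψ (fun k => ae_of_all _ fun x => ?_) φ1 ψ1
    rw [← sub_sub_sub_cancel_right _ _ (u x)]
    exact norm_sub_le _ _
  have t1 : Tendsto (fun k => eLpNorm ((fun x => ψ k x + χ x * (φ k x + (-1) * ψ k x)) - u) 2 μ)
      atTop (𝓝 0) := by
    refine tendsto_eLpNorm_zero_of_le_add mφ mψ (fun k => ae_of_all _ fun x => ?_) φ1 ψ1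
    have := norm_convex_comb_le (hχ01 x).1 (hχ01 x).2 (φ k x - u x) (ψ k x - u x)
    refine (le_of_eq ?_).trans this
    simp only [Pi.sub_apply, smul_eq_mul]
    congr 1
    ring
  have t2' : Tendsto (fun k => eLpNorm (fun x => ∇ (ψ k) x - G x +
      χ x • ((∇ (φ k) x - G x) - (∇ (ψ k) x - G x))) 2 μ) atTop (𝓝 0) :=
    tendsto_eLpNorm_zero_of_le_add mφ' mψ' (fun k => ae_of_all _ fun x =>
      norm_convex_comb_le (hχ01 x).1 (hχ01 x).2 _ _) φ2 ψ2
  have t3' : Tendsto (fun k => eLpNorm (fun x => M * (φ k x - ψ k x)) 2 μ) atTop (𝓝 0) := by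
    have : ∀ k, eLpNorm (fun x => M * (φ k x - ψ k x)) 2 μ =
        ‖M‖ₑ * eLpNorm (fun x => φ k x - ψ k x) 2 μ := fun k =>
      eLpNorm_const_smul M (fun x => φ k x - ψ k x) 2 μ
    simp only [this]
    simpa using ENNReal.Tendsto.const_mul t0 (Or.inr enorm_ne_top)
  have t2 : Tendsto (fun k => eLpNorm ((∇ (fun x => ψ k x + χ x * (φ k x + (-1) * ψ k x))) - G) 2 μ)
      atTop (𝓝 0) := by
    refine tendsto_eLpNorm_zero_of_le_add (fun k => ?_) (fun k => ?_) (fun k => ?_) t2' t3'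
    · exact (mψ' k).add (hχ.continuous.aestronglyMeasurable.smul ((mφ' k).sub (mψ' k)))
    · exact (((hφ k).continuous.sub (hψ k).continuous).const_smul M).aestronglyMeasurable
    · filter_upwards [ae_restrict_mem (measurableSet_perforatedBall c₁ R c₂ r)] with x hx
      have hx' := hM x (ball_subset_closedBall hx.1)
      rw [Pi.sub_apply, hgrad]
      have e : ∇ (ψ k) x + χ x • (∇ (φ k) x - ∇ (ψ k) x) + (φ k x - ψ k x) • ∇ χ x - G x =
          (∇ (ψ k) x - G x + χ x • ((∇ (φ k) x - G x) - (∇ (ψ k) x - G x))) +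
            (φ k x - ψ k x) • ∇ χ x := by module
      rw [e]
      refine (norm_add_le _ _).trans (add_le_add le_rfl ?_)
      rw [norm_smul, norm_mul, mul_comm]
      gcongr
      exact hx'.trans (le_abs_self M)
  have t3 : Tendsto (fun k => eLpNorm ((fun x => ψ k x + χ x * (φ k x + (-1) * ψ k x)) - t) 2
      (surfaceMeasure c₁ R)) atTop (𝓝 0) := by
    refine φ3.congr fun k => eLpNorm_congr_ae ?_
    filter_upwards [ae_surfaceMeasure_mem_sphere c₁ hR.le] with x hx
    simp [hχ1 x hx]
  have t4 : Tendsto (fun k => eLpNorm ((fun x => ψ k x + χ x * (φ k x + (-1) * ψ k x)) - 0) 2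
      (surfaceMeasure c₂ r)) atTop (𝓝 0) := by
    refine ψ3.congr fun k => eLpNorm_congr_ae ?_
    filter_upwards [ae_surfaceMeasure_mem_sphere c₂ hr.le] with x hx
    simp [hχ0 x hx]
  choose m1 m2 m3 m4 hrep using fun k =>
    mem_smoothGraph_toLp (c₁ := c₁) (c₂ := c₂) (R := R) (r := r) hr.le hR.le (hs k)
  refine mem_closure_of_tendsto (b := atTop) (f := fun k =>
    ((m1 k).toLp, (m2 k).toLp, (m3 k).toLp, (m4 k).toLp)) ?_
    (Eventually.of_forall fun k => ⟨_, hrep k⟩)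
  refine Tendsto.prodMk_nhds ?_ (Tendsto.prodMk_nhds ?_ (Tendsto.prodMk_nhds ?_ ?_))
  · exact (Lp.tendsto_Lp_iff_tendsto_eLpNorm'' _ m1 _ ha.isH1.memLp).2 t1
  · exact (Lp.tendsto_Lp_iff_tendsto_eLpNorm'' _ m2 _ ha.isH1.memLp_grad).2 t2
  · exact (Lp.tendsto_Lp_iff_tendsto_eLpNorm'' _ m3 _ ha.trace_outer.1).2 t3
  · have := (Lp.tendsto_Lp_iff_tendsto_eLpNorm'' _ m4 _ ha.trace_inner.1).2 t4
    rwa [MemLp.toLp_zero] at this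

end FunctionSpace

/-! ### Eigenvalues, the variational characterization and the comparison. -/

section Eigenvalues

variable {n : ℕ} {c₁ c₂ : Euc n} {R r : ℝ}

theorem exists_norm_fn_sq_le (hn : 0 < n) (hr : 0 < r) (h : closedBall c₂ r ⊆ ball c₁ R) :
    ∃ C : ℝ, 0 ≤ C ∧ ∀ x ∈ admissibleSpace c₁ R c₂ r, ‖x.1‖ ^ 2 ≤ C * ‖x.2.1‖ ^ 2 := by
  obtain ⟨C, hC, hest⟩ := exists_poincare hn hr h
  refine ⟨C.toReal, ENNReal.toReal_nonneg, fun x hx => ?_⟩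
  have := closure_induction (P := {y : TraceQuad c₁ R c₂ r |
    ‖y.1‖ ^ 2 ≤ C.toReal * (‖y.2.1‖ ^ 2 + ‖y.2.2.2‖ ^ 2)})
    (isClosed_le (by fun_prop) (by fun_prop)) (fun y φ hφ => ?_)
    ((mem_admissibleSpace_iff x).1 hx)
  · simpa using this
  · have h1 := hest φ (contDiff_one_of_smooth hφ.smooth)
    rw [← ofReal_norm_sq_eq_lintegral y.1 hφ.fn, ← ofReal_norm_sq_eq_lintegral y.2.1 hφ.grad,
      ← ofReal_norm_sq_eq_lintegral y.2.2.2 hφ.inner, ← ENNReal.ofReal_toReal hC,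
      ← ENNReal.ofReal_add (sq_nonneg _) (sq_nonneg _), ← ENNReal.ofReal_mul ENNReal.toReal_nonneg,
      ENNReal.ofReal_le_ofReal_iff (by positivity)] at h1
    exact h1

theorem exists_average_functional {Q : Set (Euc n)} (hQ : MeasurableSet Q)
    (hs : Q ⊆ perforatedBall c₁ R c₂ r) :
    ∃ l : Lp ℝ 2 (volume.restrict (perforatedBall c₁ R c₂ r)) →L[ℝ] ℝ,
      ∀ f, l f = ∫ x in Q, f x := by
  have hfin : (volume.restrict (perforatedBall c₁ R c₂ r)) Q ≠ ⊤ := by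
    refine ne_top_of_le_ne_top ((isBounded_perforatedBall c₁ R c₂ r).subset hs).measure_lt_top.ne
      (Measure.restrict_apply_le _ _)
  refine ⟨innerSL ℝ (indicatorConstLp 2 hQ hfin (1 : ℝ)), fun f => ?_⟩
  rw [innerSL_apply_apply, L2.inner_indicatorConstLp_one, Measure.restrict_restrict hQ,
    inter_eq_left.2 hs]

theorem exists_norm_trace_sq_le (hn : 0 < n) (hr : 0 < r) (h : closedBall c₂ r ⊆ ball c₁ R)
    {ε : ℝ} (hε : 0 < ε) :
    ∃ (t : Finset (Fin n → ℤ))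
      (l : (Fin n → ℤ) → Lp ℝ 2 (volume.restrict (perforatedBall c₁ R c₂ r)) →L[ℝ] ℝ) (C : ℝ),
      0 ≤ C ∧ ∀ x ∈ admissibleSpace c₁ R c₂ r,
        ‖x.2.2‖ ^ 2 ≤ ε * ‖x.2.1‖ ^ 2 + C * ∑ k ∈ t, (l k x.1) ^ 2 := by
  obtain ⟨t, Q, C, hC, hQ, hest⟩ := exists_trace_le_averages hn hr h hε
  have hl : ∀ k, ∃ l : Lp ℝ 2 (volume.restrict (perforatedBall c₁ R c₂ r)) →L[ℝ] ℝ,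
      k ∈ t → ∀ f, l f = ∫ x in Q k, f x := by
    intro k
    by_cases hk : k ∈ t
    · obtain ⟨l, hl⟩ := exists_average_functional (hQ k hk).1 (hQ k hk).2
      exact ⟨l, fun _ => hl⟩
    · exact ⟨0, fun h => absurd h hk⟩
  choose l hl using hl
  refine ⟨t, l, C.toReal, ENNReal.toReal_nonneg, fun x hx => ?_⟩
  refine closure_induction (P := {y : TraceQuad c₁ R c₂ r |
    ‖y.2.2.1‖ ^ 2 ≤ ε * ‖y.2.1‖ ^ 2 + C.toReal * ∑ k ∈ t, (l k y.1) ^ 2})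
    (isClosed_le (by fun_prop) (by fun_prop)) (fun y φ hφ => ?_)
    ((mem_admissibleSpace_iff x).1 hx)
  have h1 := hest φ (contDiff_one_of_smooth hφ.smooth)
  have h2 : ∑ k ∈ t, ‖∫ x in Q k, φ x‖ₑ ^ 2 = ENNReal.ofReal (∑ k ∈ t, (l k y.1) ^ 2) := by
    rw [ENNReal.ofReal_sum_of_nonneg fun k _ => sq_nonneg _]
    refine Finset.sum_congr rfl fun k hk => ?_
    have e : ∫ x in Q k, φ x = l k y.1 := by
      rw [hl k hk]
      refine integral_congr_ae ?_
      have := ae_mono (Measure.restrict_mono (hQ k hk).2 le_rfl) hφ.fn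
      filter_upwards [this] with z hz using hz.symm
    rw [e, ← sq_abs, ENNReal.ofReal_pow (abs_nonneg _), ← Real.norm_eq_abs, ofReal_norm]
  have h3 : 0 ≤ ∑ k ∈ t, (l k y.1) ^ 2 := Finset.sum_nonneg fun k _ => sq_nonneg _
  rw [h2, ← ofReal_norm_sq_eq_lintegral y.2.1 hφ.grad,
    ← ofReal_norm_sq_eq_lintegral y.2.2.1 hφ.outer, ← ENNReal.ofReal_toReal hC,
    ← ENNReal.ofReal_mul hε.le, ← ENNReal.ofReal_mul ENNReal.toReal_nonneg,
    ← ENNReal.ofReal_add (by positivity) (by positivity),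
    ENNReal.ofReal_le_ofReal_iff (by positivity)] at h1
  exact h1

/-- Coercivity of the Dirichlet norm. The Poincaré inequality controls the function, and the trace
estimate with ε = 1 controls the outer trace, its finitely many averages being bounded by the norm
of the function. -/
theorem exists_norm_le (hn : 0 < n) (hr : 0 < r) (h : closedBall c₂ r ⊆ ball c₁ R) :
    ∃ C : ℝ, ∀ x ∈ admissibleSpace c₁ R c₂ r, ‖x‖ ≤ C * ‖x.2.1‖ := by
  obtain ⟨C₁, hC₁, h1⟩ := exists_norm_fn_sq_le hn hr h
  obtain ⟨t, l, C₂, hC₂, h2⟩ := exists_norm_trace_sq_le hn hr h one_pos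
  set A := 1 + C₁ + C₂ * ∑ k ∈ t, ‖l k‖ ^ 2 * C₁
  have hA0 : 0 ≤ C₂ * ∑ k ∈ t, ‖l k‖ ^ 2 * C₁ :=
    mul_nonneg hC₂ (Finset.sum_nonneg fun k _ => by positivity)
  have hA : 0 ≤ A := by positivity
  refine ⟨√A, fun x hx => ?_⟩
  have key : ∀ y : ℝ, 0 ≤ y → y ^ 2 ≤ A * ‖x.2.1‖ ^ 2 → y ≤ √A * ‖x.2.1‖ := by
    intro y hy hle
    refine (sq_le_sq₀ hy (by positivity)).1 ?_
    rwa [mul_pow, Real.sq_sqrt hA]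
  have hx1 := h1 x hx
  refine max_le ?_ (max_le ?_ ?_)
  · exact key _ (norm_nonneg _) (hx1.trans (by gcongr; linarith))
  · refine key _ (norm_nonneg _) (le_mul_of_one_le_left (sq_nonneg _) ?_)
    linarith
  · refine key _ (norm_nonneg _) ((h2 x hx).trans ?_)
    have h3 : C₂ * ∑ k ∈ t, (l k x.1) ^ 2 ≤ C₂ * ∑ k ∈ t, ‖l k‖ ^ 2 * C₁ * ‖x.2.1‖ ^ 2 := by
      gcongr with k hk
      rw [← sq_abs, ← Real.norm_eq_abs]
      calc ‖l k x.1‖ ^ 2 ≤ (‖l k‖ * ‖x.1‖) ^ 2 := by gcongr; exact (l k).le_opNorm _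
        _ = ‖l k‖ ^ 2 * ‖x.1‖ ^ 2 := mul_pow _ _ _
        _ ≤ ‖l k‖ ^ 2 * (C₁ * ‖x.2.1‖ ^ 2) := by gcongr
        _ = _ := by ring
    rw [← Finset.sum_mul, ← mul_assoc] at h3
    have h4 : 0 ≤ C₁ * ‖x.2.1‖ ^ 2 := by positivity
    have e : A * ‖x.2.1‖ ^ 2 = 1 * ‖x.2.1‖ ^ 2 + C₁ * ‖x.2.1‖ ^ 2 +
        (C₂ * ∑ k ∈ t, ‖l k‖ ^ 2 * C₁) * ‖x.2.1‖ ^ 2 := by simp only [A]; ring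
    linarith

/-- The radial harmonic function about the centre of the hole, as a test function. -/
theorem exists_test_triple (hn : 2 ≤ n) (hr : 0 < r) (h : closedBall c₂ r ⊆ ball c₁ R) :
    ∃ x ∈ admissibleSpace c₁ R c₂ r,
      R ^ (n - 1) * ((sphereMeasure n).real univ * profile n r R ^ 2) ≤ ‖x.2.2‖ ^ 2 ∧
      ‖x.2.1‖ ^ 2 ≤ profile n r R * (sphereMeasure n).real univ ∧
      (c₁ ≠ c₂ → ‖x.2.1‖ ^ 2 < profile n r R * (sphereMeasure n).real univ) := by
  have hd := dist_add_lt_of_closedBall_subset (by omega) hr h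
  have hd0 : 0 ≤ dist c₂ c₁ := dist_nonneg
  have hR : 0 < R := by linarith
  have hF : 0 ≤ profile n r R := by
    rw [profile_eq_radialResistance hr (by linarith)]
    exact radialResistance_nonneg hr (by linarith)
  have hw := contDiff_radial (n := n) hr c₂
  obtain ⟨m1, m2, m3, m4, hrep⟩ := mem_smoothGraph_toLp (c₁ := c₁) (c₂ := c₂) hr.le hR.le hw
  have h0 : m4.toLp _ = 0 := by
    rw [Lp.eq_zero_iff_ae_eq_zero]
    filter_upwards [m4.coeFn_toLp, ae_surfaceMeasure_mem_sphere c₂ hr.le] with z h1 h2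
    rw [h1, radial, mem_sphere_iff_norm.1 h2, profile_self]
    rfl
  refine ⟨(m1.toLp _, m2.toLp _, m3.toLp _), ?_, ?_, ?_⟩
  · rw [mem_admissibleSpace_iff]
    refine subset_closure ⟨radial n r c₂, ?_⟩
    rw [h0] at hrep
    exact hrep
  · have hm : Measurable fun x => ‖radial n r c₂ x‖ₑ ^ 2 :=
      (hw.continuous.measurable.enorm).pow_const 2
    have hint : Integrable (fun w : sphere (0 : Euc n) 1 =>
        radial n r c₂ (c₁ + R • (w : Euc n)) ^ 2) (sphereMeasure n) :=
      integrable_sphere_of_continuous (hw.continuous.pow 2) c₁ R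
    have e : ENNReal.ofReal (‖m3.toLp (radial n r c₂)‖ ^ 2) = ENNReal.ofReal (R ^ (n - 1) *
        ∫ w : sphere (0 : Euc n) 1, radial n r c₂ (c₁ + R • (w : Euc n)) ^ 2
          ∂(sphereMeasure n)) := by
      rw [ofReal_norm_sq_eq_lintegral _ m3.coeFn_toLp, lintegral_surfaceMeasure c₁ R _ hm,
        ENNReal.ofReal_mul (by positivity), ofReal_integral_eq_lintegral_ofReal hint
          (ae_of_all _ fun w => sq_nonneg _)]
      congr 1
      refine lintegral_congr fun w => ?_
      rw [← sq_abs, ENNReal.ofReal_pow (abs_nonneg _), ← Real.norm_eq_abs, ofReal_norm]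
    rw [ENNReal.ofReal_eq_ofReal_iff (sq_nonneg _)
      (mul_nonneg (by positivity) (integral_nonneg fun w => sq_nonneg _))] at e
    change _ ≤ ‖m3.toLp (radial n r c₂)‖ ^ 2
    rw [e]
    gcongr
    exact le_integral_radial_sq hn hr c₁ c₂ hd
  · have h1 := lintegral_gradient_radial_le hn hr h
    have e : ENNReal.ofReal (profile n r R) * sphereMeasure n univ =
        ENNReal.ofReal (profile n r R * (sphereMeasure n).real univ) := by
      rw [ENNReal.ofReal_mul hF, ofReal_measureReal]
    rw [← ofReal_norm_sq_eq_lintegral _ m2.coeFn_toLp, e] at h1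
    exact ⟨(ENNReal.ofReal_le_ofReal_iff (by positivity)).1 h1.1,
      fun hne => (ENNReal.ofReal_lt_ofReal_iff_of_nonneg (sq_nonneg _)).1 (h1.2 hne)⟩

theorem sphereMeasure_real_univ_pos (hn : 0 < n) : 0 < (sphereMeasure n).real univ := by
  have : Nonempty (Fin n) := ⟨⟨0, hn⟩⟩
  rw [measureReal_def, ENNReal.toReal_pos_iff]
  refine ⟨?_, measure_lt_top _ _⟩
  rw [Measure.measure_univ_pos]
  exact Measure.toSphere_ne_zero _

theorem profile_pos (hr : 0 < r) (hrR : r < R) : 0 < profile n r R := by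
  rw [profile_eq_radialResistance hr (by linarith)]
  exact radialResistance_pos hr hrR

theorem inner_toLp_eq_integral {α F : Type*} [MeasurableSpace α] {μ : Measure α}
    [NormedAddCommGroup F] [InnerProductSpace ℝ F] (f g : Lp F 2 μ) {f' g' : α → F}
    (hf : f =ᵐ[μ] f') (hg : g =ᵐ[μ] g') : inner ℝ f g = ∫ x, inner ℝ (f' x) (g' x) ∂μ := by
  rw [L2.inner_def]
  refine integral_congr_ae ?_
  filter_upwards [hf, hg] with x h1 h2
  rw [h1, h2]

theorem isOpen_perforatedBall (c₁ : Euc n) (R : ℝ) (c₂ : Euc n) (r : ℝ) :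
    IsOpen (perforatedBall c₁ R c₂ r) :=
  isOpen_ball.sdiff isClosed_closedBall

/-- Uniqueness of the weak gradient, by the fundamental lemma of the calculus of variations. It
makes the maximizer a nonzero function, rather than only a nonzero triple. -/
theorem grad_eq_zero_of_fn_eq_zero {u : Euc n → ℝ} {G : Euc n → Euc n} {Ω : Set (Euc n)}
    (hΩ : IsOpen Ω) (hΩb : volume Ω ≠ ⊤) (h : IsH1 Ω u G) (hu : u =ᵐ[volume.restrict Ω] 0) :
    G =ᵐ[volume.restrict Ω] 0 := by
  have : IsFiniteMeasure (volume.restrict Ω) := ⟨by simpa using hΩb.lt_top⟩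
  have hint : IntegrableOn G Ω := h.memLp_grad.integrable (by norm_num)
  rw [EventuallyEq, ae_restrict_iff' hΩ.measurableSet]
  refine hΩ.ae_eq_zero_of_integral_contDiff_smul_eq_zero hint.locallyIntegrableOn
    fun ψ hψ hc hs => ?_
  refine ext_inner_right ℝ fun v => ?_
  have hψ' : ContDiff ℝ ∞ ψ := hψ
  have hsup : ∀ x, x ∉ Ω → ψ x = 0 := fun x hx => image_eq_zero_of_notMem_tsupport fun h' => hx (hs h')
  rw [← setIntegral_eq_integral_of_forall_compl_eq_zero (s := Ω) fun x hx => by simp [hsup x hx]]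
  obtain ⟨C, hC⟩ := hψ'.continuous.bounded_above_of_compact_support hc
  have hi : Integrable (fun x => ψ x • G x) (volume.restrict Ω) :=
    hint.bdd_smul C hψ'.continuous.aestronglyMeasurable (ae_of_all _ hC)
  rw [real_inner_comm, ← integral_inner hi, inner_zero_left]
  have h1 := h.weak_grad ψ hψ' hc hs v
  have h2 : ∫ x in Ω, u x * fderiv ℝ ψ x v = 0 := by
    refine (integral_congr_ae ?_).trans (integral_zero _ _)
    filter_upwards [hu] with x hx
    simp [hx]
  rw [h2, eq_comm, neg_eq_zero] at h1
  rw [← h1]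
  refine integral_congr_ae (ae_of_all _ fun x => ?_)
  simp only [inner_smul_right, real_inner_comm, mul_comm]

theorem eq_zero_of_grad_eq_zero (hn : 0 < n) (hr : 0 < r) (h : closedBall c₂ r ⊆ ball c₁ R)
    {x : TraceTriple c₁ R c₂ r} (hx : x ∈ admissibleSpace c₁ R c₂ r) (h0 : x.2.1 = 0) : x = 0 := by
  obtain ⟨C, hC⟩ := exists_norm_le hn hr h
  have := hC x hx
  rw [h0, norm_zero, mul_zero] at this
  simpa using this

/-- The Euler–Lagrange equation divided by m is the weak eigenvalue equation; every admissible test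
function is available because it belongs to the closed space. -/
theorem isEigenvalue_inv (hn : 0 < n) (hr : 0 < r) (hR : 0 < R) (h : closedBall c₂ r ⊆ ball c₁ R)
    {m : ℝ} (hm : 0 < m) {x : TraceTriple c₁ R c₂ r} (hx : x ∈ admissibleSpace c₁ R c₂ r)
    (hx0 : x.2.1 ≠ 0)
    (hvar : ∀ y ∈ admissibleSpace c₁ R c₂ r, m * inner ℝ x.2.1 y.2.1 = inner ℝ x.2.2 y.2.2) :
    IsEigenvalue c₁ R c₂ r m⁻¹ := by
  have hadm := isAdmissible_of_mem hx
  refine ⟨x.1, x.2.1, x.2.2, hadm, fun h0 => ?_, fun v H s hv => ?_⟩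
  · refine hx0 ((Lp.eq_zero_iff_ae_eq_zero).2 ?_)
    exact grad_eq_zero_of_fn_eq_zero (isOpen_perforatedBall c₁ R c₂ r)
      (isBounded_perforatedBall c₁ R c₂ r).measure_lt_top.ne hadm.isH1 h0
  · have e := hvar _ (mem_admissibleSpace hn hr hR h hv)
    rw [inner_toLp_eq_integral _ _ (ae_eq_refl _) (MemLp.coeFn_toLp _),
      inner_toLp_eq_integral _ _ (ae_eq_refl _) (MemLp.coeFn_toLp _)] at e
    rw [eq_inv_mul_iff_mul_eq₀ hm.ne', e]
    refine integral_congr_ae (ae_of_all _ fun z => ?_)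
    simp [mul_comm]

/-- Test the equation with the eigenfunction itself: ∫|∇u|² = τ ∫ t². The left side is positive,
since a zero gradient would force u = 0. So the trace is nonzero as well, and maximality of m gives
1 ≤ m τ. In particular 0 is not an eigenvalue. -/
theorem inv_le_of_isEigenvalue (hn : 0 < n) (hr : 0 < r) (hR : 0 < R)
    (h : closedBall c₂ r ⊆ ball c₁ R) {m : ℝ} (hm : 0 < m)
    (hmax : ∀ x ∈ admissibleSpace c₁ R c₂ r, ‖x.2.2‖ ^ 2 ≤ m * ‖x.2.1‖ ^ 2) {τ : ℝ}
    (hτ : IsEigenvalue c₁ R c₂ r τ) : m⁻¹ ≤ τ := by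
  obtain ⟨u, G, t, hadm, hu, heq⟩ := hτ
  have hy := mem_admissibleSpace hn hr hR h hadm
  have hG : hadm.isH1.memLp_grad.toLp G ≠ 0 := fun h0 => by
    have h1 : hadm.isH1.memLp.toLp u = 0 :=
      congrArg Prod.fst (eq_zero_of_grad_eq_zero hn hr h hy h0)
    refine hu ?_
    rw [Lp.eq_zero_iff_ae_eq_zero] at h1
    exact hadm.isH1.memLp.coeFn_toLp.symm.trans h1
  have e := heq u G t hadm
  have e1 : ‖hadm.isH1.memLp_grad.toLp G‖ ^ 2 =
      ∫ z in perforatedBall c₁ R c₂ r, inner ℝ (G z) (G z) := by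
    rw [← real_inner_self_eq_norm_sq]
    exact inner_toLp_eq_integral _ _ (MemLp.coeFn_toLp _) (MemLp.coeFn_toLp _)
  have e2 : ‖hadm.trace_outer.1.toLp t‖ ^ 2 = ∫ z, t z * t z ∂(surfaceMeasure c₁ R) := by
    rw [← real_inner_self_eq_norm_sq]
    exact inner_toLp_eq_integral _ _ (MemLp.coeFn_toLp _) (MemLp.coeFn_toLp _)
  rw [← e1, ← e2] at e
  have hle := hmax _ hy
  have hpos : 0 < ‖hadm.isH1.memLp_grad.toLp G‖ ^ 2 := by positivity
  have hb : 0 < ‖hadm.trace_outer.1.toLp t‖ ^ 2 := by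
    rcases (sq_nonneg ‖hadm.trace_outer.1.toLp t‖).eq_or_lt with h0 | h0
    · rw [← h0, mul_zero] at e
      exact absurd e hpos.ne'
    · exact h0
  simp only [e] at hle
  rw [inv_le_iff_one_le_mul₀' hm]
  refine le_of_mul_le_mul_right ?_ hb
  linarith

/-- The reciprocal of the maximum of `∫_{∂B₁} u² / ∫_Ω |∇u|²` is the least nonzero eigenvalue. -/
theorem exists_isLeast_nonzeroEigenvalues (hn : 2 ≤ n) (hr : 0 < r)
    (h : closedBall c₂ r ⊆ ball c₁ R) :
    ∃ m : ℝ, 0 < m ∧ (∀ x ∈ admissibleSpace c₁ R c₂ r, ‖x.2.2‖ ^ 2 ≤ m * ‖x.2.1‖ ^ 2) ∧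
      (∃ x ∈ admissibleSpace c₁ R c₂ r, x.2.1 ≠ 0 ∧ m * ‖x.2.1‖ ^ 2 = ‖x.2.2‖ ^ 2) ∧
      IsLeast (nonzeroEigenvalues c₁ R c₂ r) m⁻¹ := by
  have hn0 : 0 < n := by omega
  have hd := dist_add_lt_of_closedBall_subset hn0 hr h
  have hd0 : 0 ≤ dist c₂ c₁ := dist_nonneg
  have hR : 0 < R := by linarith
  obtain ⟨C₀, hC₀⟩ := exists_norm_le hn0 hr h
  set K := admissibleSpace c₁ R c₂ r
  let g : K →L[ℝ] _ := ((ContinuousLinearMap.fst ℝ _ _).comp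
    (ContinuousLinearMap.snd ℝ _ _)).comp K.subtypeL
  let T : K →L[ℝ] _ := ((ContinuousLinearMap.snd ℝ _ _).comp
    (ContinuousLinearMap.snd ℝ _ _)).comp K.subtypeL
  obtain ⟨m, hm, hmax, ⟨x, hx⟩, hx0, hEL⟩ := exists_maximizer g T (C₀ := C₀)
    (fun x => hC₀ x.1 x.2) (by
      obtain ⟨x, hx, h1, -⟩ := exists_test_triple hn hr h
      refine ⟨⟨x, hx⟩, fun h0 => ?_⟩
      have h0' : x.2.2 = 0 := h0
      rw [h0', norm_zero] at h1
      have : 0 < R ^ (n - 1) * ((sphereMeasure n).real univ * profile n r R ^ 2) :=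
        mul_pos (pow_pos hR _) (mul_pos (sphereMeasure_real_univ_pos hn0)
          (pow_pos (profile_pos hr (by linarith)) _))
      rw [zero_pow two_ne_zero] at h1
      exact this.not_ge h1) (by
      intro ε hε
      obtain ⟨t, l, C, -, hl⟩ := exists_norm_trace_sq_le hn0 hr h hε
      exact ⟨_, t, fun k => (l k).comp ((ContinuousLinearMap.fst ℝ _ _).comp K.subtypeL), C,
        fun x => hl x.1 x.2⟩)
  have hx0' : x.2.1 ≠ 0 := fun h0 => hx0 (Subtype.ext (eq_zero_of_grad_eq_zero hn0 hr h hx h0))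
  have hvar : ∀ y ∈ K, m * inner ℝ x.2.1 y.2.1 = inner ℝ x.2.2 y.2.2 := fun y hy => hEL ⟨y, hy⟩
  have hmax' : ∀ y ∈ K, ‖y.2.2‖ ^ 2 ≤ m * ‖y.2.1‖ ^ 2 := fun y hy => hmax ⟨y, hy⟩
  have hself : m * ‖x.2.1‖ ^ 2 = ‖x.2.2‖ ^ 2 := by
    have := hvar x hx
    rwa [real_inner_self_eq_norm_sq, real_inner_self_eq_norm_sq] at this
  exact ⟨m, hm, hmax', ⟨x, hx, hx0', hself⟩,
    ⟨(inv_pos.2 hm).ne', isEigenvalue_inv hn0 hr hR h hm hx hx0' hvar⟩,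
    fun τ hτ => inv_le_of_isEigenvalue hn0 hr hR h hm hmax' hτ.2⟩

/-- The sharp trace inequality in the concentric case. -/
theorem norm_trace_sq_le_concentric (hn : 0 < n) (hr : 0 < r) (hrR : r < R) (c : Euc n)
    {x : TraceTriple c R c r} (hx : x ∈ admissibleSpace c R c r) :
    ‖x.2.2‖ ^ 2 ≤ R ^ (n - 1) * profile n r R * ‖x.2.1‖ ^ 2 := by
  have hR : 0 < R := hr.trans hrR
  set I := profile n r R with hI
  have hI0 : 0 < I := profile_pos hr hrR
  have hIr : I = radialResistance n r R := profile_eq_radialResistance hr (by linarith)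
  -- Smooth approximants need not vanish on the inner sphere. Young's inequality a² ≤ (1 + δ)(a -
  -- b)² + (1 + 1/δ) b² isolates their inner values b, whose term disappears for the limit; δ → 0
  -- then restores the sharp constant.
  have key : ∀ δ : ℝ, 0 < δ → ‖x.2.2‖ ^ 2 ≤ (1 + δ) * (R ^ (n - 1) * I * ‖x.2.1‖ ^ 2) := by
    intro δ hδ
    have := closure_induction (P := {y : TraceQuad c R c r | ‖y.2.2.1‖ ^ 2 ≤ R ^ (n - 1) *
      ((1 + δ) * (I * ‖y.2.1‖ ^ 2) + (1 + δ⁻¹) * ((r ^ (n - 1))⁻¹ * ‖y.2.2.2‖ ^ 2))})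
      (isClosed_le (by fun_prop) (by fun_prop)) (fun y φ hφ => ?_)
      ((mem_admissibleSpace_iff x).1 hx)
    · have h1 : ‖x.2.2‖ ^ 2 ≤ R ^ (n - 1) *
        ((1 + δ) * (I * ‖x.2.1‖ ^ 2) + (1 + δ⁻¹) *
          ((r ^ (n - 1))⁻¹ * ‖(0 : Lp ℝ 2 (surfaceMeasure c r))‖ ^ 2)) := this
      rw [norm_zero] at h1
      refine h1.trans_eq ?_
      ring
    · have hφ1 := contDiff_one_of_smooth hφ.smooth
      have hm : Measurable fun x => ‖φ x‖ₑ ^ 2 := (hφ1.continuous.measurable.enorm).pow_const 2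
      have h1 := lintegral_sphere_sub_le hn hφ1 c hr hrR.le
      have hpt : ∀ a b : ℝ, ‖a‖ₑ ^ 2 ≤
          ENNReal.ofReal (1 + δ) * ‖a - b‖ₑ ^ 2 + ENNReal.ofReal (1 + δ⁻¹) * ‖b‖ₑ ^ 2 := by
        intro a b
        have e : ∀ z : ℝ, ‖z‖ₑ ^ 2 = ENNReal.ofReal (z ^ 2) := fun z => by
          rw [← sq_abs, ENNReal.ofReal_pow (abs_nonneg _), ← Real.norm_eq_abs, ofReal_norm]
        rw [e, e, e, ← ENNReal.ofReal_mul (by positivity), ← ENNReal.ofReal_mul (by positivity),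
          ← ENNReal.ofReal_add (by positivity) (by positivity)]
        refine ENNReal.ofReal_le_ofReal ?_
        have h5 : 0 ≤ δ⁻¹ * (δ * (a - b) - b) ^ 2 := by positivity
        have h6 : δ⁻¹ * (δ * (a - b) - b) ^ 2 =
            δ * (a - b) ^ 2 - 2 * (a - b) * b + δ⁻¹ * b ^ 2 := by
          field_simp
          ring
        nlinarith
      have h2 : ENNReal.ofReal (‖y.2.2.1‖ ^ 2) ≤ ENNReal.ofReal (R ^ (n - 1)) *
          (ENNReal.ofReal (1 + δ) * (ENNReal.ofReal I * ENNReal.ofReal (‖y.2.1‖ ^ 2)) +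
            ENNReal.ofReal (1 + δ⁻¹) * (ENNReal.ofReal ((r ^ (n - 1))⁻¹) *
              ENNReal.ofReal (‖y.2.2.2‖ ^ 2))) := by
        rw [ofReal_norm_sq_eq_lintegral y.2.1 hφ.grad,
          ofReal_norm_sq_eq_lintegral y.2.2.1 hφ.outer,
          ofReal_norm_sq_eq_lintegral y.2.2.2 hφ.inner, lintegral_surfaceMeasure c R _ hm,
          ENNReal.ofReal_inv_of_pos (pow_pos hr _),
          ← lintegral_sphere_le_surfaceMeasure hr c _ hm, hIr]
        refine mul_le_mul' le_rfl ?_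
        refine (lintegral_mono fun w : sphere (0 : Euc n) 1 => hpt (φ (c + R • (w : Euc n)))
          (φ (c + r • (w : Euc n)))).trans ?_
        have hm2 : Measurable fun w : sphere (0 : Euc n) 1 =>
            ENNReal.ofReal (1 + δ⁻¹) * ‖φ (c + r • (w : Euc n))‖ₑ ^ 2 :=
          (hm.comp (by fun_prop : Measurable fun w : sphere (0 : Euc n) 1 =>
            c + r • (w : Euc n))).const_mul _
        rw [lintegral_add_right _ hm2, lintegral_const_mul' _ _ ENNReal.ofReal_ne_top,
          lintegral_const_mul' _ _ ENNReal.ofReal_ne_top]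
        gcongr
      rw [← ENNReal.ofReal_mul hI0.le, ← ENNReal.ofReal_mul (by positivity),
        ← ENNReal.ofReal_mul (by positivity), ← ENNReal.ofReal_mul (by positivity),
        ← ENNReal.ofReal_add (by positivity) (by positivity),
        ← ENNReal.ofReal_mul (by positivity), ENNReal.ofReal_le_ofReal_iff (by positivity)] at h2
      exact h2
  have hlim : Tendsto (fun δ : ℝ => (1 + δ) * (R ^ (n - 1) * I * ‖x.2.1‖ ^ 2)) (𝓝[>] 0)
      (𝓝 ((1 + 0) * (R ^ (n - 1) * I * ‖x.2.1‖ ^ 2))) :=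
    (Continuous.tendsto (by fun_prop) 0).mono_left nhdsWithin_le_nhds
  rw [add_zero, one_mul] at hlim
  exact ge_of_tendsto hlim (by filter_upwards [self_mem_nhdsWithin] with δ hδ using key δ hδ)

/-- The test function has squared trace norm at least R^(n-1) I² S and squared gradient norm at most
I S, strictly less for distinct centres, where I is the profile at R and S the area of the unit
sphere. The quotient gives the lower bound for m. -/
theorem exists_firstEigenvalue_eq_inv (hn : 2 ≤ n) (hr : 0 < r)
    (h : closedBall c₂ r ⊆ ball c₁ R) :
    ∃ m : ℝ, 0 < m ∧ IsLeast (nonzeroEigenvalues c₁ R c₂ r) m⁻¹ ∧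
      firstEigenvalue c₁ R c₂ r = m⁻¹ ∧ R ^ (n - 1) * profile n r R ≤ m ∧
      (c₁ ≠ c₂ → R ^ (n - 1) * profile n r R < m) := by
  have hn0 : 0 < n := by omega
  have hd := dist_add_lt_of_closedBall_subset hn0 hr h
  have hd0 : 0 ≤ dist c₂ c₁ := dist_nonneg
  obtain ⟨m, hm, hmax, -, hleast⟩ := exists_isLeast_nonzeroEigenvalues hn hr h
  obtain ⟨x, hx, h1, h2, h3⟩ := exists_test_triple hn hr h
  have hF : 0 < profile n r R := profile_pos hr (by linarith)
  have hFS : 0 < profile n r R * (sphereMeasure n).real univ :=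
    mul_pos hF (sphereMeasure_real_univ_pos hn0)
  have h4 := h1.trans (hmax x hx)
  refine ⟨m, hm, hleast, hleast.csInf_eq, ?_, fun hne => ?_⟩
  · refine le_of_mul_le_mul_right ?_ hFS
    nlinarith
  · refine lt_of_mul_lt_mul_right (a := profile n r R * (sphereMeasure n).real univ) ?_ hFS.le
    have := mul_lt_mul_of_pos_left (h3 hne) hm
    nlinarith

/-- The general lower bound for m is attained: the sharp trace inequality, applied to the maximizer,
gives the reverse bound. -/
theorem firstEigenvalue_concentric (hn : 2 ≤ n) (hr : 0 < r) (hrR : r < R) (c : Euc n) :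
    firstEigenvalue c R c r = (R ^ (n - 1) * profile n r R)⁻¹ := by
  have h : closedBall c r ⊆ ball c R := closedBall_subset_ball hrR
  obtain ⟨m, -, hleast, hm, hle, -⟩ := exists_firstEigenvalue_eq_inv hn hr h
  obtain ⟨m', -, -, ⟨x, hx, hx0, he⟩, hleast'⟩ := exists_isLeast_nonzeroEigenvalues hn hr h
  have hmm : m = m' := inv_injective (hleast.unique hleast')
  subst hmm
  rw [hm]
  congr 1
  refine le_antisymm ?_ hle
  have h1 := norm_trace_sq_le_concentric (by omega) hr hrR c hx
  rw [← he] at h1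
  exact le_of_mul_le_mul_right h1 (by positivity)

end Eigenvalues

end DirichletSteklov

end

/-- For fixed radii `0 < r < R`, the first nonzero eigenvalue exists for every position of the two
balls, and it is maximal exactly when they are concentric. -/
theorem theorem1p2 (n : ℕ) (hn : 2 ≤ n) (r R : ℝ) (hr : 0 < r) (hrR : r < R) :
    (∀ c₁ c₂ : EuclideanSpace ℝ (Fin n), closedBall c₂ r ⊆ ball c₁ R →
      IsLeast (DirichletSteklov.nonzeroEigenvalues c₁ R c₂ r)
          (DirichletSteklov.firstEigenvalue c₁ R c₂ r) ∧
        0 < DirichletSteklov.firstEigenvalue c₁ R c₂ r) ∧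
    (∀ c c₁ c₂ : EuclideanSpace ℝ (Fin n), closedBall c₂ r ⊆ ball c₁ R →
      DirichletSteklov.firstEigenvalue c₁ R c₂ r ≤ DirichletSteklov.firstEigenvalue c R c r ∧
        (DirichletSteklov.firstEigenvalue c₁ R c₂ r = DirichletSteklov.firstEigenvalue c R c r ↔
          c₁ = c₂)) := by
  refine ⟨fun c₁ c₂ h => ?_, fun c c₁ c₂ h => ?_⟩
  · obtain ⟨m, hm, hleast, he, -⟩ := DirichletSteklov.exists_firstEigenvalue_eq_inv hn hr h
    rw [he]
    exact ⟨hleast, inv_pos.2 hm⟩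
  · obtain ⟨m, hm, -, he, hle, hlt⟩ := DirichletSteklov.exists_firstEigenvalue_eq_inv hn hr h
    have hpos : 0 < R ^ (n - 1) * DirichletSteklov.profile n r R :=
      mul_pos (pow_pos (hr.trans hrR) _) (DirichletSteklov.profile_pos hr hrR)
    rw [DirichletSteklov.firstEigenvalue_concentric hn hr hrR c]
    refine ⟨?_, fun heq => ?_, fun heq => ?_⟩
    · rw [he]
      exact inv_anti₀ hpos hle
    · by_contra hne
      rw [he] at heq
      exact (hlt hne).ne' (inv_injective heq)
    · subst heq
      exact DirichletSteklov.firstEigenvalue_concentric hn hr hrR c₁
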